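/- Let $X=\{x_1,\dots,x_n\}$ be a finite alphabet, $F(X)$ the free group on $X$, and let $\log^*(k)$ be the least number of times the base-2 logarithm has to be applied to $k$ to obtain a value at most $1$. Running times are measured on a unit-cost machine with finitely many variables and finitely many unary functions (pointer fields) from natural numbers to natural numbers, where each assignment, evaluation or change of one entry of a function, successor, and comparison of two variables costs one step. For words $J_1,\dots,J_m$ in $X^{\pm1}$ let $N=\sum_i|J_i|$ and $H=\langle J_1,\dots,J_m\rangle\le F(X)$. Let $\Gamma$ be the folded graph of $J_1,\dots,J_m$: the result of performing elementary foldings (identifying two edges with the same label and the same incidence at a common vertex, together with their other end points) on the bouquet of $m$ circles labelled $J_1,\dots,J_m$, attached at a base point $v_0$, until no further folding is possible. For each $n$ there are two programs and a constant $C$, depending only on $n$, such that the following hold. (a) Given any $J_1,\dots,J_m$, the first program halts within $C\,(N\log^*(N)+m+1)$ steps (so in time $O(N\log^*(N))$ if all the $J_i$ are nonempty), and its output consists of: - the folded graph $\Gamma$, with its vertices numbered consecutively from $v_0$ and, for each vertex and each letter of $X^{\pm1}$, the vertex reached by reading that letter, if there is one; - the index $[F(X):H]\in\{1,2,\dots\}\cup\{\infty\}$;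 - a Nielsen basis of $H$, written out as a list of reduced words: a free basis of $H$ such that for all $u,v,w$ that are basis elements or inverses of basis elements, $u\ne1$; $|uv|\ge|u|$ and $|uv|\ge|v|$ if $uv\neq1$; and $|uvw|>|u|-|v|+|w|$ if $uv\ne1$ and $vw\neq1$, where $|\cdot|$ is the length of the reduced word; - a Schreier transversal of $H$ (a set of reduced words that contains exactly one representative of each coset $Hg$ and is closed under taking prefixes), given by a spanning tree of $\Gamma$ rooted at $v_0$, stored by parents and letters. If $\tau_v$ is the label of the path in the tree from $v_0$ to the vertex $v$, the transversal consists of the words $\tau_v$ and of the words $\tau_v s$ where $s$ is a nonempty reduced word whose first letter cannot be read in $\Gamma$ at $v$. If $[F(X):H]<\infty$ it is just the set of all $\tau_v$. (b) Given any memory that contains the folded graph $\Gamma$ of some $J_1,\dots,J_m$ in the above form, and any word $w$ in $X^{\pm1}$, the second program decides within $C\,(|w|+1)$ steps whether $w\in H$, and leaves $\Gamma$ intact. -/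

import Mathlib

namespace Folding

/-! ### The iterated logarithm -/

/-- `logStar k` is the least number of applications of the base 2 logarithm after which the
value starting from `k` is at most `1`. -/
noncomputable def logStar (k : ℕ) : ℕ :=
  sInf {j : ℕ | (Real.logb 2)^[j] (k : ℝ) ≤ 1}

/-! ### Words and subgroups -/

/-- A letter of `X ∪ X⁻¹` with `X = {x₀, …, xₙ₋₁}`: `(i, true)` is `xᵢ`, `(i, false)` is its
inverse (the convention of `FreeGroup`). -/
abbrev Letter (n : ℕ) : Type := Fin n × Bool

/-- A word, not necessarily reduced. -/
abbrev Word (n : ℕ) : Type := List (Letter n)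

/-- The sum of the lengths of the words. -/
def totalLength {n : ℕ} (J : List (Word n)) : ℕ := (J.map List.length).sum

/-- The subgroup of the free group generated by the given words. -/
def generated {n : ℕ} (J : List (Word n)) : Subgroup (FreeGroup (Fin n)) :=
  Subgroup.closure {g | ∃ w ∈ J, g = FreeGroup.mk w}

/-- Nielsen reduced sets of elements of a free group: with `u`, `v`, `w` in `S ∪ S⁻¹`,
`u ≠ 1`; `|uv| ≥ |u|, |v|` if `uv ≠ 1`; `|uvw| > |u| - |v| + |w|` if `uv ≠ 1` and `vw ≠ 1`. -/
def IsNielsenReduced {n : ℕ} (S : Set (FreeGroup (Fin n))) : Prop :=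
  let P : Set (FreeGroup (Fin n)) := {g | g ∈ S ∨ g⁻¹ ∈ S}
  (∀ u ∈ P, u ≠ 1) ∧
  (∀ u ∈ P, ∀ v ∈ P, u * v ≠ 1 → u.norm ≤ (u * v).norm ∧ v.norm ≤ (u * v).norm) ∧
  (∀ u ∈ P, ∀ v ∈ P, ∀ w ∈ P, u * v ≠ 1 → v * w ≠ 1 →
    u.norm + w.norm < (u * v * w).norm + v.norm)

/-- The list `U` of reduced words is a Nielsen basis of `H`: its members freely generate `H`
and form a Nielsen reduced set. -/
def IsNielsenBasis {n : ℕ} (H : Subgroup (FreeGroup (Fin n))) (U : List (Word n)) : Prop :=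
  (∀ u ∈ U, FreeGroup.IsReduced u) ∧
  Function.Injective
    (FreeGroup.lift fun i : Fin U.length => (FreeGroup.mk (U.get i) : FreeGroup (Fin n))) ∧
  (FreeGroup.lift fun i : Fin U.length =>
    (FreeGroup.mk (U.get i) : FreeGroup (Fin n))).range = H ∧
  IsNielsenReduced {g : FreeGroup (Fin n) | ∃ u ∈ U, g = FreeGroup.mk u}

/-- A Schreier transversal: one representative in each coset `Hg`, and closed under taking
prefixes of reduced words. -/
def IsSchreierTransversal {n : ℕ} (H : Subgroup (FreeGroup (Fin n)))
    (T : Set (FreeGroup (Fin n))) : Prop :=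
  Subgroup.IsComplement (H : Set (FreeGroup (Fin n))) T ∧
  ∀ g ∈ T, ∀ p : Word n, p <+: g.toWord → FreeGroup.mk p ∈ T

/-! ### Labelled directed graphs and foldings -/

/-- A based directed multigraph with edges labelled by `{x₀, …, xₙ₋₁}`. -/
structure LGraph (n : ℕ) where
  V : Type
  E : Type
  src : E → V
  tgt : E → V
  label : E → Fin n
  base : V

/-- At each vertex there is at most one edge with given label and incidence. -/
def LGraph.IsFolded {n : ℕ} (Γ : LGraph n) : Prop :=
  ∀ e e' : Γ.E, Γ.label e = Γ.label e' → (Γ.src e = Γ.src e' ∨ Γ.tgt e = Γ.tgt e') → e = e'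

/-- `Δ` is (up to isomorphism) obtained from `Γ` by one elementary folding: two distinct edges
`e₁`, `e₂` with the same label and the same incidence at a common vertex are identified, and with
them their other end points; nothing else is identified. -/
def ElementaryFolding {n : ℕ} (Γ Δ : LGraph n) : Prop :=
  ∃ e₁ e₂ : Γ.E, e₁ ≠ e₂ ∧ Γ.label e₁ = Γ.label e₂ ∧
    (Γ.src e₁ = Γ.src e₂ ∨ Γ.tgt e₁ = Γ.tgt e₂) ∧
    ∃ (πV : Γ.V → Δ.V) (πE : Γ.E → Δ.E),
      Function.Surjective πV ∧ Function.Surjective πE ∧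
      (∀ e, Δ.src (πE e) = πV (Γ.src e)) ∧
      (∀ e, Δ.tgt (πE e) = πV (Γ.tgt e)) ∧
      (∀ e, Δ.label (πE e) = Γ.label e) ∧
      Δ.base = πV Γ.base ∧
      (∀ e e', πE e = πE e' ↔ e = e' ∨ (e = e₁ ∧ e' = e₂) ∨ (e = e₂ ∧ e' = e₁)) ∧
      (∀ v v', πV v = πV v' ↔ v = v' ∨
        (v = Γ.src e₁ ∧ v' = Γ.src e₂) ∨ (v = Γ.src e₂ ∧ v' = Γ.src e₁) ∨
        (v = Γ.tgt e₁ ∧ v' = Γ.tgt e₂) ∨ (v = Γ.tgt e₂ ∧ v' = Γ.tgt e₁))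

/-- Vertices of the bouquet: the base point `none`, and `len J_i - 1` inner vertices on the
`i`-th circle. -/
abbrev BouquetV {n : ℕ} (J : List (Word n)) : Type :=
  Option (Σ i : Fin J.length, Fin ((J.get i).length - 1))

/-- The vertex reached after `k` steps along the `i`-th circle. -/
def bouquetPos {n : ℕ} (J : List (Word n)) (i : Fin J.length) (k : ℕ) : BouquetV J :=
  if h : 0 < k ∧ k < (J.get i).length then some ⟨i, ⟨k - 1, by omega⟩⟩ else none

/-- The bouquet of circles, attached at the base point, on which the words of `J` can be read.
The `k`-th edge of the `i`-th circle is directed along the circle if the `k`-th letter of the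
word is a generator, and against it if the letter is an inverse. -/
def bouquet {n : ℕ} (J : List (Word n)) : LGraph n where
  V := BouquetV J
  E := Σ i : Fin J.length, Fin (J.get i).length
  src e := bouquetPos J e.1 (if ((J.get e.1).get e.2).2 then e.2 else e.2 + 1)
  tgt e := bouquetPos J e.1 (if ((J.get e.1).get e.2).2 then e.2 + 1 else e.2)
  label e := ((J.get e.1).get e.2).1
  base := none

/-- `Γ` is the outcome of a folding process on the words `J`: a folded graph reached from the
bouquet by finitely many elementary foldings. -/
def IsFoldedGraphOf {n : ℕ} (J : List (Word n)) (Γ : LGraph n) : Prop :=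
  Relation.ReflTransGen ElementaryFolding (bouquet J) Γ ∧ Γ.IsFolded

/-- `Γ.Step v l w`: the letter `l` can be read along an edge from `v` to `w`. -/
def LGraph.Step {n : ℕ} (Γ : LGraph n) (v : Γ.V) (l : Letter n) (w : Γ.V) : Prop :=
  ∃ e : Γ.E, Γ.label e = l.1 ∧
    ((l.2 = true ∧ Γ.src e = v ∧ Γ.tgt e = w) ∨ (l.2 = false ∧ Γ.src e = w ∧ Γ.tgt e = v))

/-- The set of representatives described by a spanning tree, `τ v` being the label of the path
in the tree from the base point to `v`: the elements `τ v`, and the elements `τ v · s` with `s` a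
nonempty reduced word whose first letter cannot be read in `Γ` at `v`. -/
def LGraph.treeTransversal {n : ℕ} (Γ : LGraph n) (τ : Γ.V → Word n) :
    Set (FreeGroup (Fin n)) :=
  {g | ∃ (v : Γ.V) (s : Word n), FreeGroup.IsReduced s ∧
    (∀ l ∈ s.head?, ¬ ∃ w, Γ.Step v l w) ∧ g = FreeGroup.mk (τ v ++ s)}

/-! ### The machine

Objects are natural numbers. There are registers (variables) and unary functions on objects
(arrays, or pointer fields), indexed by `ℕ`; a program refers to finitely many of them. Each
evaluation or change of one entry, each assignment and each test costs one unit of time. The only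
arithmetic is the successor, so within `t` steps no number exceeds `t` plus the
largest number in the program and in the entries it reads. -/

/-- A memory state. -/
structure State where
  reg : ℕ → ℕ
  arr : ℕ → ℕ → ℕ

/-- Change one register. -/
def State.setReg (σ : State) (r v : ℕ) : State :=
  { σ with reg := Function.update σ.reg r v }

/-- Change one entry of one array. -/
def State.setArr (σ : State) (a i v : ℕ) : State :=
  { σ with arr := Function.update σ.arr a (Function.update (σ.arr a) i v) }

/-- Comparisons of two registers. -/
inductive Test where
  | eq (r s : ℕ)
  | lt (r s : ℕ)

/-- The outcome of a comparison. -/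
def Test.holds (σ : State) : Test → Prop
  | .eq r s => σ.reg r = σ.reg s
  | .lt r s => σ.reg r < σ.reg s

/-- Programs. `const r k` is `r := k`; `copy r s` is `r := s`; `succ r s` is `r := s + 1`;
`load r a s` is `r := a[s]`; `store a r s` is `a[r] := s`, with `r`, `s` registers and `a` an
array. -/
inductive Cmd where
  | skip
  | const (r k : ℕ)
  | copy (r s : ℕ)
  | succ (r s : ℕ)
  | load (r a s : ℕ)
  | store (a r s : ℕ)
  | seq (c d : Cmd)
  | ite (b : Test) (c d : Cmd)
  | loop (b : Test) (c : Cmd)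

/-- `Exec c σ t σ'`: the program `c` started in `σ` halts in `σ'` after exactly `t` steps.
`loop b c` is "while `b` do `c`". -/
inductive Exec : Cmd → State → ℕ → State → Prop where
  | skip (σ) : Exec .skip σ 1 σ
  | const (σ r k) : Exec (.const r k) σ 1 (σ.setReg r k)
  | copy (σ r s) : Exec (.copy r s) σ 1 (σ.setReg r (σ.reg s))
  | succ (σ r s) : Exec (.succ r s) σ 1 (σ.setReg r (σ.reg s + 1))
  | load (σ r a s) : Exec (.load r a s) σ 1 (σ.setReg r (σ.arr a (σ.reg s)))
  | store (σ a r s) : Exec (.store a r s) σ 1 (σ.setArr a (σ.reg r) (σ.reg s))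
  | seq {c d σ₁ σ₂ σ₃ t₁ t₂} : Exec c σ₁ t₁ σ₂ → Exec d σ₂ t₂ σ₃ →
      Exec (.seq c d) σ₁ (t₁ + t₂) σ₃
  | iteTrue {b c d σ σ' t} : b.holds σ → Exec c σ t σ' → Exec (.ite b c d) σ (t + 1) σ'
  | iteFalse {b c d σ σ' t} : ¬ b.holds σ → Exec d σ t σ' → Exec (.ite b c d) σ (t + 1) σ'
  | loopStop {b c σ} : ¬ b.holds σ → Exec (.loop b c) σ 1 σ
  | loopStep {b c σ₁ σ₂ σ₃ t₁ t₂} : b.holds σ₁ → Exec c σ₁ t₁ σ₂ →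
      Exec (.loop b c) σ₂ t₂ σ₃ → Exec (.loop b c) σ₁ (t₁ + t₂ + 1) σ₃

/-! ### Input and output formats -/

/-- The positive number `2i + 1` for `xᵢ` and `2i + 2` for its inverse. -/
def code {n : ℕ} (l : Letter n) : ℕ := 2 * (l.1 : ℕ) + (if l.2 then 1 else 2)

/-- A word is written letter by letter, followed by `0`. -/
def encodeWord {n : ℕ} (w : Word n) : List ℕ := w.map code ++ [0]

/-- Several words are written one after the other. -/
def encodeWords {n : ℕ} (J : List (Word n)) : List ℕ := J.flatMap encodeWord

/-- Array `a` starts with the list `L`. -/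
def State.Holds (σ : State) (a : ℕ) (L : List ℕ) : Prop :=
  ∀ i : Fin L.length, σ.arr a i = L.get i

/-! Locations of input and output. -/

/-- Input: the number of words. -/
def regCount : ℕ := 0
/-- Output: the index, `0` standing for infinity. -/
def regIndex : ℕ := 1
/-- Output: the number of basis elements. -/
def regRank : ℕ := 2
/-- Output: the number of vertices of the folded graph. -/
def regVertices : ℕ := 3
/-- Output: `1` for yes and `0` for no. -/
def regAnswer : ℕ := 4
/-- Input: the generators. -/
def arrInput : ℕ := 0
/-- Input: the word whose membership is asked for. -/
def arrQuery : ℕ := 1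
/-- Output: the parents of the vertices in the spanning tree. -/
def arrParent : ℕ := 2
/-- Output: the letters read from the parents to the vertices. -/
def arrLetter : ℕ := 3
/-- Output: the Nielsen basis. -/
def arrBasis : ℕ := 4
/-- Output: for each letter, the table of its transitions in the folded graph. -/
def arrTable {n : ℕ} (l : Letter n) : ℕ := 4 + code l

/-- The initial memory for the generators `J`; everything but the input is `0`. -/
def inputState {n : ℕ} (J : List (Word n)) : State where
  reg r := if r = regCount then J.length else 0
  arr a i := if a = arrInput then (encodeWords J).getD i 0 else 0

/-- The memory `σ` contains the folded graph `Γ`: the vertices are numbered `1, …, k` by `ν`, the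
base point is `1`, and for each vertex and letter the table of the letter gives the vertex
reached by reading it, and `0` if it cannot be read. -/
def EncodesGraph {n : ℕ} (σ : State) (Γ : LGraph n) (ν : Γ.V → ℕ) : Prop :=
  Function.Injective ν ∧ Set.range ν = Set.Icc 1 (σ.reg regVertices) ∧ ν Γ.base = 1 ∧
  (∀ v l w, Γ.Step v l w → σ.arr (arrTable l) (ν v) = ν w) ∧
  (∀ v l, (¬ ∃ w, Γ.Step v l w) → σ.arr (arrTable l) (ν v) = 0)

/-- The memory `σ` contains a spanning tree of `Γ`, rooted at the base point: for each other vertex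
its parent and the letter read from the parent to it, along an edge of `Γ`. The label of the
path in the tree from the base point to `v` is `τ v`. -/
def EncodesSpanningTree {n : ℕ} (σ : State) (Γ : LGraph n) (ν : Γ.V → ℕ)
    (τ : Γ.V → Word n) : Prop :=
  σ.arr arrParent (ν Γ.base) = 0 ∧ τ Γ.base = [] ∧
  ∀ v, v ≠ Γ.base → ∃ (p : Γ.V) (l : Letter n), Γ.Step p l v ∧
    σ.arr arrParent (ν v) = ν p ∧ σ.arr arrLetter (ν v) = code l ∧ τ v = τ p ++ [l]

end Folding

/-! The proof separates graph theory, amortised analysis and verification of programs.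

Folded graph: a finite bouquet can be folded until it is folded, since each folding removes an edge.
Every graph on the way satisfies `Carries`: the generators label loops at the base, these loops
cover the graph, and there is a label-preserving map to the cosets of `H`. In a folded graph free
reduction does not change the end of a path, so a reduced word lies in `H` exactly if it labels a
loop at the base (`Carries.mem_generated_iff`).

Computing it: each letter of input becomes a separate edge with two new nodes, giving `V = 2N + 1`
nodes, and the incidences are put in a queue of pairs to be joined. Joining two classes merges their
transition tables; two transitions with the same letter put their ends in the queue. A join uses up
a root and adds at most `2n` pairs, so there are `O(nN)` rounds. The classes are kept in a
union-find forest with union by rank and path halving. The potential `∑ min (rk (par x)) (cap (rk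
x))` rises with each halving that does not reach a higher level of the tower function; it is bounded
by `2LV` (`UnionFind.potential_le`) and there are at most `L` levels, with `L = log* N + 2`. Hence a
find costs `O(L)` on average (`findRoot_spec`, `foldLoop_spec`). A morphism `φ` to a folded graph
known to exist shows that nothing is joined wrongly; reading elements of `H` along loops shows that
enough is joined (`FoldInv.rootGraph`).

Output: breadth first search gives a spanning tree in which neighbours differ in depth by at most
one (`GeodesicTree`). Then tree labels are reduced, the maximal readable prefix of a word determines
its coset representative (`GeodesicTree.isSchreierTransversal`), and the index is finite exactly if
every letter can be read everywhere. The loops through the edges outside the tree freely generate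
`H`, because a path determines its sequence of such edges up to free reduction. Comparing depths at
successive edges bounds the length of a reduced path from below, which gives the Nielsen
inequalities (`IsCotree.isNielsenReduced`) and a total basis length of at most `N`
(`IsCotree.sum_length_le`). So the basis can be written in linear time.

Membership: a stack reduces the word, and the result is read in the transition table.

The programs are verified with weakest preconditions that carry the running time; loop invariants
carry a credit for the steps to come, into which potentials can be built. -/

namespace Folding

set_option linter.constructorNameAsVariable false
set_option linter.unusedSimpArgs false

/-! ### Weakest preconditions for the machine -/

/-- `WP c σ Q`: started in `σ`, the program `c` halts in some state after some number of steps that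
together satisfy `Q`. -/
def WP (c : Cmd) (σ : State) (Q : State → ℕ → Prop) : Prop :=
  ∃ t σ', Exec c σ t σ' ∧ Q σ' t

theorem WP.mono {c : Cmd} {σ : State} {Q Q' : State → ℕ → Prop} (h : WP c σ Q)
    (h' : ∀ σ' t, Q σ' t → Q' σ' t) : WP c σ Q' := by
  obtain ⟨t, σ', he, hq⟩ := h
  exact ⟨t, σ', he, h' _ _ hq⟩

-- The rules for the basic commands are equivalences, so that simplification alone executes
-- straight-line programs and adds up their time.
@[simp] theorem wp_skip {σ : State} {Q : State → ℕ → Prop} : WP .skip σ Q ↔ Q σ 1 :=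
  ⟨by rintro ⟨t, σ', he, hq⟩; cases he; exact hq, fun h => ⟨_, _, .skip σ, h⟩⟩

@[simp] theorem wp_const {σ : State} {r k : ℕ} {Q : State → ℕ → Prop} :
    WP (.const r k) σ Q ↔ Q (σ.setReg r k) 1 :=
  ⟨by rintro ⟨t, σ', he, hq⟩; cases he; exact hq, fun h => ⟨_, _, .const σ r k, h⟩⟩

@[simp] theorem wp_copy {σ : State} {r s : ℕ} {Q : State → ℕ → Prop} :
    WP (.copy r s) σ Q ↔ Q (σ.setReg r (σ.reg s)) 1 :=
  ⟨by rintro ⟨t, σ', he, hq⟩; cases he; exact hq, fun h => ⟨_, _, .copy σ r s, h⟩⟩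

@[simp] theorem wp_succ {σ : State} {r s : ℕ} {Q : State → ℕ → Prop} :
    WP (.succ r s) σ Q ↔ Q (σ.setReg r (σ.reg s + 1)) 1 :=
  ⟨by rintro ⟨t, σ', he, hq⟩; cases he; exact hq, fun h => ⟨_, _, .succ σ r s, h⟩⟩

@[simp] theorem wp_load {σ : State} {r a s : ℕ} {Q : State → ℕ → Prop} :
    WP (.load r a s) σ Q ↔ Q (σ.setReg r (σ.arr a (σ.reg s))) 1 :=
  ⟨by rintro ⟨t, σ', he, hq⟩; cases he; exact hq, fun h => ⟨_, _, .load σ r a s, h⟩⟩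

@[simp] theorem wp_store {σ : State} {a r s : ℕ} {Q : State → ℕ → Prop} :
    WP (.store a r s) σ Q ↔ Q (σ.setArr a (σ.reg r) (σ.reg s)) 1 :=
  ⟨by rintro ⟨t, σ', he, hq⟩; cases he; exact hq, fun h => ⟨_, _, .store σ a r s, h⟩⟩

@[simp] theorem wp_seq {σ : State} {c d : Cmd} {Q : State → ℕ → Prop} :
    WP (.seq c d) σ Q ↔ WP c σ fun σ₁ t₁ => WP d σ₁ fun σ₂ t₂ => Q σ₂ (t₁ + t₂) := by
  constructor
  · rintro ⟨t, σ', he, hq⟩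
    cases he with
    | seq h₁ h₂ => exact ⟨_, _, h₁, _, _, h₂, hq⟩
  · rintro ⟨_, _, h₁, _, _, h₂, hq⟩
    exact ⟨_, _, .seq h₁ h₂, hq⟩

@[simp] theorem wp_ite {σ : State} {b : Test} {c d : Cmd} {Q : State → ℕ → Prop} :
    WP (.ite b c d) σ Q ↔ (b.holds σ → WP c σ fun σ' t => Q σ' (t + 1)) ∧
      (¬ b.holds σ → WP d σ fun σ' t => Q σ' (t + 1)) := by
  constructor
  · rintro ⟨t, σ', he, hq⟩
    cases he with
    | iteTrue hb h => exact ⟨fun _ => ⟨_, _, h, hq⟩, fun hn => absurd hb hn⟩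
    | iteFalse hb h => exact ⟨fun hn => absurd hn hb, fun _ => ⟨_, _, h, hq⟩⟩
  · rintro ⟨h₁, h₂⟩
    by_cases hb : b.holds σ
    · obtain ⟨_, _, h, hq⟩ := h₁ hb
      exact ⟨_, _, .iteTrue hb h, hq⟩
    · obtain ⟨_, _, h, hq⟩ := h₂ hb
      exact ⟨_, _, .iteFalse hb h, hq⟩

@[simp] theorem holds_eq {σ : State} {r s : ℕ} : (Test.eq r s).holds σ ↔ σ.reg r = σ.reg s :=
  Iff.rfl

@[simp] theorem holds_lt {σ : State} {r s : ℕ} : (Test.lt r s).holds σ ↔ σ.reg r < σ.reg s :=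
  Iff.rfl

/-- The rule for loops. The invariant `I k σ` holds in `σ` with credit `k` for the steps to come. -/
theorem wp_loop {b : Test} {c : Cmd} (I : ℕ → State → Prop)
    (hI : ∀ k σ, I k σ → b.holds σ → WP c σ fun σ' t => ∃ k', I k' σ' ∧ t + 1 + k' ≤ k)
    {k : ℕ} {σ : State} (h : I k σ) :
    WP (.loop b c) σ fun σ' t => ∃ k', I k' σ' ∧ ¬ b.holds σ' ∧ t + k' ≤ k + 1 := by
  -- Each round uses at least one unit of credit, for the test, so one induction gives both
  -- termination and the time bound. The unused credit `k'` is kept, since amortised bounds read the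
  -- final potential off it; the final `1` pays for the test that fails.
  induction k using Nat.strong_induction_on generalizing σ with
  | _ k ih =>
    by_cases hb : b.holds σ
    · obtain ⟨t, σ₁, he, k₁, h₁, hk⟩ := hI k σ h hb
      obtain ⟨t₂, σ₂, he₂, k₂, h₂, hb₂, hk₂⟩ := ih k₁ (by omega) h₁
      exact ⟨_, _, .loopStep hb he he₂, k₂, h₂, hb₂, by omega⟩
    · exact ⟨_, _, .loopStop hb, k, h, hb, by omega⟩

/-- The rule for loops that run through an interval, with a bound for the cost of each round. -/
theorem wp_for {b : Test} {c : Cmd} (I : ℕ → State → Prop) (cost : ℕ → ℕ) {e : ℕ}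
    (hb : ∀ i σ, I i σ → i ≤ e ∧ (b.holds σ ↔ i < e))
    (hI : ∀ i σ, I i σ → i < e → WP c σ fun σ' t => I (i + 1) σ' ∧ t ≤ cost i)
    {s : ℕ} {σ : State} (h : I s σ) :
    WP (.loop b c) σ fun σ' t => I e σ' ∧ t ≤ ∑ i ∈ Finset.Ico s e, (cost i + 1) + 1 := by
  refine (wp_loop (fun k σ => ∃ i, I i σ ∧ k = ∑ j ∈ Finset.Ico i e, (cost j + 1)) ?_
    ⟨s, h, rfl⟩).mono ?_
  · rintro k σ ⟨i, hi, rfl⟩ hh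
    have hlt := (hb i σ hi).2.1 hh
    refine (hI i σ hi hlt).mono ?_
    rintro σ' t ⟨h', ht⟩
    refine ⟨_, ⟨i + 1, h', rfl⟩, ?_⟩
    rw [Finset.sum_eq_sum_Ico_succ_bot hlt]
    omega
  · rintro σ' t ⟨k', ⟨i, hi, rfl⟩, hn, ht⟩
    have h1 := hb i σ' hi
    rw [h1.2] at hn
    obtain rfl : i = e := by omega
    refine ⟨hi, ?_⟩
    simp at ht
    omega

/-- Consecutive execution. -/
def block : List Cmd → Cmd
  | [] => .skip
  | c :: cs => .seq c (block cs)

@[simp] theorem wp_block_nil {σ : State} {Q : State → ℕ → Prop} : WP (block []) σ Q ↔ Q σ 1 :=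
  wp_skip

@[simp] theorem wp_block_cons {σ : State} {c : Cmd} {cs : List Cmd} {Q : State → ℕ → Prop} :
    WP (block (c :: cs)) σ Q ↔
      WP c σ fun σ₁ t₁ => WP (block cs) σ₁ fun σ₂ t₂ => Q σ₂ (t₁ + t₂) :=
  wp_seq

/-- The rule for blocks that run through a list. -/
theorem wp_block_map {α : Type*} {f : α → Cmd} (I : List α → State → Prop) (cost : α → ℕ)
    {L : List α} (hI : ∀ D a R σ, L = D ++ a :: R → I D σ →
      WP (f a) σ fun σ' t => I (D ++ [a]) σ' ∧ t ≤ cost a)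
    {σ : State} (h : I [] σ) :
    WP (block (L.map f)) σ fun σ' t => I L σ' ∧ t ≤ (L.map cost).sum + 1 := by
  suffices H : ∀ R D σ, L = D ++ R → I D σ →
      WP (block (R.map f)) σ fun σ' t => I L σ' ∧ t ≤ (R.map cost).sum + 1 from H L [] σ rfl h
  intro R
  induction R with
  | nil =>
    intro D σ hL hD
    simp only [List.map_nil, wp_block_nil]
    rw [List.append_nil] at hL
    exact ⟨hL ▸ hD, by simp⟩
  | cons a R ih =>
    intro D σ hL hD
    simp only [List.map_cons, wp_block_cons]
    refine (hI D a R σ hL hD).mono ?_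
    rintro σ₁ t₁ ⟨h₁, ht₁⟩
    refine (ih (D ++ [a]) σ₁ (by simpa using hL) h₁).mono ?_
    rintro σ₂ t₂ ⟨h₂, ht₂⟩
    refine ⟨h₂, ?_⟩
    simp only [List.sum_cons]
    omega

/-! ### What a program leaves unchanged -/

/-- The program does not assign to the register. -/
def Cmd.KeepsReg (x : ℕ) : Cmd → Prop
  | .skip => True
  | .const r _ => x ≠ r
  | .copy r _ => x ≠ r
  | .succ r _ => x ≠ r
  | .load r _ _ => x ≠ r
  | .store _ _ _ => True
  | .seq c d => c.KeepsReg x ∧ d.KeepsReg x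
  | .ite _ c d => c.KeepsReg x ∧ d.KeepsReg x
  | .loop _ c => c.KeepsReg x

/-- The program does not assign to the array. -/
def Cmd.KeepsArr (x : ℕ) : Cmd → Prop
  | .store a _ _ => x ≠ a
  | .seq c d => c.KeepsArr x ∧ d.KeepsArr x
  | .ite _ c d => c.KeepsArr x ∧ d.KeepsArr x
  | .loop _ c => c.KeepsArr x
  | _ => True

/-- `σ'` agrees with `σ` on what `c` leaves unchanged. -/
structure Frame (c : Cmd) (σ σ' : State) : Prop where
  reg : ∀ r, c.KeepsReg r → σ'.reg r = σ.reg r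
  arr : ∀ a, c.KeepsArr a → σ'.arr a = σ.arr a

@[simp] theorem keepsReg_block {x : ℕ} {L : List Cmd} :
    (block L).KeepsReg x ↔ ∀ c ∈ L, c.KeepsReg x := by
  induction L with
  | nil => simp [block, Cmd.KeepsReg]
  | cons c L ih => simp [block, Cmd.KeepsReg, ih]

@[simp] theorem keepsArr_block {x : ℕ} {L : List Cmd} :
    (block L).KeepsArr x ↔ ∀ c ∈ L, c.KeepsArr x := by
  induction L with
  | nil => simp [block, Cmd.KeepsArr]
  | cons c L ih => simp [block, Cmd.KeepsArr, ih]

theorem keepsReg_block_map {α : Type*} {x : ℕ} {L : List α} {f : α → Cmd} :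
    (block (L.map f)).KeepsReg x ↔ ∀ a ∈ L, (f a).KeepsReg x := by
  rw [keepsReg_block, List.forall_mem_map]

theorem keepsArr_block_map {α : Type*} {x : ℕ} {L : List α} {f : α → Cmd} :
    (block (L.map f)).KeepsArr x ↔ ∀ a ∈ L, (f a).KeepsArr x := by
  rw [keepsArr_block, List.forall_mem_map]

@[simp] theorem setReg_reg (σ : State) (r v s : ℕ) :
    (σ.setReg r v).reg s = if s = r then v else σ.reg s := by
  simp [State.setReg, Function.update_apply]

@[simp] theorem setReg_arr (σ : State) (r v : ℕ) : (σ.setReg r v).arr = σ.arr := rfl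

@[simp] theorem setArr_reg (σ : State) (a i v : ℕ) : (σ.setArr a i v).reg = σ.reg := rfl

@[simp] theorem setArr_arr (σ : State) (a i v b : ℕ) :
    (σ.setArr a i v).arr b = if b = a then Function.update (σ.arr a) i v else σ.arr b := by
  simp [State.setArr, Function.update_apply]

/-- Specifications of subprograms need only mention what changes; everything else follows from a
syntactic check of the assignments. -/
theorem Exec.frame {c : Cmd} {σ σ' : State} {t : ℕ} (h : Exec c σ t σ') : Frame c σ σ' := by
  induction h with
  | seq _ _ h₁ h₂ =>
    exact ⟨fun r hr => (h₂.reg r hr.2).trans (h₁.reg r hr.1),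
      fun r hr => (h₂.arr r hr.2).trans (h₁.arr r hr.1)⟩
  | iteTrue _ _ h => exact ⟨fun r hr => h.reg r hr.1, fun r hr => h.arr r hr.1⟩
  | iteFalse _ _ h => exact ⟨fun r hr => h.reg r hr.2, fun r hr => h.arr r hr.2⟩
  | loopStep _ _ _ h₁ h₂ =>
    exact ⟨fun r hr => (h₂.reg r hr).trans (h₁.reg r hr),
      fun r hr => (h₂.arr r hr).trans (h₁.arr r hr)⟩
  | _ =>
    constructor
    · intro r hr
      simp [Cmd.KeepsReg] at hr
      simp [hr]
    · intro r hr
      simp [Cmd.KeepsArr] at hr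
      simp [hr]

theorem WP.frame {c : Cmd} {σ : State} {Q : State → ℕ → Prop} (h : WP c σ Q) :
    WP c σ fun σ' t => Q σ' t ∧ Frame c σ σ' := by
  obtain ⟨t, σ', he, hq⟩ := h
  exact ⟨t, σ', he, hq, he.frame⟩

/-! ### Letters -/

/-- The inverse letter. -/
def linv {n : ℕ} (l : Letter n) : Letter n := (l.1, !l.2)

@[simp] theorem linv_linv {n : ℕ} (l : Letter n) : linv (linv l) = l := by simp [linv]

theorem code_pos {n : ℕ} (l : Letter n) : 0 < code l := by unfold code; split_ifs <;> omega

theorem code_le {n : ℕ} (l : Letter n) : code l ≤ 2 * n := by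
  have := l.1.2
  unfold code
  split_ifs <;> omega

theorem code_injective {n : ℕ} : Function.Injective (code (n := n)) := by
  rintro ⟨a, b⟩ ⟨a', b'⟩ h
  cases b <;> cases b' <;> simp [code] at h ⊢ <;> omega

@[simp] theorem code_inj {n : ℕ} {l l' : Letter n} : code l = code l' ↔ l = l' :=
  code_injective.eq_iff

/-- All letters. -/
noncomputable def letters (n : ℕ) : List (Letter n) := Finset.univ.toList

theorem mem_letters {n : ℕ} (l : Letter n) : l ∈ letters n := by simp [letters]

theorem nodup_letters (n : ℕ) : (letters n).Nodup := Finset.nodup_toList _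

@[simp] theorem length_letters (n : ℕ) : (letters n).length = 2 * n := by
  simp [letters, mul_comm]

/-! ### Names of registers and arrays -/

/-- Names of the registers in use. -/
inductive Reg where
  | words | index | rank | verts | ans | zero | one | pos | w | c | k | cur | a | b | nv | hd | tl
  | p | q | x | y | i | lim | full | r | o | f

/-- The registers are numbered. -/
def Reg.num (r : Reg) : ℕ := r.ctorIdx

instance : Coe Reg ℕ := ⟨Reg.num⟩

@[simp] theorem Reg.num_inj {r s : Reg} : r.num = s.num ↔ r = s := by
  refine ⟨fun h => ?_, fun h => h ▸ rfl⟩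
  cases r <;> cases s <;> first | rfl | cases h

/-- Names of the arrays in use. -/
inductive Arr (n : ℕ) where
  | input | query | parent | letter | basis
  | tbl (l : Letter n) | tr (l : Letter n)
  | par | rk | qa | qb | rt | root | num | nxt | inv | stk | prd

/-- The arrays are numbered. -/
def Arr.id {n : ℕ} : Arr n → ℕ
  | .input => 0
  | .query => 1
  | .parent => 2
  | .letter => 3
  | .basis => 4
  | .tbl l => 4 + code l
  | .tr l => 4 + 2 * n + code l
  | .par => 5 + 4 * n
  | .rk => 6 + 4 * n
  | .qa => 7 + 4 * n
  | .qb => 8 + 4 * n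
  | .rt => 9 + 4 * n
  | .root => 10 + 4 * n
  | .num => 11 + 4 * n
  | .nxt => 12 + 4 * n
  | .inv => 13 + 4 * n
  | .stk => 14 + 4 * n
  | .prd => 15 + 4 * n

instance {n : ℕ} : CoeOut (Arr n) ℕ := ⟨Arr.id⟩

@[simp] theorem Arr.id_inj {n : ℕ} {a b : Arr n} : a.id = b.id ↔ a = b := by
  refine ⟨fun h => ?_, fun h => h ▸ rfl⟩
  have hl : ∀ l : Letter n, 0 < code l ∧ code l ≤ 2 * n := fun l => ⟨code_pos l, code_le l⟩
  cases a with
  | tbl l =>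
    have := hl l
    cases b with
    | tbl l' => simp [Arr.id] at h; rw [h]
    | tr l' => have := hl l'; simp only [Arr.id] at h; omega
    | _ => simp only [Arr.id] at h; omega
  | tr l =>
    have := hl l
    cases b with
    | tr l' => simp [Arr.id] at h; rw [h]
    | tbl l' => have := hl l'; simp only [Arr.id] at h; omega
    | _ => simp only [Arr.id] at h; omega
  | _ =>
    cases b with
    | tbl l' => have := hl l'; simp only [Arr.id] at h; omega
    | tr l' => have := hl l'; simp only [Arr.id] at h; omega
    | _ => first | rfl | (simp only [Arr.id] at h; omega)

/-! ### Case distinction on letters in constant time. -/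

/-- Run `f l` for the letter `l` whose code is in the register `c`. -/
noncomputable def dispatch {n : ℕ} (f : Letter n → Cmd) : Cmd :=
  block ((letters n).map fun l =>
    block [.const Reg.k (code l), .ite (.eq Reg.c Reg.k) (f l) .skip])

theorem dispatch_keepsReg {n : ℕ} {f : Letter n → Cmd} {r : Reg} (h : r ≠ .k)
    (hf : ∀ l, (f l).KeepsReg r) : (dispatch f).KeepsReg r := by
  unfold dispatch
  rw [keepsReg_block_map]
  intro l _
  simp [Cmd.KeepsReg, h, hf]

theorem dispatch_keepsArr {n : ℕ} {f : Letter n → Cmd} {a : Arr n}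
    (hf : ∀ l, (f l).KeepsArr a) : (dispatch f).KeepsArr a := by
  unfold dispatch
  rw [keepsArr_block_map]
  intro l _
  simp [Cmd.KeepsArr, hf]

theorem setReg_setReg (σ : State) (r v v' : ℕ) :
    (σ.setReg r v).setReg r v' = σ.setReg r v' := by
  simp [State.setReg]

theorem setReg_self (σ : State) (r : ℕ) : σ.setReg r (σ.reg r) = σ := by
  simp [State.setReg]

/-- Arrays cannot be addressed by registers, so a letter read at run time is compared with all `2 *
n` codes. Only one branch runs, because no branch changes the register `c`. The comparisons
overwrite `k`, hence the requirement that `Q` is insensitive to it. -/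
theorem wp_dispatch {n : ℕ} {f : Letter n → Cmd} {σ : State} {l : Letter n} {Q : State → Prop}
    {T : ℕ} (hc : σ.reg Reg.c = code l) (hf : ∀ l, (f l).KeepsReg Reg.c)
    (hQ : ∀ σ' v, Q σ' → Q (σ'.setReg Reg.k v))
    (h : WP (f l) (σ.setReg Reg.k (code l)) fun σ' t => Q σ' ∧ t ≤ T) :
    WP (dispatch f) σ fun σ' t => Q σ' ∧ t ≤ 2 * n * (T + 4) + 1 := by
  refine (wp_block_map (L := letters n) (fun D σ' => σ'.reg Reg.c = code l ∧
    (l ∉ D → ∃ v, σ' = σ.setReg Reg.k v) ∧ (l ∈ D → Q σ')) (fun _ => T + 4) ?_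
    ⟨hc, fun _ => ⟨_, (setReg_self σ Reg.k).symm⟩, by simp⟩).mono ?_
  · rintro D a R σ₁ hL ⟨h₁, h₂, h₃⟩
    simp only [wp_block_cons, wp_const, wp_ite, wp_skip, wp_block_nil, holds_eq, setReg_reg]
    simp only [Reg.num_inj, reduceCtorEq, if_false, if_true, h₁, code_inj]
    constructor
    · rintro rfl
      have hD : l ∉ D := by
        have := nodup_letters n
        rw [hL, List.nodup_append] at this
        exact fun hl => this.2.2 l hl l (by simp) rfl
      obtain ⟨v, rfl⟩ := h₂ hD
      rw [setReg_setReg]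
      refine h.frame.mono ?_
      rintro σ' t ⟨⟨hq, ht⟩, hfr⟩
      refine ⟨⟨?_, by simp, fun _ => hq⟩, by omega⟩
      rw [hfr.reg _ (hf l)]
      simpa using hc
    · intro hne
      refine ⟨⟨trivial, ?_, ?_⟩, by omega⟩
      · intro hl
        obtain ⟨v, rfl⟩ := h₂ fun h' => hl (by simp [h'])
        exact ⟨_, setReg_setReg _ _ _ _⟩
      · intro hl
        simp [hne] at hl
        exact hQ _ _ (h₃ hl)
  · rintro σ' t ⟨⟨_, _, h₃⟩, ht⟩
    refine ⟨h₃ (mem_letters l), ?_⟩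
    simpa using ht

/-! ### Towers of powers of two and the iterated logarithm -/

/-- The tower function `0, 1, 2, 4, 16, …`. -/
def tower : ℕ → ℕ
  | 0 => 0
  | k + 1 => 2 ^ tower k

theorem tower_lt_succ (k : ℕ) : tower k < tower (k + 1) := Nat.lt_two_pow_self

theorem tower_strictMono : StrictMono tower := strictMono_nat_of_lt_succ tower_lt_succ

theorem exists_lt_tower (r : ℕ) : ∃ k, r < tower k :=
  ⟨r + 1, lt_of_lt_of_le r.lt_succ_self tower_strictMono.le_apply⟩

/-- The level of a rank: the least `k` such that the rank is below `tower k`. -/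
def level (r : ℕ) : ℕ := Nat.find (exists_lt_tower r)

/-- The least value of the tower function above `r`. -/
def cap (r : ℕ) : ℕ := tower (level r)

theorem lt_cap (r : ℕ) : r < cap r := Nat.find_spec (exists_lt_tower r)

theorem level_le {r L : ℕ} (h : r < tower L) : level r ≤ L := Nat.find_min' _ h

theorem level_mono {r s : ℕ} (h : r ≤ s) : level r ≤ level s :=
  level_le (h.trans_lt (lt_cap s))

theorem cap_mono {r s : ℕ} (h : r ≤ s) : cap r ≤ cap s :=
  tower_strictMono.monotone (level_mono h)

/-- The alternative in the analysis of path halving: an ancestor whose rank has reached the cap of a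
node belongs to a higher level, and this can happen at most once per level on a path. -/
theorem level_lt_of_cap_le {r s : ℕ} (h : cap r ≤ s) : level r < level s :=
  tower_strictMono.lt_iff_lt.1 (h.trans_lt (lt_cap s))

theorem cap_eq {r L : ℕ} (h : tower L ≤ r) (h' : r < tower (L + 1)) : cap r = tower (L + 1) := by
  have h₁ : level r ≤ L + 1 := level_le h'
  have h₂ : L < level r := tower_strictMono.lt_iff_lt.1 (h.trans_lt (lt_cap r))
  rw [cap, show level r = L + 1 by omega]

/-- Undoing one logarithm costs one exponential. Nonpositive arguments are bounded trivially, so the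
values of `Real.logb` there do not matter. -/
theorem le_tower_of_logb_iterate {j : ℕ} : ∀ {x : ℝ}, (Real.logb 2)^[j] x ≤ 1 →
    x ≤ tower (j + 1) := by
  induction j with
  | zero => intro x h; simpa [tower] using h
  | succ j ih =>
    intro x h
    rw [Function.iterate_succ_apply] at h
    have h₁ := ih h
    rcases le_or_gt x 0 with hx | hx
    · exact hx.trans (Nat.cast_nonneg _)
    · rw [Real.logb_le_iff_le_rpow (by norm_num) hx, Real.rpow_natCast] at h₁
      rw [show tower (j + 1 + 1) = 2 ^ tower (j + 1) from rfl]
      exact_mod_cast h₁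

/-- Shows that the set in `logStar` is nonempty, so that its infimum is attained and is not the
default value `0`. The induction uses `log₂ (k + 3) ≤ k + 2`. -/
theorem exists_logb_iterate_le (k : ℕ) : ∀ x : ℝ, x ≤ k + 2 → ∃ j, (Real.logb 2)^[j] x ≤ 1 := by
  induction k with
  | zero =>
    intro x hx
    refine ⟨if x ≤ 1 then 0 else 1, ?_⟩
    split_ifs with h
    · simpa using h
    · rw [Function.iterate_one, Real.logb_le_iff_le_rpow (by norm_num) (by linarith)]
      simpa using hx
  | succ k ih =>
    intro x hx
    rcases le_or_gt x 1 with h | h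
    · exact ⟨0, by simpa using h⟩
    · obtain ⟨j, hj⟩ := ih (Real.logb 2 x) (by
        rw [Real.logb_le_iff_le_rpow (by norm_num) (by linarith)]
        have h2 : k + 3 ≤ 2 ^ (k + 2) := Nat.lt_two_pow_self
        have h3 : ((k : ℝ) + 3) ≤ (2 : ℝ) ^ (k + 2) := by exact_mod_cast h2
        calc x ≤ (k : ℝ) + 3 := by push_cast at hx; linarith
          _ ≤ (2 : ℝ) ^ (k + 2) := h3
          _ = (2 : ℝ) ^ ((k : ℝ) + 2) := by rw [← Real.rpow_natCast]; push_cast; rfl)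
      exact ⟨j + 1, by rwa [Function.iterate_succ_apply]⟩

theorem logb_iterate_logStar (N : ℕ) : (Real.logb 2)^[logStar N] (N : ℝ) ≤ 1 :=
  Nat.sInf_mem (s := {j : ℕ | (Real.logb 2)^[j] (N : ℝ) ≤ 1})
    (exists_logb_iterate_le N N (by linarith))

/-- The left side is the number of nodes of the union-find forest. Two further exponentials absorb
the doubling: `2 ^ (N + 1) ≥ 2 * N + 2`. -/
theorem lt_tower_logStar (N : ℕ) : 2 * N + 1 < tower (logStar N + 3) := by
  have h : N ≤ tower (logStar N + 1) := by
    exact_mod_cast le_tower_of_logb_iterate (logb_iterate_logStar N)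
  have h₁ : N + 1 ≤ tower (logStar N + 2) := lt_of_le_of_lt h (tower_lt_succ _)
  have h₂ : 2 ^ (N + 1) ≤ tower (logStar N + 3) := Nat.pow_le_pow_right (by norm_num) h₁
  have h₃ : N + 1 ≤ 2 ^ N := Nat.lt_two_pow_self
  rw [pow_succ] at h₂
  omega

theorem one_le_logStar {N : ℕ} (h : 2 ≤ N) : 1 ≤ logStar N := by
  by_contra hc
  have h0 : logStar N = 0 := by omega
  have := logb_iterate_logStar N
  rw [h0, Function.iterate_zero, id] at this
  have : N ≤ 1 := by exact_mod_cast this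
  omega

/-! ### The average of the caps over a class. -/

/-- The bound for the average of `cap` over the ranks in a class of rank at most `k`. -/
noncomputable def capSum (k : ℕ) : ℚ := ∑ j ∈ Finset.range (k + 1), (cap j : ℚ) / 2 ^ j

/-- Between `tower L` and `tower (L + 1) = 2 ^ tower L` the cap is constantly `2 ^ tower L`, and the
tail of the geometric series from `tower L` on is `2 / 2 ^ tower L`. So each level contributes at
most `2`. -/
theorem sum_cap_le (L : ℕ) : ∑ j ∈ Finset.range (tower L), (cap j : ℚ) / 2 ^ j ≤ 2 * L := by
  induction L with
  | zero => simp [tower]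
  | succ L ih =>
    rw [← Finset.sum_range_add_sum_Ico _ (tower_lt_succ L).le]
    have h : ∑ j ∈ Finset.Ico (tower L) (tower (L + 1)), (cap j : ℚ) / 2 ^ j =
        2 ^ tower L * ∑ j ∈ Finset.Ico (tower L) (tower (L + 1)), (1 / 2 : ℚ) ^ j := by
      rw [Finset.mul_sum]
      refine Finset.sum_congr rfl fun j hj => ?_
      rw [Finset.mem_Ico] at hj
      rw [cap_eq hj.1 hj.2, tower]
      push_cast
      rw [div_pow, one_pow]
      ring
    have h' : ∑ j ∈ Finset.Ico (tower L) (tower (L + 1)), (1 / 2 : ℚ) ^ j ≤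
        (1 / 2) ^ tower L / (1 - 1 / 2) := geom_sum_Ico_le_of_lt_one (by norm_num) (by norm_num)
    have h'' : (2 : ℚ) ^ tower L * ((1 / 2) ^ tower L / (1 - 1 / 2)) = 2 := by
      rw [div_pow, one_pow]
      field_simp
      norm_num
    rw [h]
    have := mul_le_mul_of_nonneg_left h' (show (0 : ℚ) ≤ 2 ^ tower L by positivity)
    rw [h''] at this
    push_cast
    linarith

theorem capSum_mono {j k : ℕ} (h : j ≤ k) : capSum j ≤ capSum k := by
  unfold capSum
  refine Finset.sum_le_sum_of_subset_of_nonneg ?_ fun _ _ _ => by positivity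
  intro x
  simp only [Finset.mem_range]
  omega

theorem capSum_le {k L : ℕ} (h : k < tower L) : capSum k ≤ 2 * L := by
  refine le_trans ?_ (sum_cap_le L)
  unfold capSum
  refine Finset.sum_le_sum_of_subset_of_nonneg ?_ fun _ _ _ => by positivity
  intro x
  simp only [Finset.mem_range]
  omega

/-! ### Union-find forests -/

/-- The class of `r` among the nodes `1, …, V`. -/
def classOf (V : ℕ) (rep : ℕ → ℕ) (r : ℕ) : Finset ℕ := (Finset.Icc 1 V).filter (rep · = r)

/-- The parents `par` and ranks `rk` form a union-find forest on the nodes `1, …, V`, in which `x`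
belongs to the tree with root `rep x`. Roots have parent `0`. -/
structure UnionFind (V : ℕ) (par rk rep : ℕ → ℕ) : Prop where
  rk_zero : rk 0 = 0
  par_le : ∀ x ∈ Finset.Icc 1 V, par x ≤ V
  rep_mem : ∀ x ∈ Finset.Icc 1 V, rep x ∈ Finset.Icc 1 V
  par_rep : ∀ x ∈ Finset.Icc 1 V, par (rep x) = 0
  rep_par : ∀ x ∈ Finset.Icc 1 V, par x ≠ 0 → rep (par x) = rep x
  rep_root : ∀ x ∈ Finset.Icc 1 V, par x = 0 → rep x = x
  rk_lt : ∀ x ∈ Finset.Icc 1 V, par x ≠ 0 → rk x < rk (par x)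
  size : ∀ x ∈ Finset.Icc 1 V, par x = 0 → 2 ^ rk x ≤ (classOf V rep x).card
  -- Bounds the average cap in a tree by a quantity of the rank of its root. This takes the place of
  -- the usual count of the nodes of each rank, and it can be maintained under linking.
  weight : ∀ x ∈ Finset.Icc 1 V, par x = 0 →
    ∑ y ∈ classOf V rep x, (cap (rk y) : ℚ) ≤ capSum (rk x) * (classOf V rep x).card

/-- The potential that pays for path compressions. -/
def potential (V : ℕ) (par rk : ℕ → ℕ) : ℕ :=
  ∑ x ∈ Finset.Icc 1 V, min (rk (par x)) (cap (rk x))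

/-- The number of roots. -/
def rootCount (V : ℕ) (par : ℕ → ℕ) : ℕ := ((Finset.Icc 1 V).filter (par · = 0)).card

theorem unionFind_init (V : ℕ) : UnionFind V (fun _ => 0) (fun _ => 0) id where
  rk_zero := rfl
  par_le _ _ := Nat.zero_le _
  rep_mem _ h := h
  par_rep _ _ := rfl
  rep_par _ _ h := absurd rfl h
  rep_root _ _ _ := rfl
  rk_lt _ _ h := absurd rfl h
  size x hx _ := by
    simp only [pow_zero, Finset.one_le_card]
    exact ⟨x, by simpa [classOf] using hx⟩
  weight x hx _ := by
    rw [Finset.sum_const, nsmul_eq_mul, mul_comm]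
    simp [capSum]

namespace UnionFind

variable {V : ℕ} {par rk rep : ℕ → ℕ}

theorem par_mem (h : UnionFind V par rk rep) {x : ℕ} (hx : x ∈ Finset.Icc 1 V) (hp : par x ≠ 0) :
    par x ∈ Finset.Icc 1 V :=
  Finset.mem_Icc.2 ⟨Nat.pos_of_ne_zero hp, h.par_le x hx⟩

theorem rep_rep (h : UnionFind V par rk rep) {x : ℕ} (hx : x ∈ Finset.Icc 1 V) :
    rep (rep x) = rep x := h.rep_root _ (h.rep_mem x hx) (h.par_rep x hx)

/-- Path halving keeps the classes. -/
theorem halve (h : UnionFind V par rk rep) {x : ℕ} (hx : x ∈ Finset.Icc 1 V) (hp : par x ≠ 0)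
    (hq : par (par x) ≠ 0) : UnionFind V (Function.update par x (par (par x))) rk rep := by
  have hpm := h.par_mem hx hp
  have hqm := h.par_mem hpm hq
  have hzero : ∀ y, Function.update par x (par (par x)) y = 0 ↔ par y = 0 := by
    intro y
    by_cases hy : y = x
    · subst hy; simp [hp, hq]
    · simp [hy]
  refine ⟨h.rk_zero, ?_, h.rep_mem, fun y hy => (hzero _).2 (h.par_rep y hy), ?_,
    fun y hy h0 => h.rep_root y hy ((hzero _).1 h0), ?_,
    fun y hy h0 => h.size y hy ((hzero _).1 h0), fun y hy h0 => h.weight y hy ((hzero _).1 h0)⟩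
  · intro y hy
    by_cases hyx : y = x
    · subst hyx; simpa using (Finset.mem_Icc.1 hqm).2
    · simpa [hyx] using h.par_le y hy
  · intro y hy
    by_cases hyx : y = x
    · subst hyx; simp [h.rep_par _ hpm hq, h.rep_par _ hx hp]
    · simpa [hyx] using h.rep_par y hy
  · intro y hy
    by_cases hyx : y = x
    · subst hyx
      intro _
      simpa using (h.rk_lt _ hx hp).trans (h.rk_lt _ hpm hq)
    · simpa [hyx] using h.rk_lt y hy

/-- Path halving raises the potential unless it leads to a node of higher level. -/
theorem potential_halve (h : UnionFind V par rk rep) {x : ℕ} (hx : x ∈ Finset.Icc 1 V)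
    (hp : par x ≠ 0) (hq : par (par x) ≠ 0) :
    potential V par rk + level (rk x) + 1 ≤
      potential V (Function.update par x (par (par x))) rk + level (rk (par (par x))) := by
  have hpm := h.par_mem hx hp
  have h₁ := h.rk_lt _ hx hp
  have h₂ := h.rk_lt _ hpm hq
  have hl : level (rk x) ≤ level (rk (par (par x))) := level_mono (by omega)
  unfold potential
  rw [← Finset.add_sum_erase _ _ hx, ← Finset.add_sum_erase _ _ hx]
  have he : ∑ y ∈ (Finset.Icc 1 V).erase x,
      min (rk (Function.update par x (par (par x)) y)) (cap (rk y)) =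
      ∑ y ∈ (Finset.Icc 1 V).erase x, min (rk (par y)) (cap (rk y)) := by
    refine Finset.sum_congr rfl fun y hy => ?_
    rw [Function.update_of_ne (Finset.ne_of_mem_erase hy)]
  rw [he, Function.update_self]
  -- Ranks increase strictly along parents. Below the cap the summand of `x` therefore grows by at
  -- least one; from the cap on, the grandparent has a higher level than `x`.
  rcases lt_or_ge (rk (par x)) (cap (rk x)) with hc | hc
  · have : min (rk (par x)) (cap (rk x)) < min (rk (par (par x))) (cap (rk x)) := by
      rw [min_eq_left hc.le]
      exact lt_min h₂ hc
    omega
  · have := level_lt_of_cap_le (hc.trans h₂.le)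
    have : min (rk (par x)) (cap (rk x)) ≤ min (rk (par (par x))) (cap (rk x)) :=
      min_le_min_right _ h₂.le
    omega

/-- A root of rank `r` has at least `2 ^ r` nodes in its class, so `2 ^ r ≤ V < 2 ^ tower L`. A node
of largest rank among those violating the bound would have to be a root, as ranks increase towards
the root. -/
theorem rk_lt_tower (h : UnionFind V par rk rep) {L : ℕ} (hL : V < tower (L + 1)) {x : ℕ}
    (hx : x ∈ Finset.Icc 1 V) : rk x < tower L := by
  have hroot : ∀ r ∈ Finset.Icc 1 V, par r = 0 → rk r < tower L := by
    intro r hr h0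
    have h₁ := h.size r hr h0
    have h₂ : (classOf V rep r).card ≤ V := by
      refine (Finset.card_filter_le _ _).trans ?_
      simp
    exact (Nat.pow_lt_pow_iff_right (by norm_num : 1 < 2)).1 ((h₁.trans h₂).trans_lt hL)
  have key : ∀ d x, x ∈ Finset.Icc 1 V → tower L + d = rk x → False := by
    by_contra hc
    push Not at hc
    obtain ⟨d, x, hx, hd⟩ := hc
    obtain ⟨x, hx', hmax⟩ := Finset.exists_max_image
      ((Finset.Icc 1 V).filter fun x => tower L ≤ rk x) rk
      ⟨x, Finset.mem_filter.2 ⟨hx, by omega⟩⟩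
    rw [Finset.mem_filter] at hx'
    by_cases h0 : par x = 0
    · have := hroot x hx'.1 h0
      omega
    · have h₁ := h.rk_lt x hx'.1 h0
      have := hmax (par x) (Finset.mem_filter.2 ⟨h.par_mem hx'.1 h0, by omega⟩)
      omega
  by_contra hc
  exact key (rk x - tower L) x hx (by omega)

/-- Each summand is at most the cap of its node; the caps are added up class by class, where
`weight` bounds their average by `capSum`, hence by `2 * L`. -/
theorem potential_le (h : UnionFind V par rk rep) {L : ℕ} (hL : V < tower (L + 1)) :
    potential V par rk ≤ 2 * L * V := by
  have h₁ : (potential V par rk : ℚ) ≤ ∑ x ∈ Finset.Icc 1 V, (cap (rk x) : ℚ) := by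
    unfold potential
    push_cast
    refine Finset.sum_le_sum fun x _ => min_le_right _ _
  have h₂ : ∑ x ∈ Finset.Icc 1 V, (cap (rk x) : ℚ) =
      ∑ r ∈ (Finset.Icc 1 V).filter (par · = 0), ∑ x ∈ classOf V rep r, (cap (rk x) : ℚ) := by
    unfold classOf
    rw [Finset.sum_fiberwise_of_maps_to]
    intro x hx
    exact Finset.mem_filter.2 ⟨h.rep_mem x hx, h.par_rep x hx⟩
  have h₃ : (V : ℚ) = ∑ r ∈ (Finset.Icc 1 V).filter (par · = 0), ((classOf V rep r).card : ℚ) := by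
    have := Finset.card_eq_sum_card_fiberwise (f := rep) (s := Finset.Icc 1 V)
      (t := (Finset.Icc 1 V).filter (par · = 0))
      (fun x hx => Finset.mem_filter.2 ⟨h.rep_mem x hx, h.par_rep x hx⟩)
    rw [Nat.card_Icc] at this
    simp only [Nat.add_sub_cancel] at this
    exact_mod_cast this
  have h₄ : (potential V par rk : ℚ) ≤ 2 * L * V := by
    refine h₁.trans ?_
    rw [h₂, h₃, Finset.mul_sum]
    refine Finset.sum_le_sum fun r hr => ?_
    rw [Finset.mem_filter] at hr
    refine (h.weight r hr.1 hr.2).trans ?_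
    refine mul_le_mul_of_nonneg_right ?_ (by positivity)
    exact capSum_le (h.rk_lt_tower hL hr.1)
  exact_mod_cast h₄

/-- The representatives after the class of `x` has been joined to that of `y`. -/
def joinRep (rep : ℕ → ℕ) (x y : ℕ) : ℕ → ℕ := fun z => if rep z = x then y else rep z

theorem classOf_joinRep {x y : ℕ} (hxy : x ≠ y) :
    classOf V (joinRep rep x y) y = classOf V rep x ∪ classOf V rep y := by
  ext z
  rw [Finset.mem_union]
  unfold classOf
  rw [Finset.mem_filter, Finset.mem_filter, Finset.mem_filter]
  unfold joinRep
  by_cases h : rep z = x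
  · simp [h, hxy]
  · simp [h]

theorem classOf_joinRep_of_ne {x y r : ℕ} (hx : r ≠ x) (hy : r ≠ y) :
    classOf V (joinRep rep x y) r = classOf V rep r := by
  ext z
  unfold classOf
  rw [Finset.mem_filter, Finset.mem_filter]
  unfold joinRep
  by_cases h : rep z = x
  · simp [h, hx.symm, hy.symm]
  · simp [h]

/-- The rank of the root after the root `x` has been attached to it. -/
def joinRk (rk : ℕ → ℕ) (x y : ℕ) : ℕ → ℕ :=
  Function.update rk y (if rk x = rk y then rk y + 1 else rk y)

theorem le_joinRk {x y : ℕ} (z : ℕ) : rk z ≤ joinRk rk x y z := by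
  unfold joinRk
  by_cases h : z = y
  · subst h; rw [Function.update_self]; split_ifs <;> omega
  · rw [Function.update_of_ne h]

/-- Joining two trees, the root of lower rank becoming a child of the other. -/
theorem link (h : UnionFind V par rk rep) {x y : ℕ} (hx : x ∈ Finset.Icc 1 V)
    (hy : y ∈ Finset.Icc 1 V) (hx0 : par x = 0) (hy0 : par y = 0) (hxy : x ≠ y)
    (hr : rk x ≤ rk y) :
    UnionFind V (Function.update par x y) (joinRk rk x y) (joinRep rep x y) := by
  have hy1 : y ≠ 0 := by rw [Finset.mem_Icc] at hy; omega
  have hrx := h.rep_root x hx hx0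
  have hry := h.rep_root y hy hy0
  have hdisj : Disjoint (classOf V rep x) (classOf V rep y) := by
    rw [Finset.disjoint_left]
    intro z hz hz'
    simp only [classOf, Finset.mem_filter] at hz hz'
    exact hxy (hz.2.symm.trans hz'.2)
  have hzero : ∀ z, Function.update par x y z = 0 ↔ par z = 0 ∧ z ≠ x := by
    intro z
    by_cases hz : z = x
    · subst hz; simp [hy1]
    · simp [hz]
  refine ⟨?_, ?_, ?_, ?_, ?_, ?_, ?_, ?_, ?_⟩
  · rw [joinRk, Function.update_of_ne hy1.symm, h.rk_zero]
  · intro z hz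
    by_cases hzx : z = x
    · subst hzx; simpa using (Finset.mem_Icc.1 hy).2
    · simpa [hzx] using h.par_le z hz
  · intro z hz
    unfold joinRep
    split_ifs
    · exact hy
    · exact h.rep_mem z hz
  · intro z hz
    rw [hzero]
    unfold joinRep
    split_ifs with hzx
    · exact ⟨hy0, hxy.symm⟩
    · exact ⟨h.par_rep z hz, hzx⟩
  · intro z hz hz0
    by_cases hzx : z = x
    · subst hzx; simp [joinRep, hrx, hry]
    · rw [Function.update_of_ne hzx] at hz0 ⊢
      simp only [joinRep, h.rep_par z hz hz0]
  · intro z hz hz0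
    rw [hzero] at hz0
    have := h.rep_root z hz hz0.1
    simp [joinRep, this, hz0.2]
  · intro z hz hz0
    by_cases hzx : z = x
    · subst hzx
      rw [Function.update_self, joinRk, Function.update_self, Function.update_of_ne hxy]
      split_ifs <;> omega
    · rw [Function.update_of_ne hzx] at hz0 ⊢
      have hzy : z ≠ y := fun e => hz0 (e ▸ hy0)
      refine lt_of_lt_of_le ?_ (le_joinRk _)
      rw [joinRk, Function.update_of_ne hzy]
      exact h.rk_lt z hz hz0
  · intro z hz hz0
    rw [hzero] at hz0
    by_cases hzy : z = y
    · subst hzy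
      rw [classOf_joinRep hxy, Finset.card_union_of_disjoint hdisj, joinRk, Function.update_self]
      have h₁ := h.size x hx hx0
      have h₂ := h.size z hy hy0
      split_ifs with he
      · rw [pow_succ]; rw [he] at h₁; omega
      · omega
    · rw [classOf_joinRep_of_ne hz0.2 hzy, joinRk, Function.update_of_ne hzy]
      exact h.size z hz hz0.1
  · intro z hz hz0
    rw [hzero] at hz0
    by_cases hzy : z = y
    · subst hzy
      rw [classOf_joinRep hxy, Finset.card_union_of_disjoint hdisj, Finset.sum_union hdisj]
      have h₁ := h.weight x hx hx0
      have h₂ := h.weight z hy hy0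
      have h₃ := h.size x hx hx0
      have h₄ := h.size z hy hy0
      have e₁ : ∑ y ∈ classOf V rep x, (cap (joinRk rk x z y) : ℚ) =
          ∑ y ∈ classOf V rep x, (cap (rk y) : ℚ) := by
        refine Finset.sum_congr rfl fun w hw => ?_
        have hwz : w ≠ z := by
          rintro rfl
          simp only [classOf, Finset.mem_filter, hry] at hw
          exact hxy hw.2.symm
        rw [joinRk, Function.update_of_ne hwz]
      have hzc : z ∈ classOf V rep z := by simpa [classOf, hry] using hy
      have e₂ : ∑ y ∈ classOf V rep z, (cap (joinRk rk x z y) : ℚ) + cap (rk z) =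
          ∑ y ∈ classOf V rep z, (cap (rk y) : ℚ) + cap (joinRk rk x z z) := by
        rw [← Finset.add_sum_erase _ _ hzc,
          ← Finset.add_sum_erase (a := z) _ (fun y => (cap (rk y) : ℚ)) hzc]
        have : ∑ y ∈ (classOf V rep z).erase z, (cap (joinRk rk x z y) : ℚ) =
            ∑ y ∈ (classOf V rep z).erase z, (cap (rk y) : ℚ) := by
          refine Finset.sum_congr rfl fun w hw => ?_
          rw [joinRk, Function.update_of_ne (Finset.ne_of_mem_erase hw)]
        rw [this]
        ring
      have hrz : joinRk rk x z z = if rk x = rk z then rk z + 1 else rk z := by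
        rw [joinRk, Function.update_self]
      rw [hrz] at e₂ ⊢
      push_cast
      split_ifs at e₂ ⊢ with he
      -- Equal ranks: only the new root changes its cap. The joined class has at least `2 ^ (rk z +
      -- 1)` nodes, so the new summand of `capSum`, multiplied by the size of the class, pays for
      -- the cap of the new rank.
      · have hs : capSum (rk z + 1) = capSum (rk z) + cap (rk z + 1) / 2 ^ (rk z + 1) := by
          unfold capSum
          rw [Finset.sum_range_succ]
        rw [he] at h₁ h₃
        have h₅ : (2 : ℚ) ^ (rk z + 1) ≤
            (classOf V rep x).card + (classOf V rep z).card := by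
          rw [pow_succ]
          exact_mod_cast (by omega : 2 ^ rk z * 2 ≤
            (classOf V rep x).card + (classOf V rep z).card)
        have h₆ : (cap (rk z + 1) : ℚ) ≤ cap (rk z + 1) / 2 ^ (rk z + 1) *
            ((classOf V rep x).card + (classOf V rep z).card) := by
          calc (cap (rk z + 1) : ℚ) = cap (rk z + 1) / 2 ^ (rk z + 1) * 2 ^ (rk z + 1) := by
                field_simp
            _ ≤ _ := mul_le_mul_of_nonneg_left h₅ (by positivity)
        have h₇ : (0 : ℚ) ≤ cap (rk z) := by positivity
        rw [hs, e₁]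
        linarith
      · have h₅ : capSum (rk x) * (classOf V rep x).card ≤ capSum (rk z) * (classOf V rep x).card :=
          mul_le_mul_of_nonneg_right (capSum_mono hr) (by positivity)
        rw [e₁]
        linarith
    · rw [classOf_joinRep_of_ne hz0.2 hzy, joinRk, Function.update_of_ne hzy]
      refine le_trans (le_of_eq (Finset.sum_congr rfl fun w hw => ?_)) (h.weight z hz hz0.1)
      have hwy : w ≠ y := by
        rintro rfl
        simp only [classOf, Finset.mem_filter, hry] at hw
        exact hzy hw.2.symm
      rw [Function.update_of_ne hwy]

/-- Roots have parent `0`, and `rk 0 = 0`, so a root contributes nothing to the potential before it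
is linked; all other summands grow with the ranks. -/
theorem potential_link (h : UnionFind V par rk rep) {x y : ℕ} (hx0 : par x = 0) :
    potential V par rk ≤ potential V (Function.update par x y) (joinRk rk x y) := by
  refine Finset.sum_le_sum fun z _ => min_le_min ?_ (cap_mono (le_joinRk z))
  by_cases hz : z = x
  · subst hz
    rw [hx0, h.rk_zero]
    exact Nat.zero_le _
  · rw [Function.update_of_ne hz]
    exact le_joinRk _

theorem rootCount_link {x y : ℕ} (hx : x ∈ Finset.Icc 1 V)
    (hy : y ∈ Finset.Icc 1 V) (hx0 : par x = 0) :
    rootCount V (Function.update par x y) + 1 = rootCount V par := by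
  have hy1 : y ≠ 0 := by rw [Finset.mem_Icc] at hy; omega
  have : (Finset.Icc 1 V).filter (Function.update par x y · = 0) =
      ((Finset.Icc 1 V).filter (par · = 0)).erase x := by
    ext z
    simp only [Finset.mem_filter, Finset.mem_erase]
    by_cases hz : z = x
    · subst hz; simp [hy1]
    · simp [hz]
  unfold rootCount
  rw [this, Finset.card_erase_add_one (Finset.mem_filter.2 ⟨hx, hx0⟩)]

theorem rootCount_halve {x : ℕ} (hp : par x ≠ 0) (hq : par (par x) ≠ 0) :
    rootCount V (Function.update par x (par (par x))) = rootCount V par := by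
  unfold rootCount
  congr 1
  ext z
  simp only [Finset.mem_filter]
  by_cases hz : z = x
  · subst hz; simp [hp, hq]
  · simp [hz]

end UnionFind

/-! ### Finding representatives -/

/-- Replace the node in the register `x` by the root of its tree, halving the path. -/
def findRoot (n : ℕ) : Cmd := block [
  .load Reg.p (Arr.par (n := n)) Reg.x,
  .loop (.lt Reg.zero Reg.p) (block [
    .load Reg.q (Arr.par (n := n)) Reg.p,
    .ite (.eq Reg.q Reg.zero)
      (block [.copy Reg.x Reg.p, .copy Reg.p Reg.q])
      (block [.store (Arr.par (n := n)) Reg.x Reg.q, .copy Reg.x Reg.q,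
        .load Reg.p (Arr.par (n := n)) Reg.x])])]

/-- Amortised cost: `12 * (L + 2)` steps plus `12` for each unit by which the potential rises. A
round of halving either raises the potential or moves to a higher level, and there are at most `L`
levels. In the invariant the credit is the difference between a fixed upper bound and `12` times the
sum of potential and current level; `hbound` ensures that no subtraction is truncated. -/
theorem findRoot_spec {n V L : ℕ} {rep : ℕ → ℕ} {σ : State} (hz : σ.reg Reg.zero = 0)
    (hL : V < tower (L + 1))
    (huf : UnionFind V (σ.arr (Arr.par (n := n))) (σ.arr (Arr.rk (n := n))) rep)
    (hx : σ.reg Reg.x ∈ Finset.Icc 1 V) :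
    WP (findRoot n) σ fun σ' t =>
      UnionFind V (σ'.arr (Arr.par (n := n))) (σ.arr (Arr.rk (n := n))) rep ∧
      σ'.reg Reg.x = rep (σ.reg Reg.x) ∧
      rootCount V (σ'.arr (Arr.par (n := n))) = rootCount V (σ.arr (Arr.par (n := n))) ∧
      t + 12 * potential V (σ.arr (Arr.par (n := n))) (σ.arr (Arr.rk (n := n))) ≤
        12 * potential V (σ'.arr (Arr.par (n := n))) (σ.arr (Arr.rk (n := n))) + 12 * (L + 2) := by
  set rk := σ.arr (Arr.rk (n := n)) with hrk
  have hbound : ∀ {par x}, UnionFind V par rk rep → x ∈ Finset.Icc 1 V →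
      potential V par rk ≤ 2 * L * V ∧ level (rk x) ≤ L := fun h hx =>
    ⟨h.potential_le hL, level_le (h.rk_lt_tower hL hx)⟩
  unfold findRoot
  simp only [wp_block_cons, wp_load, wp_block_nil]
  refine (wp_loop (fun k σ₁ => σ₁.reg Reg.zero = 0 ∧
    UnionFind V (σ₁.arr (Arr.par (n := n))) rk rep ∧ σ₁.reg Reg.x ∈ Finset.Icc 1 V ∧
    rep (σ₁.reg Reg.x) = rep (σ.reg Reg.x) ∧
    σ₁.reg Reg.p = σ₁.arr (Arr.par (n := n)) (σ₁.reg Reg.x) ∧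
    rootCount V (σ₁.arr (Arr.par (n := n))) = rootCount V (σ.arr (Arr.par (n := n))) ∧
    k + 12 * potential V (σ₁.arr (Arr.par (n := n))) rk + 12 * level (rk (σ₁.reg Reg.x)) =
      12 * (2 * L * V) + 12 * L + (if σ₁.reg Reg.p = 0 then 0 else 12)) ?_
    (k := 12 * (2 * L * V) + 12 * L + (if σ.arr (Arr.par (n := n)) (σ.reg Reg.x) = 0 then 0 else 12)
      - (12 * potential V (σ.arr (Arr.par (n := n))) rk + 12 * level (rk (σ.reg Reg.x)))) ?_).mono ?_
  · rintro k σ₁ ⟨h0, h, hx₁, hrep, hp, hrc, hk⟩ hb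
    simp only [holds_lt, h0] at hb
    have hp0 : σ₁.arr (Arr.par (n := n)) (σ₁.reg Reg.x) ≠ 0 := by omega
    have hpm := h.par_mem hx₁ hp0
    rw [if_neg (by omega)] at hk
    simp only [wp_block_cons, wp_load, wp_block_nil, wp_ite, holds_eq, wp_copy, wp_store]
    simp only [setReg_reg, setReg_arr, setArr_reg, setArr_arr, Reg.num_inj, reduceCtorEq, if_true,
      if_false, h0, hp]
    constructor
    -- The parent is already the root: nothing is halved and the level may stay the same, so this
    -- last round is paid from the extra `12` that is granted while `p` is nonzero.
    · intro hq
      have h₁ := hbound h hpm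
      have hlv : level (rk (σ₁.reg Reg.x)) ≤
          level (rk (σ₁.arr (Arr.par (n := n)) (σ₁.reg Reg.x))) :=
        level_mono (h.rk_lt _ hx₁ hp0).le
      refine ⟨k - 12 - 12 * (level (rk (σ₁.arr (Arr.par (n := n)) (σ₁.reg Reg.x))) -
        level (rk (σ₁.reg Reg.x))), ⟨trivial, h, hpm, ?_, by simp, hrc, ?_⟩, ?_⟩
      · rw [h.rep_par _ hx₁ hp0, hrep]
      · simp only [hq, if_true]
        omega
      · omega
    · intro hq
      have hqm := h.par_mem hpm hq
      have h' := h.halve hx₁ hp0 hq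
      have hpot := h.potential_halve hx₁ hp0 hq
      have h₁ := hbound h' hqm
      set par' := Function.update (σ₁.arr (Arr.par (n := n))) (σ₁.reg Reg.x)
        (σ₁.arr (Arr.par (n := n)) (σ₁.arr (Arr.par (n := n)) (σ₁.reg Reg.x))) with hpar'
      set q := σ₁.arr (Arr.par (n := n)) (σ₁.arr (Arr.par (n := n)) (σ₁.reg Reg.x)) with hqdef
      refine ⟨12 * (2 * L * V) + 12 * L + (if par' q = 0 then 0 else 12) -
        (12 * potential V par' rk + 12 * level (rk q)), ⟨trivial, h', hqm, ?_, trivial, ?_, ?_⟩, ?_⟩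
      · rw [h.rep_par _ hpm hq, h.rep_par _ hx₁ hp0, hrep]
      · rw [← hrc]
        exact UnionFind.rootCount_halve hp0 hq
      · omega
      · split_ifs <;> omega
  · simp only [setReg_reg, setReg_arr, Reg.num_inj, reduceCtorEq, if_true, if_false]
    have := hbound huf hx
    exact ⟨hz, huf, hx, trivial, trivial, trivial, by omega⟩
  · rintro σ' t ⟨k', ⟨h0, h, hx₁, hrep, hp, hrc, hk⟩, hb, ht⟩
    simp only [holds_lt, h0, not_lt, Nat.le_zero] at hb
    have hp0 : σ'.arr (Arr.par (n := n)) (σ'.reg Reg.x) = 0 := by omega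
    refine ⟨h, ?_, hrc, ?_⟩
    · rw [← hrep, h.rep_root _ hx₁ hp0]
    · have h₁ := hbound huf hx
      have h₂ := hbound h hx₁
      rw [if_pos hb] at hk
      split_ifs at ht <;> omega

theorem findRoot_keepsReg {n : ℕ} {r : Reg} (h : r ≠ .x ∧ r ≠ .p ∧ r ≠ .q) :
    (findRoot n).KeepsReg r := by
  simp [findRoot, Cmd.KeepsReg, h]

theorem findRoot_keepsArr {n : ℕ} {a : Arr n} (h : a ≠ .par) : (findRoot n).KeepsArr a := by
  simp [findRoot, Cmd.KeepsArr, h]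

/-! ### Joining two classes -/

/-- Join the trees with the distinct roots in the registers `x` and `y`; the root that became a
child is left in `x`, the other one in `y`. -/
def linkRoots (n : ℕ) : Cmd := block [
  .load Reg.p (Arr.rk (n := n)) Reg.x,
  .load Reg.q (Arr.rk (n := n)) Reg.y,
  .ite (.lt Reg.q Reg.p)
    (block [.copy Reg.p Reg.x, .copy Reg.x Reg.y, .copy Reg.y Reg.p])
    (.ite (.eq Reg.p Reg.q) (block [.succ Reg.q Reg.q, .store (Arr.rk (n := n)) Reg.y Reg.q])
      .skip),
  .store (Arr.par (n := n)) Reg.x Reg.y]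

theorem linkRoots_spec {n : ℕ} (σ : State) :
    WP (linkRoots n) σ fun σ' t => ∃ x y,
      ((x = σ.reg Reg.x ∧ y = σ.reg Reg.y) ∨ (x = σ.reg Reg.y ∧ y = σ.reg Reg.x)) ∧
      σ'.reg Reg.x = x ∧ σ'.reg Reg.y = y ∧
      σ.arr (Arr.rk (n := n)) x ≤ σ.arr (Arr.rk (n := n)) y ∧
      σ'.arr (Arr.par (n := n)) = Function.update (σ.arr (Arr.par (n := n))) x y ∧
      σ'.arr (Arr.rk (n := n)) = UnionFind.joinRk (σ.arr (Arr.rk (n := n))) x y ∧ t ≤ 12 := by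
  unfold linkRoots
  simp only [wp_block_cons, wp_load, wp_block_nil, wp_ite, holds_eq, holds_lt, wp_copy, wp_store,
    wp_succ, wp_skip]
  simp only [setReg_reg, setReg_arr, setArr_reg, setArr_arr, Reg.num_inj, reduceCtorEq, if_true,
    if_false, Arr.id_inj]
  refine ⟨fun h => ?_, fun h => ⟨fun h' => ?_, fun h' => ?_⟩⟩
  · refine ⟨_, _, Or.inr ⟨rfl, rfl⟩, rfl, rfl, h.le, rfl, ?_, by omega⟩
    rw [UnionFind.joinRk, if_neg h.ne, Function.update_eq_self]
  · refine ⟨_, _, Or.inl ⟨rfl, rfl⟩, rfl, rfl, h'.le, rfl, ?_, by omega⟩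
    rw [UnionFind.joinRk, if_pos h']
  · refine ⟨_, _, Or.inl ⟨rfl, rfl⟩, rfl, rfl, by omega, rfl, ?_, by omega⟩
    rw [UnionFind.joinRk, if_neg h', Function.update_eq_self]

/-- Append the contents of two registers to the queue of pairs to be joined. -/
def enqueue (n : ℕ) (r s : Reg) : Cmd := block [
  .store (Arr.qa (n := n)) Reg.tl r, .store (Arr.qb (n := n)) Reg.tl s, .succ Reg.tl Reg.tl]

/-- Move the transitions of the node in `x` to the node in `y`, queueing the pairs of ends of
edges with the same label. -/
noncomputable def transfer (n : ℕ) : Cmd := block ((letters n).map fun l => block [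
  .load Reg.p (Arr.tr l) Reg.x,
  .ite (.lt Reg.zero Reg.p) (block [
    .load Reg.q (Arr.tr l) Reg.y,
    .ite (.lt Reg.zero Reg.q) (enqueue n .p .q) (.store (Arr.tr l) Reg.y Reg.p)]) .skip])

/-- The effect of `transfer` on one table of transitions. -/
def movedTable (T : ℕ → ℕ) (x y : ℕ) : ℕ → ℕ :=
  if T x ≠ 0 ∧ T y = 0 then Function.update T y (T x) else T

/-- The new part of the queue consists of the clashing transitions and nothing else, at most `2 * n`
pairs. The table entries at the old root `x` are left as they are; only roots are consulted
afterwards. -/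
theorem transfer_spec {n : ℕ} {σ : State} (hz : σ.reg Reg.zero = 0) :
    WP (transfer n) σ fun σ' t =>
      (∀ l : Letter n, σ'.arr (Arr.tr l) =
        movedTable (σ.arr (Arr.tr l)) (σ.reg Reg.x) (σ.reg Reg.y)) ∧
      σ.reg Reg.tl ≤ σ'.reg Reg.tl ∧ σ'.reg Reg.tl ≤ σ.reg Reg.tl + 2 * n ∧
      (∀ i < σ.reg Reg.tl, σ'.arr (Arr.qa (n := n)) i = σ.arr (Arr.qa (n := n)) i ∧
        σ'.arr (Arr.qb (n := n)) i = σ.arr (Arr.qb (n := n)) i) ∧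
      (∀ l : Letter n, σ.arr (Arr.tr l) (σ.reg Reg.x) ≠ 0 → σ.arr (Arr.tr l) (σ.reg Reg.y) ≠ 0 →
        ∃ i, σ.reg Reg.tl ≤ i ∧ i < σ'.reg Reg.tl ∧
          σ'.arr (Arr.qa (n := n)) i = σ.arr (Arr.tr l) (σ.reg Reg.x) ∧
          σ'.arr (Arr.qb (n := n)) i = σ.arr (Arr.tr l) (σ.reg Reg.y)) ∧
      (∀ i, σ.reg Reg.tl ≤ i → i < σ'.reg Reg.tl → ∃ l : Letter n,
        σ.arr (Arr.tr l) (σ.reg Reg.x) ≠ 0 ∧ σ.arr (Arr.tr l) (σ.reg Reg.y) ≠ 0 ∧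
        σ'.arr (Arr.qa (n := n)) i = σ.arr (Arr.tr l) (σ.reg Reg.x) ∧
        σ'.arr (Arr.qb (n := n)) i = σ.arr (Arr.tr l) (σ.reg Reg.y)) ∧
      t ≤ 2 * n * 14 + 1 := by
  refine (wp_block_map (L := letters n) (fun D σ' =>
      σ'.reg Reg.zero = 0 ∧ σ'.reg Reg.x = σ.reg Reg.x ∧ σ'.reg Reg.y = σ.reg Reg.y ∧
      (∀ l ∈ D, σ'.arr (Arr.tr l) =
        movedTable (σ.arr (Arr.tr l)) (σ.reg Reg.x) (σ.reg Reg.y)) ∧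
      (∀ l ∉ D, σ'.arr (Arr.tr l) = σ.arr (Arr.tr l)) ∧
      σ.reg Reg.tl ≤ σ'.reg Reg.tl ∧ σ'.reg Reg.tl ≤ σ.reg Reg.tl + D.length ∧
      (∀ i < σ.reg Reg.tl, σ'.arr (Arr.qa (n := n)) i = σ.arr (Arr.qa (n := n)) i ∧
        σ'.arr (Arr.qb (n := n)) i = σ.arr (Arr.qb (n := n)) i) ∧
      (∀ l ∈ D, σ.arr (Arr.tr l) (σ.reg Reg.x) ≠ 0 → σ.arr (Arr.tr l) (σ.reg Reg.y) ≠ 0 →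
        ∃ i, σ.reg Reg.tl ≤ i ∧ i < σ'.reg Reg.tl ∧
          σ'.arr (Arr.qa (n := n)) i = σ.arr (Arr.tr l) (σ.reg Reg.x) ∧
          σ'.arr (Arr.qb (n := n)) i = σ.arr (Arr.tr l) (σ.reg Reg.y)) ∧
      (∀ i, σ.reg Reg.tl ≤ i → i < σ'.reg Reg.tl → ∃ l : Letter n,
        σ.arr (Arr.tr l) (σ.reg Reg.x) ≠ 0 ∧ σ.arr (Arr.tr l) (σ.reg Reg.y) ≠ 0 ∧
        σ'.arr (Arr.qa (n := n)) i = σ.arr (Arr.tr l) (σ.reg Reg.x) ∧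
        σ'.arr (Arr.qb (n := n)) i = σ.arr (Arr.tr l) (σ.reg Reg.y))) (fun _ => 14) ?_ ?_).mono ?_
  · rintro D l R σ₁ hL ⟨h0, hx, hy, hD, hnD, htl, htl', hpre, hnew, hold⟩
    have hlD : l ∉ D := by
      have := nodup_letters n
      rw [hL, List.nodup_append] at this
      exact fun hl => this.2.2 l hl l (by simp) rfl
    have hT := hnD l hlD
    unfold enqueue
    simp only [wp_block_cons, wp_load, wp_block_nil, wp_ite, holds_lt, wp_store,
      wp_succ, wp_skip]
    simp only [setReg_reg, setReg_arr, setArr_reg, setArr_arr, Reg.num_inj, reduceCtorEq, if_true,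
      if_false, Arr.id_inj, h0, hx, hy, hT, Arr.tr.injEq, List.length_append, List.length_singleton]
    refine ⟨fun h₁ => ⟨fun h₂ => ?_, fun h₂ => ?_⟩, fun h₁ => ?_⟩
    · refine ⟨⟨trivial, trivial, trivial, ?_, ?_, by omega, by omega, ?_, ?_, ?_⟩, by omega⟩
      · intro l' hl'
        rcases List.mem_append.1 hl' with hl' | hl'
        · exact hD l' hl'
        · rw [List.mem_singleton] at hl'
          subst hl'
          rw [hT, movedTable, if_neg (by omega)]
      · exact fun l' hl' => hnD l' fun h => hl' (by simp [h])
      · intro i hi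
        rw [Function.update_of_ne (by omega), Function.update_of_ne (by omega)]
        exact hpre i hi
      · intro l' hl' hx' hy'
        rcases List.mem_append.1 hl' with hl' | hl'
        · obtain ⟨i, h₃, h₄, h₅⟩ := hnew l' hl' hx' hy'
          refine ⟨i, h₃, by omega, ?_⟩
          rwa [Function.update_of_ne (by omega), Function.update_of_ne (by omega)]
        · rw [List.mem_singleton] at hl'
          subst hl'
          exact ⟨σ₁.reg Reg.tl, htl, by omega, by simp, by simp⟩
      · intro i hi hi'
        by_cases he : i = σ₁.reg Reg.tl
        · subst he
          exact ⟨l, by omega, by omega, by simp, by simp⟩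
        · rw [Function.update_of_ne he, Function.update_of_ne he]
          exact hold i hi (by omega)
    · refine ⟨⟨trivial, trivial, trivial, ?_, ?_, htl, by omega, hpre, ?_, hold⟩, by omega⟩
      · intro l' hl'
        rcases List.mem_append.1 hl' with hl' | hl'
        · rw [if_neg (fun e : l' = l => hlD (e ▸ hl'))]
          exact hD l' hl'
        · rw [List.mem_singleton] at hl'
          subst hl'
          rw [if_pos rfl, movedTable, if_pos (by omega)]
      · intro l' hl'
        have : l' ≠ l := fun e => hl' (by simp [e])
        rw [if_neg this]
        exact hnD l' fun h => hl' (by simp [h])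
      · intro l' hl' hx' hy'
        rcases List.mem_append.1 hl' with hl' | hl'
        · exact hnew l' hl' hx' hy'
        · rw [List.mem_singleton] at hl'
          subst hl'
          omega
    · refine ⟨⟨trivial, trivial, trivial, ?_, ?_, htl, by omega, hpre, ?_, hold⟩, by omega⟩
      · intro l' hl'
        rcases List.mem_append.1 hl' with hl' | hl'
        · exact hD l' hl'
        · rw [List.mem_singleton] at hl'
          subst hl'
          rw [hT, movedTable, if_neg (by omega)]
      · exact fun l' hl' => hnD l' fun h => hl' (by simp [h])
      · intro l' hl' hx' hy'
        rcases List.mem_append.1 hl' with hl' | hl'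
        · exact hnew l' hl' hx' hy'
        · rw [List.mem_singleton] at hl'
          subst hl'
          omega
  · refine ⟨hz, rfl, rfl, by simp, by simp, le_rfl, by simp, by simp, by simp, ?_⟩
    intro i h₁ h₂
    omega
  · rintro σ' t ⟨⟨h0, hx, hy, hD, hnD, htl, htl', hpre, hnew, hold⟩, ht⟩
    refine ⟨fun l => hD l (mem_letters l), htl, by simpa using htl', hpre,
      fun l => hnew l (mem_letters l), hold, ?_⟩
    simpa using ht

/-! ### The folding loop -/

/-- Initial data of the folding process on the nodes `1, …, V`: the table `T l x` is the end of the
edge with label `l` at the node `x`, or `0`; the pairs `(qa i, qb i)` with `i < m` are to be joined.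
The map `φ` is a morphism to a deterministic labelled graph with edges `S` that joins these pairs. -/
structure FoldData {n : ℕ} {D : Type} (S : D → Letter n → D → Prop) (φ : ℕ → D) (V m : ℕ)
    (T : Letter n → ℕ → ℕ) (qa qb : ℕ → ℕ) : Prop where
  det : ∀ {v l w w'}, S v l w → S v l w' → w = w'
  mem : ∀ l, ∀ x ∈ Finset.Icc 1 V, T l x ≠ 0 → T l x ∈ Finset.Icc 1 V
  step : ∀ l, ∀ x ∈ Finset.Icc 1 V, T l x ≠ 0 → S (φ x) l (φ (T l x))
  pair_mem : ∀ i < m, qa i ∈ Finset.Icc 1 V ∧ qb i ∈ Finset.Icc 1 V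
  pair_eq : ∀ i < m, φ (qa i) = φ (qb i)

/-- The invariant of the folding loop. The initial tables are `T₀`, the current ones `T`. The pairs
with numbers below `hd` have been joined, those with numbers from `hd` to `tl` are waiting. -/
structure FoldInv {n : ℕ} {D : Type} (φ : ℕ → D) (V : ℕ) (T₀ T : Letter n → ℕ → ℕ)
    (qa qb rep : ℕ → ℕ) (hd tl : ℕ) : Prop where
  hd_le : hd ≤ tl
  rep_eq : ∀ x ∈ Finset.Icc 1 V, φ (rep x) = φ x
  pair_mem : ∀ i < tl, qa i ∈ Finset.Icc 1 V ∧ qb i ∈ Finset.Icc 1 V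
  pair_eq : ∀ i < tl, φ (qa i) = φ (qb i)
  joined : ∀ i < hd, rep (qa i) = rep (qb i)
  orig : ∀ l, ∀ x ∈ Finset.Icc 1 V, T l x ≠ 0 →
    ∃ u ∈ Finset.Icc 1 V, rep u = rep x ∧ T₀ l u = T l x
  -- No original edge is lost, up to the joins that are still pending. Quantifying over all
  -- equivalence relations that contain the classes and the waiting pairs avoids constructing the
  -- one they generate; with an empty queue `R` can be the kernel of `rep`.
  complete : ∀ R : Setoid ℕ, (∀ x ∈ Finset.Icc 1 V, R x (rep x)) →
    (∀ i, hd ≤ i → i < tl → R (qa i) (qb i)) →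
    ∀ l, ∀ u ∈ Finset.Icc 1 V, T₀ l u ≠ 0 → T l (rep u) ≠ 0 ∧ R (T l (rep u)) (T₀ l u)

/-- Nothing is to be done for a pair that has been joined already. -/
theorem FoldInv.skip {n : ℕ} {D : Type} {φ : ℕ → D} {V : ℕ} {T₀ T : Letter n → ℕ → ℕ}
    {qa qb rep : ℕ → ℕ} {hd tl : ℕ} (h : FoldInv φ V T₀ T qa qb rep hd tl) (hlt : hd < tl)
    (he : rep (qa hd) = rep (qb hd)) : FoldInv φ V T₀ T qa qb rep (hd + 1) tl where
  hd_le := hlt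
  rep_eq := h.rep_eq
  pair_mem := h.pair_mem
  pair_eq := h.pair_eq
  joined i hi := by
    rcases Nat.lt_succ_iff_lt_or_eq.1 hi with hi | rfl
    · exact h.joined i hi
    · exact he
  orig := h.orig
  complete R hR hp := by
    refine h.complete R hR fun i hi hi' => ?_
    rcases hi.eq_or_lt with rfl | hi
    · obtain ⟨ha, hb⟩ := h.pair_mem hd hlt
      have h₁ := hR _ ha
      rw [he] at h₁
      exact R.trans' h₁ (R.symm' (hR _ hb))
    · exact hp i hi hi'

/-- The invariant is kept when a pair is joined. -/
theorem FoldInv.join {n : ℕ} {D : Type} {S : D → Letter n → D → Prop} {φ : ℕ → D} {V m : ℕ}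
    {T₀ T T' : Letter n → ℕ → ℕ} {qa qb rep qa₀ qb₀ qa' qb' par rk : ℕ → ℕ} {hd tl tl' x y : ℕ}
    (hd₀ : FoldData S φ V m T₀ qa₀ qb₀) (h : FoldInv φ V T₀ T qa qb rep hd tl)
    (huf : UnionFind V par rk rep) (hlt : hd < tl)
    (hxy : (x = rep (qa hd) ∧ y = rep (qb hd)) ∨ (x = rep (qb hd) ∧ y = rep (qa hd)))
    (hT' : ∀ l, T' l = movedTable (T l) x y) (htl : tl ≤ tl')
    (hpre : ∀ i < tl, qa' i = qa i ∧ qb' i = qb i)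
    (hnew : ∀ l, T l x ≠ 0 → T l y ≠ 0 → ∃ i, tl ≤ i ∧ i < tl' ∧ qa' i = T l x ∧ qb' i = T l y)
    (hold : ∀ i, tl ≤ i → i < tl' → ∃ l, T l x ≠ 0 ∧ T l y ≠ 0 ∧ qa' i = T l x ∧ qb' i = T l y) :
    FoldInv φ V T₀ T' qa' qb' (UnionFind.joinRep rep x y) (hd + 1) tl' := by
  obtain ⟨ham, hbm⟩ := h.pair_mem hd hlt
  have hxm : x ∈ Finset.Icc 1 V := by
    rcases hxy with ⟨rfl, _⟩ | ⟨rfl, _⟩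
    · exact huf.rep_mem _ ham
    · exact huf.rep_mem _ hbm
  have hym : y ∈ Finset.Icc 1 V := by
    rcases hxy with ⟨_, rfl⟩ | ⟨_, rfl⟩
    · exact huf.rep_mem _ hbm
    · exact huf.rep_mem _ ham
  have hrx : rep x = x := by
    rcases hxy with ⟨rfl, _⟩ | ⟨rfl, _⟩
    · exact huf.rep_rep ham
    · exact huf.rep_rep hbm
  have hry : rep y = y := by
    rcases hxy with ⟨_, rfl⟩ | ⟨_, rfl⟩
    · exact huf.rep_rep hbm
    · exact huf.rep_rep ham
  have hφ : φ x = φ y := by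
    rcases hxy with ⟨rfl, rfl⟩ | ⟨rfl, rfl⟩
    · rw [h.rep_eq _ ham, h.rep_eq _ hbm, h.pair_eq hd hlt]
    · rw [h.rep_eq _ ham, h.rep_eq _ hbm, h.pair_eq hd hlt]
  have hmono : ∀ {u v}, rep u = rep v →
      UnionFind.joinRep rep x y u = UnionFind.joinRep rep x y v := by
    intro u v e
    simp only [UnionFind.joinRep, e]
  have hjx : UnionFind.joinRep rep x y x = y := by simp [UnionFind.joinRep, hrx]
  have hjy : UnionFind.joinRep rep x y y = y := by
    simp only [UnionFind.joinRep, hry]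
    split_ifs <;> rfl
  have hTmem : ∀ l, ∀ z ∈ Finset.Icc 1 V, T l z ≠ 0 → T l z ∈ Finset.Icc 1 V ∧
      S (φ z) l (φ (T l z)) := by
    intro l z hz h0
    obtain ⟨u, hu, hur, hue⟩ := h.orig l z hz h0
    have h1 : T₀ l u ≠ 0 := by rwa [hue]
    rw [← hue, ← h.rep_eq z hz, ← hur, h.rep_eq u hu]
    exact ⟨hd₀.mem l u hu h1, hd₀.step l u hu h1⟩
  refine ⟨by omega, ?_, ?_, ?_, ?_, ?_, ?_⟩
  · intro z hz
    unfold UnionFind.joinRep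
    split_ifs with hzx
    · rw [← hφ, ← hzx, h.rep_eq z hz]
    · exact h.rep_eq z hz
  · intro i hi
    rcases lt_or_ge i tl with hit | hit
    · rw [(hpre i hit).1, (hpre i hit).2]
      exact h.pair_mem i hit
    · obtain ⟨l, h₁, h₂, h₃, h₄⟩ := hold i hit hi
      rw [h₃, h₄]
      exact ⟨(hTmem l x hxm h₁).1, (hTmem l y hym h₂).1⟩
  · intro i hi
    rcases lt_or_ge i tl with hit | hit
    · rw [(hpre i hit).1, (hpre i hit).2]
      exact h.pair_eq i hit
    · obtain ⟨l, h₁, h₂, h₃, h₄⟩ := hold i hit hi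
      rw [h₃, h₄]
      have h₅ := (hTmem l x hxm h₁).2
      rw [hφ] at h₅
      exact hd₀.det h₅ (hTmem l y hym h₂).2
  · intro i hi
    have hit : i < tl := by omega
    rw [(hpre i hit).1, (hpre i hit).2]
    rcases Nat.lt_succ_iff_lt_or_eq.1 hi with hi | rfl
    · exact hmono (h.joined i hi)
    · rcases hxy with ⟨h₁, h₂⟩ | ⟨h₁, h₂⟩
      · rw [hmono (h₁.symm.trans hrx.symm : rep (qa i) = rep x),
          hmono (h₂.symm.trans hry.symm : rep (qb i) = rep y), hjx, hjy]
      · rw [hmono (h₁.symm.trans hrx.symm : rep (qb i) = rep x),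
          hmono (h₂.symm.trans hry.symm : rep (qa i) = rep y), hjx, hjy]
  · intro l z hz
    rw [hT' l]
    unfold movedTable
    have hgen : T l z ≠ 0 → ∃ u ∈ Finset.Icc 1 V,
        UnionFind.joinRep rep x y u = UnionFind.joinRep rep x y z ∧ T₀ l u = T l z := by
      intro h0
      obtain ⟨u, hu, hur, hue⟩ := h.orig l z hz h0
      exact ⟨u, hu, hmono hur, hue⟩
    split_ifs with hc
    · by_cases hzy : z = y
      · subst hzy
        rw [Function.update_self]
        intro h0
        obtain ⟨u, hu, hur, hue⟩ := h.orig l x hxm h0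
        exact ⟨u, hu, by rw [hmono hur, hjx, hjy], hue⟩
      · rw [Function.update_of_ne hzy]
        exact hgen
    · exact hgen
  -- A relation that contains the new classes and the new queue also contains the old ones: `x` and
  -- `y` are related because `x` is now represented by `y`, and this accounts for the pair just
  -- removed.
  · intro R hR hp l u hu h0
    have hRxy : R x y := by
      have := hR x hxm
      rwa [hjx] at this
    have hRrep : ∀ z ∈ Finset.Icc 1 V, R z (rep z) := by
      intro z hz
      have := hR z hz
      unfold UnionFind.joinRep at this
      split_ifs at this with hzx
      · rw [hzx]
        exact R.trans' this (R.symm' hRxy)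
      · exact this
    obtain ⟨h₁, h₂⟩ := h.complete R hRrep (by
      intro i hi hi'
      rcases hi.eq_or_lt with rfl | hi
      · rcases hxy with ⟨rfl, rfl⟩ | ⟨rfl, rfl⟩
        · exact R.trans' (hRrep _ ham) (R.trans' hRxy (R.symm' (hRrep _ hbm)))
        · exact R.trans' (hRrep _ ham) (R.trans' (R.symm' hRxy) (R.symm' (hRrep _ hbm)))
      · have := hp i hi (by omega)
        rwa [(hpre i hi').1, (hpre i hi').2] at this) l u hu h0
    rw [hT' l]
    unfold UnionFind.joinRep movedTable
    by_cases hux : rep u = x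
    · rw [if_pos hux]
      rw [hux] at h₁ h₂
      by_cases hy0 : T l y = 0
      · rw [if_pos ⟨h₁, hy0⟩, Function.update_self]
        exact ⟨h₁, h₂⟩
      -- Both roots have a transition with this letter. That of `x` is dropped, but the ends of the
      -- two were queued, hence are related by `R`.
      · rw [if_neg (fun h => hy0 h.2)]
        refine ⟨hy0, ?_⟩
        obtain ⟨i, hi, hi', ha, hb⟩ := hnew l h₁ hy0
        have := hp i (by omega) hi'
        rw [ha, hb] at this
        exact R.trans' (R.symm' this) h₂
    · rw [if_neg hux]
      split_ifs with hc
      · have : rep u ≠ y := fun e => h₁ (e ▸ hc.2)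
        rw [Function.update_of_ne this]
        exact ⟨h₁, h₂⟩
      · exact ⟨h₁, h₂⟩

/-- Join the pairs in the queue, until it is empty. -/
noncomputable def foldLoop (n : ℕ) : Cmd := .loop (.lt Reg.hd Reg.tl) (block [
  .load Reg.x (Arr.qb (n := n)) Reg.hd, findRoot n, .copy Reg.y Reg.x,
  .load Reg.x (Arr.qa (n := n)) Reg.hd, findRoot n, .succ Reg.hd Reg.hd,
  .ite (.eq Reg.x Reg.y) .skip (block [linkRoots n, transfer n])])

/-- The tables of transitions in the memory. -/
def trTable (n : ℕ) (σ : State) : Letter n → ℕ → ℕ := fun l => σ.arr (Arr.tr l)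

theorem transfer_keepsReg {n : ℕ} {r : Reg} (h : r ≠ .p ∧ r ≠ .q ∧ r ≠ .tl) :
    (transfer n).KeepsReg r := by
  unfold transfer
  rw [keepsReg_block_map]
  intro l _
  simp [enqueue, Cmd.KeepsReg, h]

theorem transfer_keepsArr {n : ℕ} {a : Arr n} (h : (∀ l, a ≠ .tr l) ∧ a ≠ .qa ∧ a ≠ .qb) :
    (transfer n).KeepsArr a := by
  unfold transfer
  rw [keepsArr_block_map]
  intro l _
  simp [enqueue, Cmd.KeepsArr, h]

theorem linkRoots_keepsReg {n : ℕ} {r : Reg} (h : r ≠ .p ∧ r ≠ .q ∧ r ≠ .x ∧ r ≠ .y) :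
    (linkRoots n).KeepsReg r := by
  simp [linkRoots, Cmd.KeepsReg, h]

theorem linkRoots_keepsArr {n : ℕ} {a : Arr n} (h : a ≠ .par ∧ a ≠ .rk) :
    (linkRoots n).KeepsArr a := by
  simp [linkRoots, Cmd.KeepsArr, h]

/-- The quantity `pending pairs + 2 * n * roots` drops in every round: a pair that is already joined
just leaves the queue, while a join adds at most `2 * n` pairs and removes a root. The factor `24 *
(L + 2) + 28 * n + 40` covers the fixed part of two finds, a transfer and the overhead. What the
finds cost beyond this is charged to the potential, which linking never lowers and which is at most
`2 * L * V`. -/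
theorem foldLoop_spec {n : ℕ} {D : Type} {S : D → Letter n → D → Prop} {φ : ℕ → D} {V L : ℕ}
    {σ : State} (hz : σ.reg Reg.zero = 0) (hL : V < tower (L + 1))
    (hd₀ : FoldData S φ V (σ.reg Reg.tl) (trTable n σ) (σ.arr (Arr.qa (n := n)))
      (σ.arr (Arr.qb (n := n))))
    (hhd : σ.reg Reg.hd = 0) (hpar : σ.arr (Arr.par (n := n)) = fun _ => 0)
    (hrk : σ.arr (Arr.rk (n := n)) = fun _ => 0) :
    WP (foldLoop n) σ fun σ' t => ∃ rep,
      UnionFind V (σ'.arr (Arr.par (n := n))) (σ'.arr (Arr.rk (n := n))) rep ∧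
      FoldInv φ V (trTable n σ) (trTable n σ') (σ'.arr (Arr.qa (n := n)))
        (σ'.arr (Arr.qb (n := n))) rep (σ'.reg Reg.tl) (σ'.reg Reg.tl) ∧
      (∀ i < σ.reg Reg.tl, rep (σ.arr (Arr.qa (n := n)) i) = rep (σ.arr (Arr.qb (n := n)) i)) ∧
      t ≤ (24 * (L + 2) + 28 * n + 40) * (σ.reg Reg.tl + 2 * n * V) + 24 * L * V + 1 := by
  unfold foldLoop
  refine (wp_loop (fun k σ₁ => ∃ rep, σ₁.reg Reg.zero = 0 ∧
      UnionFind V (σ₁.arr (Arr.par (n := n))) (σ₁.arr (Arr.rk (n := n))) rep ∧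
      FoldInv φ V (trTable n σ) (trTable n σ₁) (σ₁.arr (Arr.qa (n := n)))
        (σ₁.arr (Arr.qb (n := n))) rep (σ₁.reg Reg.hd) (σ₁.reg Reg.tl) ∧
      σ.reg Reg.tl ≤ σ₁.reg Reg.tl ∧
      (∀ i < σ.reg Reg.tl, σ₁.arr (Arr.qa (n := n)) i = σ.arr (Arr.qa (n := n)) i ∧
        σ₁.arr (Arr.qb (n := n)) i = σ.arr (Arr.qb (n := n)) i) ∧
      k + 12 * potential V (σ₁.arr (Arr.par (n := n))) (σ₁.arr (Arr.rk (n := n))) =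
        (24 * (L + 2) + 28 * n + 40) * (σ₁.reg Reg.tl - σ₁.reg Reg.hd +
          2 * n * rootCount V (σ₁.arr (Arr.par (n := n)))) + 12 * (2 * L * V)) ?_
      (k := (24 * (L + 2) + 28 * n + 40) * (σ.reg Reg.tl - σ.reg Reg.hd +
          2 * n * rootCount V (σ.arr (Arr.par (n := n)))) + 12 * (2 * L * V) -
          12 * potential V (σ.arr (Arr.par (n := n))) (σ.arr (Arr.rk (n := n)))) ?_).mono ?_
  · rintro k σ₁ ⟨rep, h0, huf, hinv, htl, hpre, hk⟩ hb
    simp only [holds_lt] at hb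
    obtain ⟨ham, hbm⟩ := hinv.pair_mem _ hb
    simp only [wp_block_cons, wp_load, wp_copy, wp_succ, wp_ite, wp_block_nil, wp_skip]
    refine (findRoot_spec (n := n) (V := V) (rep := rep) (by simpa using h0) hL
      (by simpa using huf) (by simpa using hbm)).frame.mono ?_
    rintro σ₂ t₂ ⟨⟨huf₂, hx₂, hrc₂, ht₂⟩, hfr₂⟩
    have fr := fun r (hr : r ≠ Reg.x ∧ r ≠ Reg.p ∧ r ≠ Reg.q) =>
      hfr₂.reg r (findRoot_keepsReg hr)
    have fa := fun (a : Arr n) (ha : a ≠ .par) => hfr₂.arr a (findRoot_keepsArr ha)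
    have frz := fr .zero (by simp)
    have frh := fr .hd (by simp)
    have frt := fr .tl (by simp)
    have fqa := fa .qa (by simp)
    have fqb := fa .qb (by simp)
    have frk := fa .rk (by simp)
    have ftr := fun l => fa (.tr l) (by simp)
    simp only [setReg_reg, setReg_arr, Reg.num_inj, reduceCtorEq, if_false, if_true] at *
    refine (findRoot_spec (n := n) (V := V) (rep := rep) (by simpa [frz] using h0) hL
      (by simpa [frk] using huf₂) (by simpa [frh, fqa] using ham)).frame.mono ?_
    rintro σ₃ t₃ ⟨⟨huf₃, hx₃, hrc₃, ht₃⟩, hfr₃⟩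
    clear fr fa hfr₂
    have fr := fun r (hr : r ≠ Reg.x ∧ r ≠ Reg.p ∧ r ≠ Reg.q) =>
      hfr₃.reg r (findRoot_keepsReg hr)
    have fa := fun (a : Arr n) (ha : a ≠ .par) => hfr₃.arr a (findRoot_keepsArr ha)
    have gry := fr .y (by simp)
    have grz := fr .zero (by simp)
    have grh := fr .hd (by simp)
    have grt := fr .tl (by simp)
    have gqa := fa .qa (by simp)
    have gqb := fa .qb (by simp)
    have grk := fa .rk (by simp)
    have gtr := fun l => fa (.tr l) (by simp)
    clear fr fa hfr₃
    simp only [setReg_reg, setReg_arr, Reg.num_inj, reduceCtorEq, if_false, if_true] at *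
    rw [frz] at grz
    rw [frh] at grh hx₃
    rw [frt] at grt
    rw [fqa] at gqa hx₃
    rw [fqb] at gqb
    rw [frk] at grk ht₃ huf₃
    rw [hx₂] at gry
    have gtr' : ∀ l : Letter n, σ₃.arr (Arr.tr l) = σ₁.arr (Arr.tr l) :=
      fun l => (gtr l).trans (ftr l)
    clear gtr ftr fqa fqb frk frz frh frt
    have htrT : trTable n σ₃ = trTable n σ₁ := funext gtr'
    have hmono := hinv.hd_le
    have hpb := huf₃.potential_le hL
    set M := 24 * (L + 2) + 28 * n + 40 with hM
    simp only [holds_eq, setReg_reg, Reg.num_inj, reduceCtorEq, if_false]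
    rw [hx₃, gry]
    constructor
    · intro he
      refine ⟨M * (σ₁.reg Reg.tl - (σ₁.reg Reg.hd + 1) +
          2 * n * rootCount V (σ₃.arr (Arr.par (n := n)))) + 12 * (2 * L * V) -
          12 * potential V (σ₃.arr (Arr.par (n := n))) (σ₁.arr (Arr.rk (n := n))),
          ⟨rep, ?_⟩, ?_⟩
      · simp only [grz, grk, gqa, gqb, grh, grt]
        have hs := hinv.skip hb he
        rw [← htrT] at hs
        refine ⟨h0, huf₃, hs, htl, hpre, ?_⟩
        omega
      · have e₁ : σ₁.reg Reg.tl - σ₁.reg Reg.hd = σ₁.reg Reg.tl - (σ₁.reg Reg.hd + 1) + 1 := by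
          omega
        rw [e₁, add_right_comm, mul_add M _ 1, ← hrc₂, ← hrc₃] at hk
        omega
    · intro hne
      set σ₃' := σ₃.setReg Reg.hd.num (σ₃.reg Reg.hd + 1) with hσ₃'
      refine (linkRoots_spec (n := n) σ₃').frame.mono ?_
      rintro σ₄ t₄ ⟨⟨x, y, hxy, hx₄, hy₄, hrk₄, hpar₄, hrkk₄, ht₄⟩, hfr₄⟩
      have fr := fun r (hr : r ≠ Reg.p ∧ r ≠ Reg.q ∧ r ≠ Reg.x ∧ r ≠ Reg.y) =>
        hfr₄.reg r (linkRoots_keepsReg hr)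
      have fa := fun (a : Arr n) (ha : a ≠ .par ∧ a ≠ .rk) => hfr₄.arr a (linkRoots_keepsArr ha)
      have frz := fr .zero (by simp)
      have frh := fr .hd (by simp)
      have frt := fr .tl (by simp)
      have fqa := fa .qa (by simp)
      have fqb := fa .qb (by simp)
      have ftr := fun l => fa (.tr l) (by simp)
      clear fr fa hfr₄
      simp only [hσ₃', setReg_reg, setReg_arr, Reg.num_inj, reduceCtorEq, if_false, if_true,
        grz, grk, gqa, gqb, gtr', grh, grt, hx₃, gry] at frz frh frt fqa fqb ftr hxy hrk₄ hpar₄ hrkk₄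
      refine (transfer_spec (n := n) (σ := σ₄) (by rw [frz, h0])).frame.mono ?_
      rintro σ₅ t₅ ⟨⟨hT₅, htl₅, htl₅', hpre₅, hnew₅, hold₅, ht₅⟩, hfr₅⟩
      have fr := fun r (hr : r ≠ Reg.p ∧ r ≠ Reg.q ∧ r ≠ Reg.tl) =>
        hfr₅.reg r (transfer_keepsReg hr)
      have fa := fun (a : Arr n) (ha : (∀ l, a ≠ .tr l) ∧ a ≠ .qa ∧ a ≠ .qb) =>
        hfr₅.arr a (transfer_keepsArr ha)
      have grz := fr .zero (by simp)
      have grh := fr .hd (by simp)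
      have gpar := fa .par (by simp)
      have grk₅ := fa .rk (by simp)
      clear fr fa hfr₅
      rw [frz] at grz
      rw [frh] at grh
      rw [hpar₄] at gpar
      rw [hrkk₄] at grk₅
      simp only [hx₄, hy₄, frt, fqa, fqb, ftr] at hT₅ htl₅ htl₅' hpre₅ hnew₅ hold₅
      have hm : ∀ z, z = rep (σ₁.arr (Arr.qa (n := n)) (σ₁.reg Reg.hd)) ∨
          z = rep (σ₁.arr (Arr.qb (n := n)) (σ₁.reg Reg.hd)) →
          z ∈ Finset.Icc 1 V ∧ σ₃.arr (Arr.par (n := n)) z = 0 := by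
        rintro z (rfl | rfl)
        · exact ⟨huf.rep_mem _ ham, huf₃.par_rep _ ham⟩
        · exact ⟨huf.rep_mem _ hbm, huf₃.par_rep _ hbm⟩
      have hxm := hm x (by tauto)
      have hym := hm y (by tauto)
      have hxney : x ≠ y := by
        rcases hxy with ⟨rfl, rfl⟩ | ⟨rfl, rfl⟩
        · exact hne
        · exact fun e => hne e.symm
      have huf₅ := huf₃.link hxm.1 hym.1 hxm.2 hym.2 hxney hrk₄
      have hpot₅ := huf₃.potential_link (x := x) (y := y) hxm.2
      have hrc₅ := UnionFind.rootCount_link (V := V) hxm.1 hym.1 hxm.2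
      rw [← gpar, ← grk₅] at huf₅ hpot₅
      rw [← gpar] at hrc₅
      have hpb₅ := huf₅.potential_le hL
      refine ⟨M * (σ₅.reg Reg.tl - σ₅.reg Reg.hd +
          2 * n * rootCount V (σ₅.arr (Arr.par (n := n)))) + 12 * (2 * L * V) -
          12 * potential V (σ₅.arr (Arr.par (n := n))) (σ₅.arr (Arr.rk (n := n))),
          ⟨_, by rw [grz, h0], huf₅, ?_, by omega, ?_, by omega⟩, ?_⟩
      · rw [grh]
        exact hinv.join hd₀ huf hb hxy hT₅ htl₅ hpre₅ hnew₅ hold₅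
      · intro i hi
        rw [(hpre₅ i (by omega)).1, (hpre₅ i (by omega)).2]
        exact hpre i hi
      · have e₁ : σ₅.reg Reg.tl - σ₅.reg Reg.hd +
            2 * n * rootCount V (σ₅.arr (Arr.par (n := n))) + 1 ≤
            σ₁.reg Reg.tl - σ₁.reg Reg.hd +
            2 * n * rootCount V (σ₁.arr (Arr.par (n := n))) := by
          rw [← hrc₂, ← hrc₃, ← hrc₅, mul_add, grh]
          omega
        have e₂ := Nat.mul_le_mul_left M e₁
        rw [mul_add M _ 1] at e₂
        omega
  · have huf : UnionFind V (σ.arr (Arr.par (n := n))) (σ.arr (Arr.rk (n := n))) id := by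
      rw [hpar, hrk]
      exact unionFind_init V
    refine ⟨id, hz, huf, ?_, le_rfl, fun _ _ => ⟨rfl, rfl⟩, ?_⟩
    · rw [hhd]
      refine ⟨Nat.zero_le _, fun _ _ => rfl, hd₀.pair_mem, hd₀.pair_eq, fun i hi => by omega,
        fun l x hx h => ⟨x, hx, rfl, rfl⟩, fun R _ _ l u _ h => ⟨h, R.refl' _⟩⟩
    · have := huf.potential_le hL
      omega
  · rintro σ' t ⟨k', ⟨rep, h0, huf, hinv, htl, hpre, hk⟩, hb, ht⟩
    simp only [holds_lt, not_lt] at hb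
    have he : σ'.reg Reg.hd = σ'.reg Reg.tl := le_antisymm hinv.hd_le hb
    rw [he] at hinv
    refine ⟨rep, huf, hinv, ?_, ?_⟩
    · intro i hi
      rw [← (hpre i hi).1, ← (hpre i hi).2]
      exact hinv.joined i (by omega)
    · have hr : rootCount V (σ.arr (Arr.par (n := n))) ≤ V := by
        refine (Finset.card_filter_le _ _).trans ?_
        simp
      have hr' : σ.reg Reg.tl - σ.reg Reg.hd + 2 * n * rootCount V (σ.arr (Arr.par (n := n))) ≤
          σ.reg Reg.tl + 2 * n * V := by
        have := Nat.mul_le_mul_left (2 * n) hr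
        omega
      have := Nat.mul_le_mul_left (24 * (L + 2) + 28 * n + 40) hr'
      have e : 24 * L * V = 12 * (2 * L * V) := by ring
      omega

/-! ### Paths in labelled graphs -/

/-- `PathIn S v w u`: the word `w` can be read from `v` to `u`. -/
def PathIn {n : ℕ} {V : Type*} (S : V → Letter n → V → Prop) : V → Word n → V → Prop
  | v, [], u => v = u
  | v, l :: w, u => ∃ x, S v l x ∧ PathIn S x w u

/-- Edges can be read in both directions, and the end of a path is determined by its beginning and
its label. -/
structure IsInverse {n : ℕ} {V : Type*} (S : V → Letter n → V → Prop) : Prop where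
  det : ∀ {v l w w'}, S v l w → S v l w' → w = w'
  symm : ∀ {v l w}, S v l w → S w (linv l) v

section Paths

variable {n : ℕ} {V : Type*} {S : V → Letter n → V → Prop}

theorem pathIn_append {w w' : Word n} {v u : V} :
    PathIn S v (w ++ w') u ↔ ∃ x, PathIn S v w x ∧ PathIn S x w' u := by
  induction w generalizing v with
  | nil => simp [PathIn]
  | cons l w ih =>
    simp only [List.cons_append, PathIn, ih]
    constructor
    · rintro ⟨x, hx, y, hy, hy'⟩
      exact ⟨y, ⟨x, hx, hy⟩, hy'⟩
    · rintro ⟨y, ⟨x, hx, hy⟩, hy'⟩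
      exact ⟨x, hx, y, hy, hy'⟩

theorem pathIn_singleton {l : Letter n} {v u : V} : PathIn S v [l] u ↔ S v l u := by
  simp [PathIn]

theorem PathIn.map {V' : Type*} {S' : V' → Letter n → V' → Prop} (f : V → V')
    (hf : ∀ {v l w}, S v l w → S' (f v) l (f w)) {w : Word n} {v u : V} (h : PathIn S v w u) :
    PathIn S' (f v) w (f u) := by
  induction w generalizing v with
  | nil => exact congrArg f h
  | cons l w ih =>
    obtain ⟨x, hx, h⟩ := h
    exact ⟨f x, hf hx, ih h⟩

namespace IsInverse

theorem path_unique (hS : IsInverse S) {w : Word n} {v u u' : V} (h : PathIn S v w u)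
    (h' : PathIn S v w u') : u = u' := by
  induction w generalizing v with
  | nil => exact h.symm.trans h'
  | cons l w ih =>
    obtain ⟨x, hx, h⟩ := h
    obtain ⟨x', hx', h'⟩ := h'
    obtain rfl := hS.det hx hx'
    exact ih h h'

theorem path_invRev (hS : IsInverse S) {w : Word n} {v u : V} (h : PathIn S v w u) :
    PathIn S u (FreeGroup.invRev w) v := by
  induction w generalizing v with
  | nil => exact Eq.symm h
  | cons l w ih =>
    obtain ⟨x, hx, h⟩ := h
    have : FreeGroup.invRev (l :: w) = FreeGroup.invRev w ++ [linv l] := by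
      simp [FreeGroup.invRev, linv]
    rw [this, pathIn_append]
    exact ⟨x, ih h, pathIn_singleton.2 (hS.symm hx)⟩

/-- A letter followed by its inverse is read along an edge and back, since edges are reversible and
transitions deterministic. -/
theorem path_red (hS : IsInverse S) {w w' : Word n} (hr : FreeGroup.Red w w') {v u : V}
    (h : PathIn S v w u) : PathIn S v w' u := by
  induction hr with
  | refl => exact h
  | tail _ hs ih =>
    cases hs with
    | @not L₁ L₂ x b =>
      rw [pathIn_append] at ih ⊢
      obtain ⟨y, hy, y', hy', y'', hy'', hz⟩ := ih
      obtain rfl : y = y'' := hS.det (hS.symm hy') hy''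
      exact ⟨y, hy, hz⟩

theorem path_reduce (hS : IsInverse S) {w : Word n} {v u : V} (h : PathIn S v w u) :
    PathIn S v (FreeGroup.reduce w) u := hS.path_red FreeGroup.reduce.red h

theorem path_unique_of_mk_eq (hS : IsInverse S) {w w' : Word n} {v u u' : V} (h : PathIn S v w u)
    (h' : PathIn S v w' u') (he : FreeGroup.mk w = FreeGroup.mk w') : u = u' := by
  have h₁ := hS.path_reduce h
  rw [FreeGroup.reduce.sound he] at h₁
  exact hS.path_unique h₁ (hS.path_reduce h')

/-- If the generators can be read along loops, so can all elements of the subgroup. -/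
theorem exists_loop (hS : IsInverse S) {J : List (Word n)} {b : V}
    (hJ : ∀ w ∈ J, PathIn S b w b) {g : FreeGroup (Fin n)} (hg : g ∈ generated J) :
    ∃ w, FreeGroup.mk w = g ∧ PathIn S b w b := by
  induction hg using Subgroup.closure_induction with
  | mem g hg =>
    obtain ⟨w, hw, rfl⟩ := hg
    exact ⟨w, rfl, hJ w hw⟩
  | one => exact ⟨[], rfl, rfl⟩
  | mul g g' _ _ h h' =>
    obtain ⟨w, rfl, hw⟩ := h
    obtain ⟨w', rfl, hw'⟩ := h'
    exact ⟨w ++ w', by rw [FreeGroup.mul_mk], pathIn_append.2 ⟨b, hw, hw'⟩⟩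
  | inv g _ h =>
    obtain ⟨w, rfl, hw⟩ := h
    exact ⟨FreeGroup.invRev w, by rw [FreeGroup.inv_mk], hS.path_invRev hw⟩

end IsInverse

end Paths

/-! ### Foldings -/

theorem LGraph.Step.symm {n : ℕ} {Γ : LGraph n} {v w : Γ.V} {l : Letter n} (h : Γ.Step v l w) :
    Γ.Step w (linv l) v := by
  obtain ⟨e, he, h⟩ := h
  refine ⟨e, he, ?_⟩
  rcases h with ⟨h₁, h₂, h₃⟩ | ⟨h₁, h₂, h₃⟩
  · exact Or.inr ⟨by simp [linv, h₁], h₂, h₃⟩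
  · exact Or.inl ⟨by simp [linv, h₁], h₂, h₃⟩

theorem LGraph.IsFolded.isInverse {n : ℕ} {Γ : LGraph n} (h : Γ.IsFolded) : IsInverse Γ.Step where
  symm := LGraph.Step.symm
  det := by
    rintro v l w w' ⟨e, he, h₁⟩ ⟨e', he', h₂⟩
    rcases h₁ with ⟨h₁, h₃, h₄⟩ | ⟨h₁, h₃, h₄⟩ <;> rcases h₂ with ⟨h₂, h₅, h₆⟩ | ⟨h₂, h₅, h₆⟩
    · rw [← h₄, ← h₆, h e e' (he.trans he'.symm) (Or.inl (h₃.trans h₅.symm))]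
    · simp [h₁] at h₂
    · simp [h₁] at h₂
    · rw [← h₃, ← h₅, h e e' (he.trans he'.symm) (Or.inr (h₄.trans h₆.symm))]

/-- An elementary folding can be done as long as the graph is not folded. -/
theorem exists_elementaryFolding {n : ℕ} {Γ : LGraph n} [Finite Γ.E] (h : ¬ Γ.IsFolded) :
    ∃ Δ, ElementaryFolding Γ Δ ∧ Finite Δ.E ∧ Nat.card Δ.E < Nat.card Γ.E := by
  unfold LGraph.IsFolded at h
  push Not at h
  obtain ⟨e₁, e₂, hl, hinc, hne⟩ := h
  let sE : Setoid Γ.E :=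
    ⟨fun e e' => e = e' ∨ (e = e₁ ∧ e' = e₂) ∨ (e = e₂ ∧ e' = e₁), by
      constructor
      · exact fun _ => Or.inl rfl
      · intro x y h; aesop
      · intro x y z h h'; aesop⟩
  let sV : Setoid Γ.V :=
    ⟨fun v v' => v = v' ∨
      (v = Γ.src e₁ ∧ v' = Γ.src e₂) ∨ (v = Γ.src e₂ ∧ v' = Γ.src e₁) ∨
      (v = Γ.tgt e₁ ∧ v' = Γ.tgt e₂) ∨ (v = Γ.tgt e₂ ∧ v' = Γ.tgt e₁), by
      constructor
      · exact fun _ => Or.inl rfl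
      · intro x y h; tauto
      · intro x y z h h'
        -- Transitivity holds because the two edges share an end: one of the two pairs of ends is
        -- trivial, so at most one pair of vertices is identified.
        rcases hinc with h0 | h0 <;> simp only [h0] at h h' ⊢ <;> grind⟩
  have hsrc : ∀ e e', sE e e' → sV (Γ.src e) (Γ.src e') := by
    rintro e e' (rfl | ⟨rfl, rfl⟩ | ⟨rfl, rfl⟩)
    · exact Or.inl rfl
    · exact Or.inr (Or.inl ⟨rfl, rfl⟩)
    · exact Or.inr (Or.inr (Or.inl ⟨rfl, rfl⟩))
  have htgt : ∀ e e', sE e e' → sV (Γ.tgt e) (Γ.tgt e') := by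
    rintro e e' (rfl | ⟨rfl, rfl⟩ | ⟨rfl, rfl⟩)
    · exact Or.inl rfl
    · exact Or.inr (Or.inr (Or.inr (Or.inl ⟨rfl, rfl⟩)))
    · exact Or.inr (Or.inr (Or.inr (Or.inr ⟨rfl, rfl⟩)))
  have hlab : ∀ e e', sE e e' → Γ.label e = Γ.label e' := by
    rintro e e' (rfl | ⟨rfl, rfl⟩ | ⟨rfl, rfl⟩)
    · rfl
    · exact hl
    · exact hl.symm
  let Δ : LGraph n :=
    { V := Quotient sV
      E := Quotient sE
      src := Quotient.map Γ.src hsrc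
      tgt := Quotient.map Γ.tgt htgt
      label := Quotient.lift Γ.label hlab
      base := Quotient.mk sV Γ.base }
  refine ⟨Δ, ⟨e₁, e₂, hne, hl, hinc, Quotient.mk sV, Quotient.mk sE, Quotient.mk_surjective,
    Quotient.mk_surjective, fun _ => rfl, fun _ => rfl, fun _ => rfl, rfl,
    fun e e' => Quotient.eq, fun v v' => Quotient.eq⟩, Quotient.finite sE, ?_⟩
  refine lt_of_le_of_ne (Nat.card_le_card_of_surjective _ Quotient.mk_surjective) fun he => hne ?_
  have hinj : Function.Injective (Quotient.mk sE) := by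
    have := Fintype.ofFinite Γ.E
    have := Fintype.ofFinite (Quotient sE)
    refine ((Fintype.bijective_iff_surjective_and_card _).2 ⟨Quotient.mk_surjective, ?_⟩).1
    rw [← Nat.card_eq_fintype_card, ← Nat.card_eq_fintype_card]
    exact he.symm
  exact hinj (Quotient.sound (s := sE) (Or.inr (Or.inl ⟨rfl, rfl⟩)))

/-- The number of edges decreases with each folding. -/
theorem exists_folded {n : ℕ} (k : ℕ) : ∀ Γ : LGraph n, Finite Γ.E → Nat.card Γ.E = k →
    ∃ Δ, Relation.ReflTransGen ElementaryFolding Γ Δ ∧ Δ.IsFolded := by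
  induction k using Nat.strong_induction_on with
  | _ k ih =>
    intro Γ hΓ hk
    by_cases h : Γ.IsFolded
    · exact ⟨Γ, .refl, h⟩
    · obtain ⟨Δ, hΔ, hfin, hlt⟩ := exists_elementaryFolding h
      obtain ⟨Δ', h₁, h₂⟩ := ih _ (hk ▸ hlt) Δ hfin rfl
      exact ⟨Δ', .head hΔ h₁, h₂⟩

theorem exists_isFoldedGraphOf {n : ℕ} (J : List (Word n)) : ∃ Γ, IsFoldedGraphOf J Γ :=
  exists_folded _ (bouquet J) (by unfold bouquet; infer_instance) rfl

/-- What all graphs in a folding process have in common: the generators label loops, these cover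
the graph, and there is a morphism to the graph of cosets. -/
structure Carries {n : ℕ} (J : List (Word n)) (Γ : LGraph n) : Prop where
  loop : ∀ w ∈ J, PathIn Γ.Step Γ.base w Γ.base
  conn : ∀ v, ∃ w, PathIn Γ.Step Γ.base w v
  -- Each edge is passed by one of the generator loops, in one direction or the other. This later
  -- shows that the computed graph misses no edge of `Γ`.
  edge : ∀ {v l u}, Γ.Step v l u → ∃ w ∈ J, ∃ p s,
    (w = p ++ l :: s ∧ PathIn Γ.Step Γ.base p v) ∨
    (w = p ++ linv l :: s ∧ PathIn Γ.Step Γ.base p u)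
  -- The quotient consists of left cosets, so the right coset `Hg` of the label `g` of a path from
  -- the base is represented by the left coset of `g⁻¹`, and reading a letter multiplies by its
  -- inverse on the left.
  coset : ∃ c : Γ.V → FreeGroup (Fin n) ⧸ generated J, c Γ.base = ((1 : FreeGroup (Fin n)) : _) ∧
    ∀ {v l u}, Γ.Step v l u → c u = (FreeGroup.mk [l])⁻¹ • c v

theorem Carries.elementaryFolding {n : ℕ} {J : List (Word n)} {Γ Δ : LGraph n} (h : Carries J Γ)
    (hf : ElementaryFolding Γ Δ) : Carries J Δ := by
  obtain ⟨e₁, e₂, hne, hl, hinc, πV, πE, hV, hE, hsrc, htgt, hlab, hbase, hkE, hkV⟩ := hf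
  have hstep : ∀ {v l u}, Γ.Step v l u → Δ.Step (πV v) l (πV u) := by
    rintro v l u ⟨e, he, h⟩
    refine ⟨πE e, by rw [hlab, he], ?_⟩
    rw [hsrc, htgt]
    rcases h with ⟨h₁, rfl, rfl⟩ | ⟨h₁, rfl, rfl⟩
    · exact Or.inl ⟨h₁, rfl, rfl⟩
    · exact Or.inr ⟨h₁, rfl, rfl⟩
  have hlift : ∀ {v l u}, Δ.Step v l u → ∃ v' u', Γ.Step v' l u' ∧ πV v' = v ∧ πV u' = u := by
    rintro v l u ⟨e', he, h⟩
    obtain ⟨e, rfl⟩ := hE e'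
    rw [hlab] at he
    rw [hsrc, htgt] at h
    rcases h with ⟨h₁, h₂, h₃⟩ | ⟨h₁, h₂, h₃⟩
    · exact ⟨_, _, ⟨e, he, Or.inl ⟨h₁, rfl, rfl⟩⟩, h₂, h₃⟩
    · exact ⟨_, _, ⟨e, he, Or.inr ⟨h₁, rfl, rfl⟩⟩, h₃, h₂⟩
  refine ⟨?_, ?_, ?_, ?_⟩
  · intro w hw
    rw [hbase]
    exact (h.loop w hw).map πV hstep
  · intro v
    obtain ⟨v, rfl⟩ := hV v
    obtain ⟨w, hw⟩ := h.conn v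
    rw [hbase]
    exact ⟨w, hw.map πV hstep⟩
  · intro v l u hs
    obtain ⟨v, u, hs', rfl, rfl⟩ := hlift hs
    obtain ⟨w, hw, p, s, h'⟩ := h.edge hs'
    refine ⟨w, hw, p, s, ?_⟩
    rw [hbase]
    rcases h' with ⟨h₁, h₂⟩ | ⟨h₁, h₂⟩
    · exact Or.inl ⟨h₁, h₂.map πV hstep⟩
    · exact Or.inr ⟨h₁, h₂.map πV hstep⟩
  · obtain ⟨c, hc, hcs⟩ := h.coset
    -- The folded edges have the same label and a common end. Labels act by bijections on the
    -- cosets, so their other ends lie in the same coset and `c` factors through the folding.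
    have hker : ∀ v v', πV v = πV v' → c v = c v' := by
      have hst : ∀ e, c (Γ.tgt e) = (FreeGroup.mk [((Γ.label e, true) : Letter n)])⁻¹ • c (Γ.src e) :=
        fun e => hcs ⟨e, rfl, Or.inl ⟨rfl, rfl, rfl⟩⟩
      have h₁ := hst e₁
      have h₂ := hst e₂
      rw [← hl] at h₂
      have key : c (Γ.src e₁) = c (Γ.src e₂) ∧ c (Γ.tgt e₁) = c (Γ.tgt e₂) := by
        rcases hinc with h0 | h0
        · exact ⟨by rw [h0], by rw [h₁, h₂, h0]⟩
        · refine ⟨?_, by rw [h0]⟩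
          rw [h0, h₂] at h₁
          exact (smul_left_cancel _ h₁).symm
      intro v v' hvv
      rcases (hkV v v').1 hvv with rfl | ⟨rfl, rfl⟩ | ⟨rfl, rfl⟩ | ⟨rfl, rfl⟩ | ⟨rfl, rfl⟩
      · rfl
      · exact key.1
      · exact key.1.symm
      · exact key.2
      · exact key.2.symm
    have hsurj : ∀ v, c (Function.surjInv hV (πV v)) = c v :=
      fun v => hker _ _ (Function.surjInv_eq hV _)
    refine ⟨fun v => c (Function.surjInv hV v), ?_, ?_⟩
    · rw [hbase]
      exact (hsurj _).trans hc
    · intro v l u hs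
      obtain ⟨v, u, hs', rfl, rfl⟩ := hlift hs
      simp only [hsurj]
      exact hcs hs'

/-! ### The bouquet -/

section Bouquet

variable {n : ℕ} (J : List (Word n))

theorem bouquetPos_zero (i : Fin J.length) : bouquetPos J i 0 = (bouquet J).base := by
  simp [bouquetPos, bouquet]

theorem bouquetPos_length (i : Fin J.length) :
    bouquetPos J i (J.get i).length = (bouquet J).base := by
  simp [bouquetPos, bouquet]

theorem bouquet_step (i : Fin J.length) (k : Fin (J.get i).length) :
    (bouquet J).Step (bouquetPos J i k) ((J.get i).get k) (bouquetPos J i (k + 1)) := by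
  refine ⟨⟨i, k⟩, rfl, ?_⟩
  by_cases h : ((J.get i).get k).2 = true
  · refine Or.inl ⟨h, ?_, ?_⟩
    · simp only [bouquet, h, if_true]
    · simp only [bouquet, h, if_true]
  · refine Or.inr ⟨by simpa using h, ?_, ?_⟩
    · simp only [bouquet, h, if_false, Bool.false_eq_true]
    · simp only [bouquet, h, if_false, Bool.false_eq_true]

theorem bouquet_step_cases {v u : (bouquet J).V} {l : Letter n} (h : (bouquet J).Step v l u) :
    ∃ (i : Fin J.length) (k : Fin (J.get i).length),
      (l = (J.get i).get k ∧ v = bouquetPos J i k ∧ u = bouquetPos J i (k + 1)) ∨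
      (linv l = (J.get i).get k ∧ u = bouquetPos J i k ∧ v = bouquetPos J i (k + 1)) := by
  obtain ⟨⟨i, k⟩, he, h⟩ := h
  refine ⟨i, k, ?_⟩
  obtain ⟨a, b⟩ := l
  have he : ((J.get i).get k).1 = a := he
  simp only [bouquet] at h
  by_cases hb : ((J.get i).get k).2 = true
  · simp only [hb, if_true] at h
    rcases h with ⟨h₁, h₂, h₃⟩ | ⟨h₁, h₂, h₃⟩
    · exact Or.inl ⟨Prod.ext he.symm (h₁.trans hb.symm), h₂.symm, h₃.symm⟩
    · exact Or.inr ⟨Prod.ext he.symm (by simp only [linv]; rw [hb, h₁]; rfl), h₂.symm, h₃.symm⟩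
  · simp only [hb, if_false, Bool.false_eq_true] at h
    rw [Bool.not_eq_true] at hb
    rcases h with ⟨h₁, h₂, h₃⟩ | ⟨h₁, h₂, h₃⟩
    · exact Or.inr ⟨Prod.ext he.symm (by simp only [linv]; rw [hb, h₁]; rfl), h₃.symm, h₂.symm⟩
    · exact Or.inl ⟨Prod.ext he.symm (h₁.trans hb.symm), h₃.symm, h₂.symm⟩

theorem bouquet_path (i : Fin J.length) {k : ℕ} (hk : k ≤ (J.get i).length) :
    PathIn (bouquet J).Step (bouquet J).base ((J.get i).take k) (bouquetPos J i k) := by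
  induction k with
  | zero => exact (bouquetPos_zero J i).symm
  | succ k ih =>
    rw [List.take_add_one, List.getElem?_eq_getElem (by omega)]
    refine pathIn_append.2 ⟨_, ih (by omega), ?_⟩
    exact pathIn_singleton.2 (bouquet_step J i ⟨k, by omega⟩)

theorem carries_bouquet : Carries J (bouquet J) where
  loop w hw := by
    obtain ⟨i, rfl⟩ := List.get_of_mem hw
    have := bouquet_path J i le_rfl
    rwa [List.take_length, bouquetPos_length] at this
  conn v := by
    match v with
    | none => exact ⟨[], rfl⟩
    | some ⟨i, k⟩ =>
      have hk := k.2
      have h := bouquet_path J i (k := k + 1) (by omega)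
      have e : bouquetPos J i (k + 1) = some ⟨i, k⟩ := by
        unfold bouquetPos
        rw [dif_pos (by omega)]
        rfl
      rw [e] at h
      exact ⟨_, h⟩
  edge := by
    intro v l u h
    obtain ⟨i, k, h⟩ := bouquet_step_cases J h
    have hd : J.get i = (J.get i).take k ++ (J.get i).get k :: (J.get i).drop (k + 1) := by
      conv_lhs => rw [← List.take_append_drop k (J.get i)]
      congr 1
      exact List.drop_eq_getElem_cons k.2
    have hp := bouquet_path J i k.2.le
    refine ⟨J.get i, List.get_mem J i, (J.get i).take k, (J.get i).drop (k + 1), ?_⟩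
    rcases h with ⟨h₁, h₂, h₃⟩ | ⟨h₁, h₂, h₃⟩
    · exact Or.inl ⟨by rw [h₁]; exact hd, by rw [h₂]; exact hp⟩
    · exact Or.inr ⟨by rw [h₁]; exact hd, by rw [h₂]; exact hp⟩
  coset := by
    -- An inner vertex goes to the inverse of the prefix read so far. Closing the circle is
    -- consistent because the whole word lies in the subgroup.
    let c : (bouquet J).V → FreeGroup (Fin n) ⧸ generated J := fun v => match v with
      | none => ((1 : FreeGroup (Fin n)) : _)
      | some ⟨i, k⟩ => (((FreeGroup.mk ((J.get i).take (k + 1)))⁻¹ : FreeGroup (Fin n)) : _)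
    have hc : ∀ i k, k ≤ (J.get i).length →
        c (bouquetPos J i k) = (((FreeGroup.mk ((J.get i).take k))⁻¹ : FreeGroup (Fin n)) : _) := by
      intro i k hk
      unfold bouquetPos
      split_ifs with h
      · have : k - 1 + 1 = k := by omega
        simp only [c, this]
      · have h' : k = 0 ∨ k = (J.get i).length := by omega
        change ((1 : FreeGroup (Fin n)) : FreeGroup (Fin n) ⧸ generated J) = _
        rw [QuotientGroup.eq, inv_one, one_mul]
        rcases h' with rfl | rfl
        · simp [← FreeGroup.one_eq_mk]
        · rw [List.take_length]
          exact inv_mem (Subgroup.subset_closure ⟨_, List.get_mem J i, rfl⟩)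
    refine ⟨c, rfl, ?_⟩
    have hs : ∀ i (k : Fin (J.get i).length), c (bouquetPos J i (k + 1)) =
        (FreeGroup.mk [(J.get i).get k])⁻¹ • c (bouquetPos J i k) := by
      intro i k
      rw [hc i _ k.2, hc i k k.2.le, MulAction.Quotient.smul_coe, smul_eq_mul, ← mul_inv_rev,
        FreeGroup.mul_mk, List.take_add_one, List.getElem?_eq_getElem k.2]
      rfl
    intro v l u h
    obtain ⟨i, k, ⟨rfl, rfl, rfl⟩ | ⟨h₁, rfl, rfl⟩⟩ := bouquet_step_cases J h
    · exact hs i k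
    · rw [hs i k, ← h₁, smul_smul]
      have : (FreeGroup.mk [l])⁻¹ * (FreeGroup.mk [linv l])⁻¹ = 1 := by
        rw [FreeGroup.inv_mk, FreeGroup.inv_mk, FreeGroup.mul_mk, FreeGroup.one_eq_mk]
        simp only [FreeGroup.invRev, linv]
        exact Quot.sound (FreeGroup.Red.Step.not (L₁ := []) (L₂ := []))
      rw [this, one_smul]

end Bouquet

theorem IsFoldedGraphOf.carries {n : ℕ} {J : List (Word n)} {Γ : LGraph n}
    (h : IsFoldedGraphOf J Γ) : Carries J Γ := by
  obtain ⟨h, -⟩ := h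
  induction h with
  | refl => exact carries_bouquet J
  | tail _ hf ih => exact ih.elementaryFolding hf

/-- The map to the cosets sends the end of a path labelled `w` from the base to the coset of `w⁻¹`;
for a loop this must be the trivial coset. -/
theorem Carries.mem_of_loop {n : ℕ} {J : List (Word n)} {Γ : LGraph n} (h : Carries J Γ)
    {w : Word n} (hw : PathIn Γ.Step Γ.base w Γ.base) : FreeGroup.mk w ∈ generated J := by
  obtain ⟨c, hc, hcs⟩ := h.coset
  have key : ∀ (w : Word n) v u, PathIn Γ.Step v w u → c u = (FreeGroup.mk w)⁻¹ • c v := by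
    intro w
    induction w with
    | nil =>
      rintro v u rfl
      rw [← FreeGroup.one_eq_mk, inv_one, one_smul]
    | cons l w ih =>
      rintro v u ⟨x, hx, hw⟩
      rw [ih x u hw, hcs hx, smul_smul, ← mul_inv_rev, FreeGroup.mul_mk]
      rfl
  have := key w _ _ hw
  rw [hc, MulAction.Quotient.smul_coe, smul_eq_mul, mul_one, QuotientGroup.eq, inv_one, one_mul,
    inv_mem_iff] at this
  exact this

/-- An element of the subgroup is represented by some loop, a product of generators and their
inverses; its reduced form is still a loop because the graph is folded. -/
theorem Carries.mem_generated_iff {n : ℕ} {J : List (Word n)} {Γ : LGraph n} (h : Carries J Γ)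
    (hf : Γ.IsFolded) {w : Word n} :
    FreeGroup.mk w ∈ generated J ↔ PathIn Γ.Step Γ.base (FreeGroup.reduce w) Γ.base := by
  constructor
  · intro hw
    obtain ⟨w', he, hw'⟩ := hf.isInverse.exists_loop h.loop hw
    rw [← FreeGroup.reduce.sound he]
    exact hf.isInverse.path_reduce hw'
  · intro hw
    rw [← FreeGroup.reduce.self (L := w)]
    exact h.mem_of_loop hw

/-! ### Geodesic spanning trees and Schreier transversals -/

/-- The words `τ v` are the labels of the paths in a spanning tree rooted at the base point, and the
depths of neighbours differ by at most one. -/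
structure GeodesicTree {n : ℕ} (Γ : LGraph n) (τ : Γ.V → Word n) : Prop where
  folded : Γ.IsFolded
  base : τ Γ.base = []
  step : ∀ v, v ≠ Γ.base → ∃ p l, Γ.Step p l v ∧ τ v = τ p ++ [l]
  lip : ∀ {v l u}, Γ.Step v l u → (τ u).length ≤ (τ v).length + 1

/-! ### Reduced words and their longest readable prefixes. -/

theorem isReduced_of_length_le {n : ℕ} {w : Word n} (h : w.length ≤ (FreeGroup.reduce w).length) :
    FreeGroup.IsReduced w :=
  .of_reduce_eq (FreeGroup.reduce.red.sublist.eq_of_length_le h)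

theorem toWord_mk_of_isReduced {n : ℕ} {w : Word n} (h : FreeGroup.IsReduced w) :
    (FreeGroup.mk w).toWord = w := by
  rw [FreeGroup.toWord_mk, h.reduce_eq]

/-- A reduced path can be continued by a reduced word that cannot be read at its end. -/
theorem isReduced_append {n : ℕ} {V : Type*} {S : V → Letter n → V → Prop} (hS : IsInverse S)
    {p s : Word n} {b v : V} (hp : PathIn S b p v) (hpr : FreeGroup.IsReduced p)
    (hs : FreeGroup.IsReduced s) (hh : ∀ l ∈ s.head?, ¬ ∃ w, S v l w) :
    FreeGroup.IsReduced (p ++ s) := by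
  unfold FreeGroup.IsReduced
  rw [List.isChain_append]
  refine ⟨hpr, hs, ?_⟩
  intro x hx y hy hxy
  by_contra hne
  have hyx : y = linv x := by
    refine Prod.ext hxy.symm ?_
    revert hne
    simp only [linv]
    cases x.2 <;> cases y.2 <;> simp
  obtain ⟨p', rfl⟩ : ∃ p', p = p' ++ [x] := by
    obtain ⟨h, rfl⟩ := List.mem_getLast?_eq_getLast hx
    exact ⟨p.dropLast, (List.dropLast_append_getLast h).symm⟩
  rw [pathIn_append] at hp
  obtain ⟨z, _, hz⟩ := hp
  exact hh y hy ⟨z, hyx ▸ hS.symm (pathIn_singleton.1 hz)⟩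

/-- If one of the two readable prefixes were shorter, its next letter could be read along the other
path. In a deterministic graph the decomposition is therefore determined by the word. -/
theorem eq_of_maximal_prefix {n : ℕ} {V : Type*} {S : V → Letter n → V → Prop} (hS : IsInverse S)
    {p s p' s' : Word n} {b v v' : V} (hp : PathIn S b p v) (hp' : PathIn S b p' v')
    (hh : ∀ l ∈ s.head?, ¬ ∃ w, S v l w) (hh' : ∀ l ∈ s'.head?, ¬ ∃ w, S v' l w)
    (he : p ++ s = p' ++ s') : v = v' ∧ s = s' := by
  induction p generalizing b p' with
  | nil =>
    cases p' with
    | nil => exact ⟨Eq.trans (Eq.symm hp) hp', he⟩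
    | cons l p' =>
      obtain rfl : b = v := hp
      obtain ⟨x, hx, _⟩ := hp'
      rw [List.nil_append] at he
      exact absurd ⟨x, hx⟩ (hh l (by rw [he]; rfl))
  | cons l p ih =>
    cases p' with
    | nil =>
      obtain rfl : b = v' := hp'
      obtain ⟨x, hx, _⟩ := hp
      rw [List.nil_append] at he
      exact absurd ⟨x, hx⟩ (hh' l (by rw [← he]; rfl))
    | cons l' p' =>
      obtain ⟨x, hx, hp⟩ := hp
      obtain ⟨x', hx', hp'⟩ := hp'
      simp only [List.cons_append, List.cons.injEq] at he
      obtain ⟨rfl, he⟩ := he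
      obtain rfl := hS.det hx hx'
      exact ih hp hp' he

theorem exists_maximal_prefix {n : ℕ} {V : Type*} (S : V → Letter n → V → Prop) (w : Word n)
    (b : V) : ∃ p s v, w = p ++ s ∧ PathIn S b p v ∧ ∀ l ∈ s.head?, ¬ ∃ w, S v l w := by
  induction w generalizing b with
  | nil => exact ⟨[], [], b, rfl, rfl, by simp⟩
  | cons l w ih =>
    by_cases h : ∃ x, S b l x
    · obtain ⟨x, hx⟩ := h
      obtain ⟨p, s, v, rfl, hp, hs⟩ := ih x
      exact ⟨l :: p, s, v, rfl, ⟨x, hx, hp⟩, hs⟩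
    · exact ⟨[], l :: w, b, rfl, rfl, by simpa using h⟩

namespace GeodesicTree

variable {n : ℕ} {J : List (Word n)} {Γ : LGraph n} {τ : Γ.V → Word n}

theorem path (h : GeodesicTree Γ τ) (v : Γ.V) : PathIn Γ.Step Γ.base (τ v) v := by
  induction hk : (τ v).length generalizing v with
  | zero =>
    by_cases hv : v = Γ.base
    · subst hv
      rw [h.base]
      rfl
    · obtain ⟨p, l, _, he⟩ := h.step v hv
      rw [he] at hk
      simp at hk
  | succ k ih =>
    by_cases hv : v = Γ.base
    · rw [hv, h.base] at hk
      simp at hk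
    · obtain ⟨p, l, hs, he⟩ := h.step v hv
      rw [he] at hk ⊢
      rw [List.length_append, List.length_singleton] at hk
      exact pathIn_append.2 ⟨p, ih p (by omega), pathIn_singleton.2 hs⟩

theorem injective (h : GeodesicTree Γ τ) : Function.Injective τ := by
  intro v u he
  have := h.path v
  rw [he] at this
  exact h.folded.isInverse.path_unique this (h.path u)

theorem length_le (h : GeodesicTree Γ τ) {w : Word n} {v u : Γ.V} (hp : PathIn Γ.Step v w u) :
    (τ u).length ≤ (τ v).length + w.length := by
  induction w generalizing v with
  | nil => obtain rfl : v = u := hp; simp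
  | cons l w ih =>
    obtain ⟨x, hx, hp⟩ := hp
    have h₁ := h.lip hx
    have h₂ := ih hp
    rw [List.length_cons]
    omega

/-- By the Lipschitz condition no path from the base to `v` is shorter than `τ v`, whereas reducing
a word that is not reduced would give one. -/
theorem isReduced (h : GeodesicTree Γ τ) (v : Γ.V) : FreeGroup.IsReduced (τ v) := by
  refine isReduced_of_length_le ?_
  have := h.length_le (h.folded.isInverse.path_reduce (h.path v))
  rw [h.base] at this
  simpa using this

theorem isReduced_append (h : GeodesicTree Γ τ) {v : Γ.V} {s : Word n}
    (hs : FreeGroup.IsReduced s) (hh : ∀ l ∈ s.head?, ¬ ∃ w, Γ.Step v l w) :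
    FreeGroup.IsReduced (τ v ++ s) :=
  Folding.isReduced_append h.folded.isInverse (h.path v) (h.isReduced v) hs hh

theorem exists_prefix (h : GeodesicTree Γ τ) (v : Γ.V) {p : Word n} (hp : p <+: τ v) :
    ∃ u, τ u = p := by
  induction hk : (τ v).length generalizing v with
  | zero =>
    rw [List.length_eq_zero_iff] at hk
    rw [hk] at hp
    exact ⟨v, by rw [hk, List.prefix_nil.1 hp]⟩
  | succ k ih =>
    by_cases hv : v = Γ.base
    · rw [hv, h.base] at hk
      simp at hk
    · obtain ⟨q, l, hs, he⟩ := h.step v hv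
      rw [he, List.prefix_concat_iff] at hp
      rcases hp with rfl | hp
      · exact ⟨v, he⟩
      · rw [he, List.length_append, List.length_singleton] at hk
        exact ih q hp (by omega)

/-- Write the reduced word of `g` as `p ++ s`, with `p` its longest prefix readable from the base,
ending at `v`. Then `p` and `τ v` end at the same vertex, so `τ v ++ s` represents the coset of `g`.
Conversely, if `τ v' ++ s'` represents it, then `g` is a loop followed by `τ v'` and `s'`; after
reducing the part before `s'` the whole word is reduced, and its longest readable prefix ends at
`v'`. By uniqueness of that decomposition `v' = v` and `s' = s`. -/
theorem isSchreierTransversal (h : GeodesicTree Γ τ) (hc : Carries J Γ) :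
    IsSchreierTransversal (generated J) (Γ.treeTransversal τ) := by
  have hS := h.folded.isInverse
  constructor
  · rw [Subgroup.isComplement_iff_existsUnique_mul_inv_mem]
    intro g
    obtain ⟨p, s, v, hw, hp, hs⟩ := exists_maximal_prefix Γ.Step g.toWord Γ.base
    have hgr : FreeGroup.IsReduced (p ++ s) := hw ▸ FreeGroup.isReduced_toWord
    have hsr : FreeGroup.IsReduced s := hgr.infix (List.suffix_append p s).isInfix
    have hg : g = FreeGroup.mk p * FreeGroup.mk s := by
      rw [FreeGroup.mul_mk, ← hw, FreeGroup.mk_toWord]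
    refine ⟨⟨FreeGroup.mk (τ v ++ s), v, s, hsr, hs, rfl⟩, ?_, ?_⟩
    · change g * (FreeGroup.mk (τ v ++ s))⁻¹ ∈ generated J
      have e : g * (FreeGroup.mk (τ v ++ s))⁻¹ = FreeGroup.mk (p ++ FreeGroup.invRev (τ v)) := by
        rw [hg, ← FreeGroup.mul_mk, ← FreeGroup.mul_mk, ← FreeGroup.inv_mk]
        group
      rw [e]
      exact hc.mem_of_loop (pathIn_append.2 ⟨v, hp, hS.path_invRev (h.path v)⟩)
    · rintro ⟨t, v', s', hsr', hs', rfl⟩ ht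
      change g * (FreeGroup.mk (τ v' ++ s'))⁻¹ ∈ generated J at ht
      obtain ⟨w, hw', hloop⟩ := hS.exists_loop hc.loop ht
      have hq : PathIn Γ.Step Γ.base (FreeGroup.reduce (w ++ τ v')) v' :=
        hS.path_reduce (pathIn_append.2 ⟨_, hloop, h.path v'⟩)
      have hqr : FreeGroup.IsReduced (FreeGroup.reduce (w ++ τ v')) := .of_reduce_eq
        FreeGroup.reduce.idem
      have hqs := Folding.isReduced_append hS hq hqr hsr' hs'
      have hge : g = FreeGroup.mk (FreeGroup.reduce (w ++ τ v') ++ s') := by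
        rw [← FreeGroup.mul_mk, FreeGroup.reduce.self, ← FreeGroup.mul_mk, hw',
          ← FreeGroup.mul_mk]
        group
      rw [hge, toWord_mk_of_isReduced hqs] at hw
      obtain ⟨rfl, rfl⟩ := eq_of_maximal_prefix hS hq hp hs' hs hw
      rfl
  · rintro g ⟨v, s, hsr, hs, rfl⟩ p hp
    rw [toWord_mk_of_isReduced (h.isReduced_append hsr hs)] at hp
    rcases List.prefix_or_prefix_of_prefix hp (List.prefix_append (τ v) s) with hp' | ⟨r, rfl⟩
    · obtain ⟨u, rfl⟩ := h.exists_prefix v hp'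
      exact ⟨u, [], .nil, by simp, by simp⟩
    · have hr : r <+: s := (List.prefix_append_right_inj _).1 hp
      refine ⟨v, r, hsr.infix hr.isInfix, ?_, rfl⟩
      intro l hl
      refine hs l ?_
      obtain ⟨t, rfl⟩ := hr
      cases r with
      | nil => simp at hl
      | cons a r => exact hl

theorem treeTransversal_of_complete (hcomp : ∀ v l, ∃ w, Γ.Step v l w) :
    Γ.treeTransversal τ = Set.range fun v => FreeGroup.mk (τ v) := by
  ext g
  constructor
  · rintro ⟨v, s, hsr, hs, rfl⟩
    cases s with
    | nil => exact ⟨v, by simp⟩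
    | cons l s => exact absurd (hcomp v l) (hs l rfl)
  · rintro ⟨v, rfl⟩
    exact ⟨v, [], .nil, by simp, by simp⟩

theorem index_of_complete (h : GeodesicTree Γ τ) (hc : Carries J Γ)
    (hcomp : ∀ v l, ∃ w, Γ.Step v l w) : (generated J).index = Nat.card Γ.V := by
  rw [← (h.isSchreierTransversal hc).1.card_right, treeTransversal_of_complete hcomp]
  refine Nat.card_range_of_injective fun v u he => h.injective ?_
  have := congrArg FreeGroup.toWord he
  rwa [toWord_mk_of_isReduced (h.isReduced v), toWord_mk_of_isReduced (h.isReduced u)] at this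

/-- If `l` cannot be read at `v`, the elements `τ v * l ^ (k + 1)` all belong to the transversal and
have different lengths. -/
theorem not_finiteIndex (h : GeodesicTree Γ τ) (hc : Carries J Γ)
    (hcomp : ¬ ∀ v l, ∃ w, Γ.Step v l w) : ¬ (generated J).FiniteIndex := by
  rw [← (h.isSchreierTransversal hc).1.finite_right_iff]
  push Not at hcomp
  obtain ⟨v, l, hl⟩ := hcomp
  have hr : ∀ k, FreeGroup.IsReduced (List.replicate k l) := fun k =>
    .of_reduce_eq (FreeGroup.reduce_replicate k l)
  have hh : ∀ k, ∀ l' ∈ (List.replicate (k + 1) l).head?, ¬ ∃ w, Γ.Step v l' w := by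
    intro k l' hl'
    simp only [List.replicate_succ, List.head?_cons, Option.mem_def, Option.some.injEq] at hl'
    subst hl'
    simpa using hl
  let f : ℕ → Γ.treeTransversal τ := fun k =>
    ⟨FreeGroup.mk (τ v ++ List.replicate (k + 1) l), v, _, hr _, hh k, rfl⟩
  have hf : Function.Injective f := by
    intro j k he
    have := congrArg (fun x : Γ.treeTransversal τ => (FreeGroup.toWord x.1).length) he
    simp only [f] at this
    rw [toWord_mk_of_isReduced (h.isReduced_append (hr _) (hh j)),
      toWord_mk_of_isReduced (h.isReduced_append (hr _) (hh k))] at this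
    simpa using this
  intro hfin
  exact (Finite.of_injective f hf).false

end GeodesicTree

/-! ### Nielsen bases from geodesic trees -/

/-- The edge from `v` to `u` with label `l` belongs to the tree. -/
def IsTreeEdge {n : ℕ} {V : Type*} (τ : V → Word n) (v : V) (l : Letter n) (u : V) : Prop :=
  τ u = τ v ++ [l] ∨ τ v = τ u ++ [linv l]

theorem IsTreeEdge.symm {n : ℕ} {V : Type*} {τ : V → Word n} {v u : V} {l : Letter n}
    (h : IsTreeEdge τ v l u) : IsTreeEdge τ u (linv l) v := by
  unfold IsTreeEdge
  rw [linv_linv]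
  exact Or.symm h

/-- `E` enumerates the edges outside the tree. -/
structure IsCotree {n : ℕ} {Γ : LGraph n} (τ : Γ.V → Word n) {r : ℕ}
    (E : Fin r → Γ.V × Fin n × Γ.V) : Prop where
  inj : Function.Injective E
  mem : ∀ v i u, (∃ j, E j = (v, i, u)) ↔ Γ.Step v (i, true) u ∧ ¬ IsTreeEdge τ v (i, true) u

/-- The label of the loop through the edge `e` that otherwise runs in the tree. -/
def cotreeWord {n : ℕ} {V : Type*} (τ : V → Word n) (e : V × Fin n × V) : Word n :=
  τ e.1 ++ (e.2.1, true) :: FreeGroup.invRev (τ e.2.2)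

section Oriented

variable {n r : ℕ} {V : Type*} (E : Fin r → V × Fin n × V) (j : Letter r)

/-- The beginning of an oriented edge outside the tree. -/
def osrc : V := if j.2 then (E j.1).1 else (E j.1).2.2

/-- The end of an oriented edge outside the tree. -/
def otgt : V := osrc E (linv j)

/-- The label of an oriented edge outside the tree. -/
def olab : Letter n := ((E j.1).2.1, j.2)

/-- The label of the loop through an oriented edge that otherwise runs in the tree. -/
def oword (τ : V → Word n) : Word n :=
  τ (osrc E j) ++ olab E j :: FreeGroup.invRev (τ (otgt E j))

theorem otgt_linv : otgt E (linv j) = osrc E j := by simp [otgt]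

theorem olab_linv : olab E (linv j) = linv (olab E j) := rfl

theorem oword_true (τ : V → Word n) (i : Fin r) :
    oword E (i, true) τ = cotreeWord τ (E i) := rfl

theorem oword_linv (τ : V → Word n) : oword E (linv j) τ = FreeGroup.invRev (oword E j τ) := by
  have h : ∀ (x y : Word n) (l : Letter n), FreeGroup.invRev (x ++ l :: FreeGroup.invRev y) =
      y ++ linv l :: FreeGroup.invRev x := by
    intro x y l
    rw [FreeGroup.invRev_append, show l :: FreeGroup.invRev y = [l] ++ FreeGroup.invRev y from rfl,
      FreeGroup.invRev_append, FreeGroup.invRev_invRev]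
    simp [FreeGroup.invRev, linv]
  unfold oword
  rw [h, otgt_linv, olab_linv]
  rfl

/-- The homomorphism that sends the letters to the loops through the edges outside the tree. -/
def cotreeHom (τ : V → Word n) : FreeGroup (Fin r) →* FreeGroup (Fin n) :=
  FreeGroup.lift fun i => FreeGroup.mk (cotreeWord τ (E i))

theorem cotreeHom_letter (τ : V → Word n) :
    cotreeHom E τ (FreeGroup.mk [j]) = FreeGroup.mk (oword E j τ) := by
  obtain ⟨i, b⟩ := j
  cases b
  · have : oword E (i, false) τ = FreeGroup.invRev (oword E (i, true) τ) := oword_linv E (i, true) τ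
    rw [this, ← FreeGroup.inv_mk, oword_true]
    simp [cotreeHom, FreeGroup.lift_mk]
  · rw [oword_true]
    simp [cotreeHom, FreeGroup.lift_mk]

theorem cotreeHom_mk (τ : V → Word n) (W : Word r) :
    cotreeHom E τ (FreeGroup.mk W) = FreeGroup.mk (W.flatMap fun j => oword E j τ) := by
  induction W with
  | nil => simp [← FreeGroup.one_eq_mk]
  | cons j W ih =>
    rw [show j :: W = [j] ++ W from rfl, ← FreeGroup.mul_mk, map_mul, cotreeHom_letter, ih,
      FreeGroup.mul_mk]
    simp

/-- `WPath S E τ v w u W`: the word `w` can be read from `v` to `u`, and `W` is the sequence of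
the edges outside the tree on this path. -/
def WPath (S : V → Letter n → V → Prop) (τ : V → Word n) : V → Word n → V → Word r → Prop
  | v, [], u, W => v = u ∧ W = []
  | v, l :: w, u, W => ∃ x, S v l x ∧ ((IsTreeEdge τ v l x ∧ WPath S τ x w u W) ∨
      ∃ j W', osrc E j = v ∧ olab E j = l ∧ otgt E j = x ∧ W = j :: W' ∧ WPath S τ x w u W')

end Oriented

namespace IsCotree

variable {n r : ℕ} {J : List (Word n)} {Γ : LGraph n} {τ : Γ.V → Word n}
  {E : Fin r → Γ.V × Fin n × Γ.V}

theorem ostep (hE : IsCotree τ E) (j : Letter r) :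
    Γ.Step (osrc E j) (olab E j) (otgt E j) ∧ ¬ IsTreeEdge τ (osrc E j) (olab E j) (otgt E j) := by
  obtain ⟨i, b⟩ := j
  have h := (hE.mem (E i).1 (E i).2.1 (E i).2.2).1 ⟨i, rfl⟩
  cases b
  · exact ⟨h.1.symm, fun ht => h.2 ht.symm⟩
  · exact h

theorem exists_oriented (hE : IsCotree τ E) {v u : Γ.V} {l : Letter n} (hs : Γ.Step v l u)
    (ht : ¬ IsTreeEdge τ v l u) : ∃ j, osrc E j = v ∧ olab E j = l ∧ otgt E j = u := by
  obtain ⟨i, b⟩ := l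
  cases b
  · obtain ⟨j, hj⟩ := (hE.mem u i v).2 ⟨hs.symm, fun h => ht h.symm⟩
    exact ⟨(j, false), by simp [osrc, hj], by simp [olab, hj], by simp [otgt, osrc, linv, hj]⟩
  · obtain ⟨j, hj⟩ := (hE.mem v i u).2 ⟨hs, ht⟩
    exact ⟨(j, true), by simp [osrc, hj], by simp [olab, hj], by simp [otgt, osrc, linv, hj]⟩

/-- The sign of the label is the orientation, and in a folded graph the beginning and the label
determine the end. -/
theorem oriented_unique (hE : IsCotree τ E) (hf : Γ.IsFolded) {j j' : Letter r}
    (hs : osrc E j = osrc E j') (hl : olab E j = olab E j') : j = j' := by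
  have ht : otgt E j = otgt E j' := by
    have h₁ := (hE.ostep j).1
    have h₂ := (hE.ostep j').1
    rw [hs, hl] at h₁
    exact hf.isInverse.det h₁ h₂
  obtain ⟨i, b⟩ := j
  obtain ⟨i', b'⟩ := j'
  simp only [olab, Prod.mk.injEq] at hl
  obtain ⟨hl, rfl⟩ := hl
  congr 1
  refine hE.inj ?_
  cases b
  · simp only [osrc, otgt, linv, Bool.false_eq_true, if_false, Bool.not_false, if_true] at hs ht
    exact Prod.ext ht (Prod.ext hl hs)
  · simp only [osrc, otgt, linv, Bool.false_eq_true, if_false, Bool.not_true, if_true] at hs ht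
    exact Prod.ext hs (Prod.ext hl ht)

theorem exists_wPath (hE : IsCotree τ E) {w : Word n} {v u : Γ.V} (h : PathIn Γ.Step v w u) :
    ∃ W, WPath E Γ.Step τ v w u W := by
  induction w generalizing v with
  | nil => exact ⟨[], h, rfl⟩
  | cons l w ih =>
    obtain ⟨x, hx, h⟩ := h
    obtain ⟨W, hW⟩ := ih h
    by_cases ht : IsTreeEdge τ v l x
    · exact ⟨W, x, hx, Or.inl ⟨ht, hW⟩⟩
    · obtain ⟨j, h₁, h₂, h₃⟩ := hE.exists_oriented hx ht
      exact ⟨j :: W, x, hx, Or.inr ⟨j, W, h₁, h₂, h₃, rfl, hW⟩⟩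

theorem wPath_append {w w' : Word n} {v u : Γ.V} {W : Word r} :
    WPath E Γ.Step τ v (w ++ w') u W ↔
      ∃ x W₁ W₂, WPath E Γ.Step τ v w x W₁ ∧ WPath E Γ.Step τ x w' u W₂ ∧ W = W₁ ++ W₂ := by
  induction w generalizing v W with
  | nil =>
    constructor
    · intro h
      exact ⟨v, [], W, ⟨rfl, rfl⟩, h, rfl⟩
    · rintro ⟨x, W₁, W₂, ⟨rfl, rfl⟩, h, rfl⟩
      exact h
  | cons l w ih =>
    constructor
    · rintro ⟨y, hy, ⟨ht, h⟩ | ⟨j, W', h₁, h₂, h₃, rfl, h⟩⟩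
      · obtain ⟨x, W₁, W₂, hw, hw', rfl⟩ := ih.1 h
        exact ⟨x, W₁, W₂, ⟨y, hy, Or.inl ⟨ht, hw⟩⟩, hw', rfl⟩
      · obtain ⟨x, W₁, W₂, hw, hw', rfl⟩ := ih.1 h
        exact ⟨x, j :: W₁, W₂, ⟨y, hy, Or.inr ⟨j, W₁, h₁, h₂, h₃, rfl, hw⟩⟩, hw', rfl⟩
    · rintro ⟨x, W₁, W₂, ⟨y, hy, ⟨ht, h⟩ | ⟨j, W', h₁, h₂, h₃, rfl, h⟩⟩, hw', rfl⟩
      · exact ⟨y, hy, Or.inl ⟨ht, ih.2 ⟨x, W₁, W₂, h, hw', rfl⟩⟩⟩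
      · exact ⟨y, hy, Or.inr ⟨j, _, h₁, h₂, h₃, rfl, ih.2 ⟨x, W', W₂, h, hw', rfl⟩⟩⟩

theorem wPath_unique (hE : IsCotree τ E) (hf : Γ.IsFolded) {w : Word n} {v u u' : Γ.V}
    {W W' : Word r} (h : WPath E Γ.Step τ v w u W) (h' : WPath E Γ.Step τ v w u' W') : W = W' := by
  induction w generalizing v W W' with
  | nil => rw [h.2, h'.2]
  | cons l w ih =>
    obtain ⟨x, hx, h⟩ := h
    obtain ⟨x', hx', h'⟩ := h'
    obtain rfl := hf.isInverse.det hx hx'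
    have hno : ∀ j, osrc E j = v → olab E j = l → otgt E j = x → ¬ IsTreeEdge τ v l x := by
      rintro j rfl rfl rfl
      exact (hE.ostep j).2
    rcases h with ⟨ht, h⟩ | ⟨j, W₁, h₁, h₂, h₃, rfl, h⟩ <;>
      rcases h' with ⟨ht', h'⟩ | ⟨j', W₁', h₁', h₂', h₃', rfl, h'⟩
    · exact ih h h'
    · exact absurd ht (hno j' h₁' h₂' h₃')
    · exact absurd ht' (hno j h₁ h₂ h₃)
    · rw [hE.oriented_unique hf (h₁.trans h₁'.symm) (h₂.trans h₂'.symm), ih h h']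

/-- A cancelling pair of letters runs along one edge and back. A tree edge leaves no trace in the
sequence; any other edge leaves a letter followed by its inverse. So the sequence is well defined as
an element of the free group on the edges outside the tree. -/
theorem wPath_red (hE : IsCotree τ E) (hf : Γ.IsFolded) {w w' : Word n}
    (hr : FreeGroup.Red w w') {v u : Γ.V} {W : Word r} (h : WPath E Γ.Step τ v w u W) :
    ∃ W', WPath E Γ.Step τ v w' u W' ∧ FreeGroup.mk W = FreeGroup.mk W' := by
  induction hr with
  | refl => exact ⟨W, h, rfl⟩
  | tail _ hs ih =>
    obtain ⟨W', hW', he⟩ := ih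
    cases hs with
    | @not L₁ L₂ a b =>
      obtain ⟨y, W₁, W₂, hw, ⟨z, hz, h₂⟩, rfl⟩ := wPath_append.1 hW'
      have hno : ∀ j, osrc E j = y → olab E j = (a, b) → otgt E j = z →
          ¬ IsTreeEdge τ y (a, b) z := by
        rintro j rfl h rfl
        rw [← h]
        exact (hE.ostep j).2
      have hno' : ∀ j, osrc E j = z → olab E j = (a, !b) → otgt E j = y →
          ¬ IsTreeEdge τ y (a, b) z := by
        rintro j rfl h rfl ht
        refine (hE.ostep j).2 ?_
        rw [h]
        exact ht.symm
      have hback : ∀ {y'}, Γ.Step z (a, !b) y' → y' = y := fun h =>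
        hf.isInverse.det h hz.symm
      rcases h₂ with ⟨ht, y', hy', h₂⟩ | ⟨j, W₃, h₁, h₂, h₃, rfl, y', hy', h₄⟩
      · obtain rfl := hback hy'
        rcases h₂ with ⟨_, h₂⟩ | ⟨j, W₃, h₁, h₂, h₃, rfl, h₄⟩
        · exact ⟨W₁ ++ W₂, wPath_append.2 ⟨_, _, _, hw, h₂, rfl⟩, he⟩
        · exact absurd ht (hno' j h₁ h₂ h₃)
      · obtain rfl := hback hy'
        rcases h₄ with ⟨ht, _⟩ | ⟨j', W₄, h₁', h₂', h₃', rfl, h₄⟩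
        · exact absurd (by simpa [linv] using ht.symm) (hno j h₁ h₂ h₃)
        · refine ⟨W₁ ++ W₄, wPath_append.2 ⟨_, _, _, hw, h₄, rfl⟩, he.trans ?_⟩
          have hj : j' = linv j := by
            refine hE.oriented_unique hf ?_ ?_
            · rw [h₁', ← h₃]; rfl
            · rw [h₂', olab_linv, h₂]; rfl
          rw [hj]
          exact Quot.sound FreeGroup.Red.Step.not

theorem mk_wPath_unique (hE : IsCotree τ E) (hf : Γ.IsFolded) {w w' : Word n} {v u u' : Γ.V}
    {W W' : Word r} (h : WPath E Γ.Step τ v w u W) (h' : WPath E Γ.Step τ v w' u' W')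
    (he : FreeGroup.mk w = FreeGroup.mk w') : FreeGroup.mk W = FreeGroup.mk W' := by
  obtain ⟨W₁, h₁, e₁⟩ := hE.wPath_red hf FreeGroup.reduce.red h
  obtain ⟨W₂, h₂, e₂⟩ := hE.wPath_red hf FreeGroup.reduce.red h'
  rw [FreeGroup.reduce.sound he] at h₁
  rw [e₁, e₂, hE.wPath_unique hf h₁ h₂]

theorem wPath_tree (h : GeodesicTree Γ τ) (v : Γ.V) :
    WPath E Γ.Step τ Γ.base (τ v) v ([] : Word r) := by
  induction hk : (τ v).length generalizing v with
  | zero =>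
    by_cases hv : v = Γ.base
    · subst hv
      rw [h.base]
      exact ⟨rfl, rfl⟩
    · obtain ⟨p, l, _, he⟩ := h.step v hv
      rw [he] at hk
      simp at hk
  | succ k ih =>
    by_cases hv : v = Γ.base
    · rw [hv, h.base] at hk
      simp at hk
    · obtain ⟨p, l, hs, he⟩ := h.step v hv
      have hk' := hk
      rw [he] at hk' ⊢
      rw [List.length_append, List.length_singleton] at hk'
      exact wPath_append.2 ⟨p, [], [], ih p (by omega),
        ⟨v, hs, Or.inl ⟨Or.inl he, rfl, rfl⟩⟩, rfl⟩

theorem wPath_tree_inv (h : GeodesicTree Γ τ) (v : Γ.V) :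
    WPath E Γ.Step τ v (FreeGroup.invRev (τ v)) Γ.base ([] : Word r) := by
  induction hk : (τ v).length generalizing v with
  | zero =>
    by_cases hv : v = Γ.base
    · subst hv
      rw [h.base]
      exact ⟨rfl, rfl⟩
    · obtain ⟨p, l, _, he⟩ := h.step v hv
      rw [he] at hk
      simp at hk
  | succ k ih =>
    by_cases hv : v = Γ.base
    · rw [hv, h.base] at hk
      simp at hk
    · obtain ⟨p, l, hs, he⟩ := h.step v hv
      have hk' := hk
      have e : FreeGroup.invRev (τ v) = linv l :: FreeGroup.invRev (τ p) := by
        rw [he, FreeGroup.invRev_append]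
        rfl
      rw [he, List.length_append, List.length_singleton] at hk'
      rw [e]
      exact ⟨p, hs.symm, Or.inl ⟨IsTreeEdge.symm (Or.inl he), ih p (by omega)⟩⟩

theorem wPath_oword (hE : IsCotree τ E) (h : GeodesicTree Γ τ) (j : Letter r) :
    WPath E Γ.Step τ Γ.base (oword E j τ) Γ.base [j] :=
  wPath_append.2 ⟨_, [], [j], wPath_tree h _, ⟨_, (hE.ostep j).1,
    Or.inr ⟨j, [], rfl, rfl, rfl, rfl, wPath_tree_inv h _⟩⟩, rfl⟩

theorem wPath_flatMap (hE : IsCotree τ E) (h : GeodesicTree Γ τ) (W : Word r) :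
    WPath E Γ.Step τ Γ.base (W.flatMap fun j => oword E j τ) Γ.base W := by
  induction W with
  | nil => exact ⟨rfl, rfl⟩
  | cons j W ih =>
    rw [List.flatMap_cons]
    exact wPath_append.2 ⟨_, [j], W, hE.wPath_oword h j, ih, rfl⟩

/-- The sequence of outside edges passed by a path is a left inverse: the product of loops belonging
to `W` passes exactly `W`. If the product is trivial in the free group, its sequence represents the
same element as that of the empty path. -/
theorem cotreeHom_injective (hE : IsCotree τ E) (h : GeodesicTree Γ τ) :
    Function.Injective (cotreeHom E τ) := by
  rw [injective_iff_map_eq_one]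
  intro g hg
  obtain ⟨W, rfl⟩ : ∃ W, FreeGroup.mk W = g := ⟨g.toWord, FreeGroup.mk_toWord⟩
  rw [cotreeHom_mk] at hg
  have h₀ : WPath E Γ.Step τ Γ.base [] Γ.base ([] : Word r) := ⟨rfl, rfl⟩
  exact hE.mk_wPath_unique h.folded (hE.wPath_flatMap h W) h₀ hg

/-- A telescoping product: `τ v * l` equals `τ x` along a tree edge to `x`, and the loop through the
edge times `τ x` along any other edge. -/
theorem cotreeHom_wPath {w : Word n} {v u : Γ.V} {W : Word r}
    (hw : WPath E Γ.Step τ v w u W) :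
    FreeGroup.mk (τ v) * FreeGroup.mk w = cotreeHom E τ (FreeGroup.mk W) * FreeGroup.mk (τ u) := by
  have hcancel : ∀ l : Letter n, FreeGroup.mk [linv l] * FreeGroup.mk [l] = 1 := fun l => by
    have : FreeGroup.mk [linv l] = (FreeGroup.mk [l])⁻¹ := by
      rw [FreeGroup.inv_mk]
      rfl
    rw [this, inv_mul_cancel]
  induction w generalizing v W with
  | nil =>
    obtain ⟨rfl, rfl⟩ := hw
    rw [← FreeGroup.one_eq_mk, ← FreeGroup.one_eq_mk, map_one, one_mul, mul_one]
  | cons l w ih =>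
    rw [show l :: w = [l] ++ w from rfl, ← FreeGroup.mul_mk, ← mul_assoc]
    obtain ⟨x, hx, ⟨ht, hw⟩ | ⟨j, W', rfl, rfl, rfl, rfl, hw⟩⟩ := hw
    · have : FreeGroup.mk (τ v) * FreeGroup.mk [l] = FreeGroup.mk (τ x) := by
        rcases ht with ht | ht
        · rw [ht, FreeGroup.mul_mk]
        · rw [ht, ← FreeGroup.mul_mk, mul_assoc, hcancel, mul_one]
      rw [this, ih hw]
    · have : FreeGroup.mk (τ (osrc E j)) * FreeGroup.mk [olab E j] =
          cotreeHom E τ (FreeGroup.mk [j]) * FreeGroup.mk (τ (otgt E j)) := by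
        rw [cotreeHom_letter, oword, show olab E j :: FreeGroup.invRev (τ (otgt E j)) =
          [olab E j] ++ FreeGroup.invRev (τ (otgt E j)) from rfl, ← FreeGroup.mul_mk,
          ← FreeGroup.mul_mk, ← FreeGroup.inv_mk]
        group
      rw [this, mul_assoc, ih hw, ← mul_assoc, ← map_mul, FreeGroup.mul_mk]
      rfl

theorem cotreeHom_of_loop (h : GeodesicTree Γ τ) {w : Word n} {W : Word r}
    (hw : WPath E Γ.Step τ Γ.base w Γ.base W) :
    cotreeHom E τ (FreeGroup.mk W) = FreeGroup.mk w := by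
  have := cotreeHom_wPath hw
  rw [h.base, ← FreeGroup.one_eq_mk, one_mul, mul_one] at this
  exact this.symm

theorem path_of_wPath {w : Word n} {v u : Γ.V} {W : Word r} (hw : WPath E Γ.Step τ v w u W) :
    PathIn Γ.Step v w u := by
  induction w generalizing v W with
  | nil => exact hw.1
  | cons l w ih =>
    obtain ⟨x, hx, ⟨_, hw⟩ | ⟨j, W', _, _, _, _, hw⟩⟩ := hw
    · exact ⟨x, hx, ih hw⟩
    · exact ⟨x, hx, ih hw⟩

/-- The loops lie in the subgroup, and each generator, being a loop at the base, is the product of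
the loops through the outside edges it passes. -/
theorem range_cotreeHom (hE : IsCotree τ E) (h : GeodesicTree Γ τ) (hc : Carries J Γ) :
    (cotreeHom E τ).range = generated J := by
  apply le_antisymm
  · unfold cotreeHom
    rw [FreeGroup.range_lift_eq_closure, Subgroup.closure_le]
    rintro _ ⟨i, rfl⟩
    exact hc.mem_of_loop (path_of_wPath (hE.wPath_oword h (i, true)))
  · unfold generated
    rw [Subgroup.closure_le]
    rintro _ ⟨w, hw, rfl⟩
    obtain ⟨W, hW⟩ := hE.exists_wPath (hc.loop w hw)
    exact ⟨FreeGroup.mk W, cotreeHom_of_loop h hW⟩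

/-! ### Length estimates from depths in the tree. -/

/-- A lower bound for the length of a path from `v` to `u` through the given edges outside the
tree. -/
def lengthBound (E : Fin r → Γ.V × Fin n × Γ.V) (τ : Γ.V → Word n) : Γ.V → Word r → Γ.V → ℕ
  | v, [], u => ((τ v).length - (τ u).length) + ((τ u).length - (τ v).length)
  | v, j :: A, u => ((τ v).length - (τ (osrc E j)).length) +
      ((τ (osrc E j)).length - (τ v).length) + 1 + lengthBound E τ (otgt E j) A u

theorem lengthBound_le_succ {v x u : Γ.V} (h₁ : (τ v).length ≤ (τ x).length + 1)
    (h₂ : (τ x).length ≤ (τ v).length + 1) (A : Word r) :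
    lengthBound E τ v A u ≤ lengthBound E τ x A u + 1 := by
  cases A with
  | nil => simp only [lengthBound]; omega
  | cons j A => simp only [lengthBound]; omega

/-- Depth changes by at most one per letter, so between successive edges of `A` a path needs at
least as many letters as their depths differ. A sublist suffices: edges of the path that do not
belong to `A` are treated as ordinary steps. -/
theorem lengthBound_le (h : GeodesicTree Γ τ) {w : Word n} {v u : Γ.V}
    {W A : Word r} (hw : WPath E Γ.Step τ v w u W) (hA : A.Sublist W) :
    lengthBound E τ v A u ≤ w.length := by
  induction w generalizing v W A with
  | nil =>
    obtain ⟨rfl, rfl⟩ := hw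
    rw [List.sublist_nil.1 hA]
    simp [lengthBound]
  | cons l w ih =>
    obtain ⟨x, hx, hw⟩ := hw
    have h₁ := h.lip hx
    have h₂ := h.lip hx.symm
    rw [List.length_cons]
    rcases hw with ⟨_, hw⟩ | ⟨j, W', rfl, rfl, rfl, rfl, hw⟩
    · exact (lengthBound_le_succ h₂ h₁ A).trans (by have := ih hw hA; omega)
    · cases hA with
      | cons _ hA => exact (lengthBound_le_succ h₂ h₁ A).trans (by have := ih hw hA; omega)
      | cons_cons _ hA =>
        have := ih hw hA
        simp only [lengthBound]
        omega

/-- Reducing the label of the path may shorten the sequence of outside edges to some `W`, but `W`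
still represents the same element as `A`. Since `A` is reduced, it is the reduced form of `W` and
hence a sublist of it. -/
theorem lengthBound_le_norm (hE : IsCotree τ E) (h : GeodesicTree Γ τ) {A : Word r}
    (hA : FreeGroup.IsReduced A) :
    lengthBound E τ Γ.base A Γ.base ≤ (cotreeHom E τ (FreeGroup.mk A)).norm := by
  rw [cotreeHom_mk]
  obtain ⟨W, hW, he⟩ := hE.wPath_red h.folded FreeGroup.reduce.red (hE.wPath_flatMap h A)
  have hAW : A.Sublist W := by
    have := FreeGroup.reduce.sound he
    rw [hA.reduce_eq] at this
    rw [this]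
    exact FreeGroup.reduce.red.sublist
  exact lengthBound_le h hW hAW

theorem length_oword (j : Letter r) :
    (oword E j τ).length = (τ (osrc E j)).length + 1 + (τ (otgt E j)).length := by
  unfold oword
  rw [List.length_append, List.length_cons, FreeGroup.invRev_length]
  omega

theorem norm_oword (hE : IsCotree τ E) (h : GeodesicTree Γ τ) (j : Letter r) :
    (FreeGroup.mk (oword E j τ)).norm =
      (τ (osrc E j)).length + 1 + (τ (otgt E j)).length := by
  refine le_antisymm (FreeGroup.norm_mk_le.trans (length_oword j).le) ?_
  have := hE.lengthBound_le_norm h (A := [j]) .singleton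
  rw [cotreeHom_letter] at this
  simp only [lengthBound, h.base, List.length_nil] at this
  omega

theorem isReduced_oword (hE : IsCotree τ E) (h : GeodesicTree Γ τ) (j : Letter r) :
    FreeGroup.IsReduced (oword E j τ) := by
  refine isReduced_of_length_le ?_
  rw [length_oword, ← hE.norm_oword h]
  exact le_of_eq (by rw [FreeGroup.norm, FreeGroup.toWord_mk])

/-- A basis element has length equal to the two depths of its edge plus one. A reduced product of
two or three of them has length at least the number of edges, plus the first and last depths, plus
the differences of depths in between. For three factors this exceeds `|u| - |v| + |w|` outright; for
two, the inequalities need in addition that the depths of the ends of an edge differ by at most one.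
-/
theorem isNielsenReduced (hE : IsCotree τ E) (h : GeodesicTree Γ τ) :
    IsNielsenReduced (Set.range fun i => FreeGroup.mk (cotreeWord τ (E i))) := by
  have hP : ∀ g : FreeGroup (Fin n), (g ∈ Set.range fun i => FreeGroup.mk (cotreeWord τ (E i))) ∨
      (g⁻¹ ∈ Set.range fun i => FreeGroup.mk (cotreeWord τ (E i))) →
      ∃ j, g = cotreeHom E τ (FreeGroup.mk [j]) := by
    rintro g (⟨i, rfl⟩ | ⟨i, hi⟩)
    · exact ⟨(i, true), by rw [cotreeHom_letter, oword_true]⟩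
    · refine ⟨(i, false), ?_⟩
      rw [← inv_inv g, ← hi, cotreeHom_letter]
      change (FreeGroup.mk (oword E (i, true) τ))⁻¹ = _
      rw [FreeGroup.inv_mk, ← oword_linv]
      rfl
  have hlip : ∀ j : Letter r, (τ (osrc E j)).length ≤ (τ (otgt E j)).length + 1 ∧
      (τ (otgt E j)).length ≤ (τ (osrc E j)).length + 1 := fun j =>
    ⟨h.lip (hE.ostep j).1.symm, h.lip (hE.ostep j).1⟩
  have hcancel : ∀ a b : Letter r,
      cotreeHom E τ (FreeGroup.mk [a]) * cotreeHom E τ (FreeGroup.mk [b]) ≠ 1 →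
      (a.1 = b.1 → a.2 = b.2) := by
    intro a b hab he
    by_contra hne
    refine hab ?_
    have : b = linv a := by
      refine Prod.ext he.symm ?_
      revert hne
      simp only [linv]
      cases a.2 <;> cases b.2 <;> simp
    rw [this, ← map_mul, FreeGroup.mul_mk]
    have : FreeGroup.mk ([a] ++ [linv a]) = 1 := by
      rw [FreeGroup.one_eq_mk]
      exact Quot.sound (FreeGroup.Red.Step.not (L₁ := []) (L₂ := []))
    rw [this, map_one]
  have hnorm : ∀ j : Letter r, (cotreeHom E τ (FreeGroup.mk [j])).norm =
      (τ (osrc E j)).length + 1 + (τ (otgt E j)).length := fun j => by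
    rw [cotreeHom_letter, hE.norm_oword h]
  refine ⟨?_, ?_, ?_⟩
  · intro u hu
    obtain ⟨j, rfl⟩ := hP u hu
    intro h1
    have := hnorm j
    rw [h1, FreeGroup.norm_one] at this
    omega
  · intro u hu v hv huv
    obtain ⟨a, rfl⟩ := hP u hu
    obtain ⟨b, rfl⟩ := hP v hv
    have hred : FreeGroup.IsReduced [a, b] := by simpa using hcancel a b huv
    have hb := hE.lengthBound_le_norm h hred
    rw [show [a, b] = [a] ++ [b] from rfl, ← FreeGroup.mul_mk, map_mul] at hb
    have ha' := hlip a
    have hb' := hlip b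
    simp only [lengthBound, List.cons_append, List.nil_append, h.base, List.length_nil] at hb
    rw [hnorm, hnorm]
    omega
  · intro u hu v hv w hw huv hvw
    obtain ⟨a, rfl⟩ := hP u hu
    obtain ⟨b, rfl⟩ := hP v hv
    obtain ⟨c, rfl⟩ := hP w hw
    have hred : FreeGroup.IsReduced [a, b, c] := by
      simpa using ⟨hcancel a b huv, hcancel b c hvw⟩
    have hb := hE.lengthBound_le_norm h hred
    rw [show [a, b, c] = [a] ++ [b] ++ [c] from rfl, ← FreeGroup.mul_mk, ← FreeGroup.mul_mk,
      map_mul, map_mul] at hb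
    simp only [lengthBound, List.cons_append, List.nil_append, h.base, List.length_nil] at hb
    rw [hnorm, hnorm, hnorm]
    omega

end IsCotree

/-! ### The total length of the basis -/

/-- A sum of natural numbers is the sum over `m ≥ 1` of the number of terms that are at least `m`.
-/
theorem sum_le_sum_of_card_le {ι κ : Type} [Fintype ι] [Fintype κ] (a : ι → ℕ) (b : κ → ℕ)
    (h : ∀ m, Fintype.card {i // m ≤ a i} ≤ Fintype.card {k // m ≤ b k}) :
    ∑ i, a i ≤ ∑ k, b k := by
  set M := ∑ i, a i + ∑ k, b k with hM
  have key : ∀ {ι : Type} [Fintype ι] (a : ι → ℕ), (∀ i, a i ≤ M) →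
      ∑ i, a i = ∑ m ∈ Finset.Icc 1 M, Fintype.card {i // m ≤ a i} := by
    intro ι _ a ha
    simp_rw [Fintype.card_subtype, Finset.card_filter]
    rw [Finset.sum_comm]
    refine Finset.sum_congr rfl fun i _ => ?_
    rw [← Finset.card_filter]
    have : (Finset.Icc 1 M).filter (· ≤ a i) = Finset.Icc 1 (a i) := by
      ext m
      simp only [Finset.mem_filter, Finset.mem_Icc]
      have := ha i
      omega
    rw [this, Nat.card_Icc]
    omega
  rw [key a fun i => ?_, key b fun k => ?_]
  · exact Finset.sum_le_sum fun m _ => h m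
  · exact (Finset.single_le_sum (fun _ _ => Nat.zero_le _) (Finset.mem_univ k)).trans (by omega)
  · exact (Finset.single_le_sum (fun _ _ => Nat.zero_le _) (Finset.mem_univ i)).trans (by omega)

/-- The images of generators of a free group span the quotients of its abelianization modulo 2. -/
theorem card_le_of_closure_eq_top {r : ℕ} {κ : Type*} [Fintype κ] (W : κ → Word r)
    (htop : Subgroup.closure (Set.range fun k => FreeGroup.mk (W k)) = ⊤)
    (p : Fin r → Prop) [DecidablePred p] (q : κ → Prop) [DecidablePred q]
    (h : ∀ k, ¬ q k → ∀ j ∈ W k, ¬ p j.1) :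
    Fintype.card {i // p i} ≤ Fintype.card {k // q k} := by
  -- Abelianise modulo `2` and keep only the coordinates satisfying `p`. The words not satisfying
  -- `q` vanish there, so the images of the others must span, and the claim is a comparison with the
  -- dimension.
  let θ : FreeGroup (Fin r) →* Multiplicative ({i // p i} → ZMod 2) :=
    FreeGroup.lift fun i => Multiplicative.ofAdd fun b => if b.1 = i then 1 else 0
  have hzero : ∀ W : Word r, (∀ j ∈ W, ¬ p j.1) → θ (FreeGroup.mk W) = 1 := by
    intro W
    induction W with
    | nil => intro _; rw [← FreeGroup.one_eq_mk, map_one]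
    | cons j W ih =>
      intro hW
      have hj : (Multiplicative.ofAdd fun b : {i // p i} => if b.1 = j.1 then (1 : ZMod 2) else 0) =
          1 := by
        rw [← ofAdd_zero]
        congr 1
        funext b
        have : b.1 ≠ j.1 := fun e => hW j (by simp) (e ▸ b.2)
        simp [this]
      rw [show j :: W = [j] ++ W from rfl, ← FreeGroup.mul_mk, map_mul,
        ih fun j' hj' => hW j' (by simp [hj']), mul_one]
      simp only [θ, FreeGroup.lift_mk, List.map_cons, List.map_nil, List.prod_cons, List.prod_nil,
        mul_one, hj]
      cases j.2 <;> simp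
  let vec : {k // q k} → ({i // p i} → ZMod 2) := fun k => (θ (FreeGroup.mk (W k.1))).toAdd
  have hspan : ∀ g, (θ g).toAdd ∈ Submodule.span (ZMod 2) (Set.range vec) := by
    intro g
    have hg : g ∈ Subgroup.closure (Set.range fun k => FreeGroup.mk (W k)) := by
      rw [htop]
      exact Subgroup.mem_top g
    induction hg using Subgroup.closure_induction with
    | mem g hg =>
      obtain ⟨k, rfl⟩ := hg
      by_cases hk : q k
      · exact Submodule.subset_span ⟨⟨k, hk⟩, rfl⟩
      · simp only [hzero (W k) (h k hk), toAdd_one, Submodule.zero_mem]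
    | one => simp only [map_one, toAdd_one, Submodule.zero_mem]
    | mul g g' _ _ hg hg' =>
      rw [map_mul, toAdd_mul]
      exact Submodule.add_mem _ hg hg'
    | inv g _ hg =>
      rw [map_inv, toAdd_inv]
      exact Submodule.neg_mem _ hg
  have htop' : Submodule.span (ZMod 2) (Set.range vec) = ⊤ := by
    rw [eq_top_iff, ← (Pi.basisFun (ZMod 2) {i // p i}).span_eq, Submodule.span_le]
    rintro _ ⟨b, rfl⟩
    have := hspan (FreeGroup.of b.1)
    simp only [θ, FreeGroup.lift_apply_of, toAdd_ofAdd] at this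
    have hb : Pi.basisFun (ZMod 2) {i // p i} b = fun b' => if b'.1 = b.1 then 1 else 0 := by
      funext b'
      simp [Pi.single_apply, Subtype.ext_iff]
    rw [hb]
    exact this
  have h₁ := finrank_range_le_card (R := ZMod 2) vec
  rwa [Set.finrank, htop', finrank_top, Module.finrank_fintype_fun_eq_card] at h₁

namespace IsCotree

variable {n r : ℕ} {J : List (Word n)} {Γ : LGraph n} {τ : Γ.V → Word n}
  {E : Fin r → Γ.V × Fin n × Γ.V}

/-- In terms of the new basis the given words become words `W k` that generate the whole free group.
A basis element can occur in `W k` only if it is no longer than the `k`-th given word. So for every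
`m` the basis elements of length at least `m` are at most as many as the given words of length at
least `m`, and summation over `m` gives the claim. -/
theorem sum_length_le (hE : IsCotree τ E) (h : GeodesicTree Γ τ) (hc : Carries J Γ) :
    ∑ i, (cotreeWord τ (E i)).length ≤ totalLength J := by
  have hW : ∀ k : Fin J.length, ∃ W : Word r, WPath E Γ.Step τ Γ.base (J.get k) Γ.base W :=
    fun k => hE.exists_wPath (hc.loop _ (List.get_mem J k))
  choose W hW using hW
  have htop : Subgroup.closure (Set.range fun k => FreeGroup.mk (W k)) = ⊤ := by
    refine Subgroup.map_injective (hE.cotreeHom_injective h) ?_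
    rw [← MonoidHom.range_eq_map, hE.range_cotreeHom h hc, MonoidHom.map_closure, generated]
    congr 1
    ext g
    constructor
    · rintro ⟨_, ⟨k, rfl⟩, rfl⟩
      exact ⟨_, List.get_mem J k, cotreeHom_of_loop h (hW k)⟩
    · rintro ⟨w, hw, rfl⟩
      obtain ⟨k, rfl⟩ := List.get_of_mem hw
      exact ⟨_, ⟨k, rfl⟩, cotreeHom_of_loop h (hW k)⟩
  have hJ : totalLength J = ∑ k : Fin J.length, (J.get k).length := by
    unfold totalLength
    conv_lhs => rw [← List.ofFn_get J, List.map_ofFn, List.sum_ofFn]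
    rfl
  rw [hJ]
  refine sum_le_sum_of_card_le _ _ fun m => card_le_of_closure_eq_top W htop _ _ ?_
  intro k hk j hj hm
  refine hk (hm.trans ?_)
  -- A loop at the base through one outside edge must climb to one end of it and return from the
  -- other, which takes at least the length of the basis element.
  have hb := lengthBound_le h (hW k) (List.singleton_sublist.2 hj)
  simp only [lengthBound, h.base, List.length_nil] at hb
  have hl : (cotreeWord τ (E j.1)).length =
      (τ (osrc E j)).length + 1 + (τ (otgt E j)).length := by
    rw [← oword_true, length_oword]
    obtain ⟨i, b⟩ := j
    cases b
    · simp only [osrc, otgt, linv, Bool.false_eq_true, if_false, Bool.not_false, Bool.not_true,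
        if_true]
      omega
    · rfl
  omega

/-- The loops through the edges outside a geodesic tree form a Nielsen basis. -/
theorem isNielsenBasis (hE : IsCotree τ E) (h : GeodesicTree Γ τ) (hc : Carries J Γ) :
    IsNielsenBasis (generated J) (List.ofFn fun i => cotreeWord τ (E i)) := by
  obtain ⟨s, hs⟩ : ∃ s, s = (List.ofFn fun i => cotreeWord τ (E i)).length := ⟨_, rfl⟩
  have hsr : s = r := by rw [hs, List.length_ofFn]
  subst hsr
  have hfun : FreeGroup.lift (fun i : Fin (List.ofFn fun i => cotreeWord τ (E i)).length =>
      (FreeGroup.mk ((List.ofFn fun i => cotreeWord τ (E i)).get i) : FreeGroup (Fin n))) =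
      (cotreeHom E τ).comp (FreeGroup.freeGroupCongr (finCongr hs.symm)).toMonoidHom := by
    ext i
    simp [cotreeHom]
    rfl
  refine ⟨?_, ?_, ?_, ?_⟩
  · intro u hu
    rw [List.mem_ofFn] at hu
    obtain ⟨i, rfl⟩ := hu
    rw [← oword_true]
    exact hE.isReduced_oword h _
  · rw [hfun]
    exact (hE.cotreeHom_injective h).comp (MulEquiv.injective _)
  · rw [hfun, MonoidHom.range_comp, MonoidHom.range_eq_top.2 (MulEquiv.surjective _),
      ← MonoidHom.range_eq_map, hE.range_cotreeHom h hc]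
  · have : {g : FreeGroup (Fin n) | ∃ u ∈ List.ofFn fun i => cotreeWord τ (E i),
        g = FreeGroup.mk u} = Set.range fun i => FreeGroup.mk (cotreeWord τ (E i)) := by
      ext g
      simp [List.mem_ofFn, eq_comm]
    rw [this]
    exact hE.isNielsenReduced h

end IsCotree

/-- The Nielsen basis given by a list of the edges outside a geodesic tree. -/
theorem isNielsenBasis_of_list {n : ℕ} {J : List (Word n)} {Γ : LGraph n} {τ : Γ.V → Word n}
    (h : GeodesicTree Γ τ) (hc : Carries J Γ) {L : List (Γ.V × Fin n × Γ.V)} (hL : L.Nodup)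
    (hm : ∀ v i u, (v, i, u) ∈ L ↔ Γ.Step v (i, true) u ∧ ¬ IsTreeEdge τ v (i, true) u) :
    IsNielsenBasis (generated J) (L.map (cotreeWord τ)) ∧
      ((L.map (cotreeWord τ)).map List.length).sum ≤ totalLength J := by
  have hE : IsCotree τ L.get := by
    refine ⟨List.nodup_iff_injective_get.1 hL, fun v i u => ?_⟩
    rw [← hm, List.mem_iff_get]
  have he : L.map (cotreeWord τ) = List.ofFn fun i => cotreeWord τ (L.get i) := by
    conv_lhs => rw [← List.ofFn_get L, List.map_ofFn]
    rfl
  rw [he]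
  refine ⟨hE.isNielsenBasis h hc, ?_⟩
  rw [List.map_ofFn, List.sum_ofFn]
  exact hE.sum_length_le h hc

/-! ### Reading the generators -/

/-- The edges of the graph with transitions `T` on the nodes `1, …, V`, up to the relation `R`. -/
def relStep {n : ℕ} (R : Setoid ℕ) (V : ℕ) (T : Letter n → ℕ → ℕ) (x : ℕ) (l : Letter n) (y : ℕ) :
    Prop :=
  ∃ u ∈ Finset.Icc 1 V, R x u ∧ T l u ≠ 0 ∧ R (T l u) y

/-- The relation contains the first `m` pairs of the queue. -/
def Joins (R : Setoid ℕ) (m : ℕ) (qa qb : ℕ → ℕ) : Prop := ∀ i < m, R (qa i) (qb i)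

/-- The last edge absorbs the change of the end within its class. The empty path cannot do this, as
it requires equality on the nose. -/
theorem PathIn.relStep_trans {n : ℕ} {R : Setoid ℕ} {V : ℕ} {T : Letter n → ℕ → ℕ} {w : Word n}
    (hw : w ≠ []) {x y y' : ℕ} (h : PathIn (relStep R V T) x w y) (hy : R y y') :
    PathIn (relStep R V T) x w y' := by
  obtain ⟨p, l, rfl⟩ : ∃ p l, w = p ++ [l] :=
    ⟨w.dropLast, w.getLast hw, (List.dropLast_append_getLast hw).symm⟩
  rw [pathIn_append] at h ⊢
  obtain ⟨z, hz, h⟩ := h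
  obtain ⟨u, hu, h₁, h₂, h₃⟩ := pathIn_singleton.1 h
  exact ⟨z, hz, pathIn_singleton.2 ⟨u, hu, h₁, h₂, R.trans' h₃ hy⟩⟩

/-- The properties of the disjoint edges and the queue that are produced from the generators; `φ`
is a morphism to a graph with base point `d₀`. -/
structure ParseInv {n : ℕ} {D : Type} (S : D → Letter n → D → Prop) (d₀ : D) (φ : ℕ → D)
    (V m : ℕ) (T : Letter n → ℕ → ℕ) (qa qb : ℕ → ℕ) : Prop where
  pos : 1 ≤ V
  base : φ 1 = d₀
  data : FoldData S φ V m T qa qb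
  symm : ∀ l, ∀ x ∈ Finset.Icc 1 V, T l x ≠ 0 → T (linv l) (T l x) = x
  fresh : ∀ l x, V < x → T l x = 0
  conn : ∀ R : Setoid ℕ, Joins R m qa qb → ∀ x ∈ Finset.Icc 1 V, ∃ w, PathIn (relStep R V T) 1 w x

/-- The tables after a new edge has been added. -/
def addEdge {n : ℕ} (T : Letter n → ℕ → ℕ) (a : ℕ) (l : Letter n) (b : ℕ) : Letter n → ℕ → ℕ :=
  fun l' => if l' = linv l then Function.update (T l') b a else
    if l' = l then Function.update (T l') a b else T l'

theorem linv_ne {n : ℕ} (l : Letter n) : linv l ≠ l := by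
  intro h
  have := congrArg Prod.snd h
  simp [linv] at this

section AddEdge

variable {n : ℕ} {T : Letter n → ℕ → ℕ} {V : ℕ} {l : Letter n}

theorem addEdge_old (l' : Letter n) {x : ℕ} (h : x ≤ V) :
    addEdge T (V + 1) l (V + 2) l' x = T l' x := by
  unfold addEdge
  split_ifs
  · rw [Function.update_of_ne (by omega)]
  · rw [Function.update_of_ne (by omega)]
  · rfl

theorem addEdge_left (hT : ∀ l x, V < x → T l x = 0) (l' : Letter n) :
    addEdge T (V + 1) l (V + 2) l' (V + 1) = if l' = l then V + 2 else 0 := by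
  unfold addEdge
  split_ifs with h₁ h₂ h₃
  · exact absurd (h₁.symm.trans h₂) (linv_ne l)
  · rw [Function.update_of_ne (by omega), hT _ _ (by omega)]
  · rw [Function.update_self]
  · exact hT _ _ (by omega)

theorem addEdge_right (hT : ∀ l x, V < x → T l x = 0) (l' : Letter n) :
    addEdge T (V + 1) l (V + 2) l' (V + 2) = if l' = linv l then V + 1 else 0 := by
  unfold addEdge
  split_ifs with h₁ h₂
  · rw [Function.update_self]
  · rw [Function.update_of_ne (by omega), hT _ _ (by omega)]
  · exact hT _ _ (by omega)

theorem relStep_addEdge {R : Setoid ℕ} {x y : ℕ} {l' : Letter n} (h : relStep R V T x l' y) :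
    relStep R (V + 2) (addEdge T (V + 1) l (V + 2)) x l' y := by
  obtain ⟨u, hu, h₁, h₂, h₃⟩ := h
  rw [Finset.mem_Icc] at hu
  refine ⟨u, Finset.mem_Icc.2 (by omega), h₁, ?_⟩
  rw [addEdge_old _ hu.2]
  exact ⟨h₂, h₃⟩

end AddEdge

/-- A separate edge is added and its beginning queued for joining with `cur`, instead of attaching
it at `cur`. A table has room for only one transition per node and letter, so direct attachment
could overwrite an earlier edge. The morphism sends the new beginning to the image of `cur` and the
new end to the vertex reached there by the letter. -/
theorem ParseInv.addEdge {n : ℕ} {D : Type} {S : D → Letter n → D → Prop} {d₀ : D} {φ : ℕ → D}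
    {V m : ℕ} {T : Letter n → ℕ → ℕ} {qa qb : ℕ → ℕ} (h : ParseInv S d₀ φ V m T qa qb)
    (hS : IsInverse S) {cur : ℕ} (hcur : cur ∈ Finset.Icc 1 V) {l : Letter n} {d : D}
    (hs : S (φ cur) l d) :
    ParseInv S d₀ (Function.update (Function.update φ (V + 1) (φ cur)) (V + 2) d) (V + 2) (m + 1)
      (addEdge T (V + 1) l (V + 2)) (Function.update qa m cur) (Function.update qb m (V + 1)) ∧
    ∀ R : Setoid ℕ, Joins R (m + 1) (Function.update qa m cur) (Function.update qb m (V + 1)) →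
      Joins R m qa qb ∧ relStep R (V + 2) (Folding.addEdge T (V + 1) l (V + 2)) cur l (V + 2) := by
  have hpos := h.pos
  have hcur' := Finset.mem_Icc.1 hcur
  set φ' := Function.update (Function.update φ (V + 1) (φ cur)) (V + 2) d with hφ'
  have hφ : ∀ x ≤ V, φ' x = φ x := by
    intro x hx
    rw [hφ', Function.update_of_ne (by omega), Function.update_of_ne (by omega)]
  have hφa : φ' (V + 1) = φ cur := by
    rw [hφ', Function.update_of_ne (by omega), Function.update_self]
  have hφb : φ' (V + 2) = d := by rw [hφ', Function.update_self]
  have hcases : ∀ x ∈ Finset.Icc 1 (V + 2), x ∈ Finset.Icc 1 V ∨ x = V + 1 ∨ x = V + 2 := by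
    intro x hx
    rw [Finset.mem_Icc] at hx ⊢
    omega
  have hup : ∀ x ∈ Finset.Icc 1 V, x ∈ Finset.Icc 1 (V + 2) := by
    intro x hx
    rw [Finset.mem_Icc] at hx ⊢
    omega
  have ham : V + 1 ∈ Finset.Icc 1 (V + 2) := Finset.mem_Icc.2 (by omega)
  have hbm : V + 2 ∈ Finset.Icc 1 (V + 2) := Finset.mem_Icc.2 (by omega)
  have hlef := addEdge_left (l := l) h.fresh
  have hrig := addEdge_right (l := l) h.fresh
  have hjoin : ∀ R : Setoid ℕ, Joins R (m + 1) (Function.update qa m cur)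
      (Function.update qb m (V + 1)) → Joins R m qa qb ∧ R cur (V + 1) := by
    intro R hR
    constructor
    · intro i hi
      have := hR i (by omega)
      rwa [Function.update_of_ne (by omega), Function.update_of_ne (by omega)] at this
    · have := hR m (by omega)
      rwa [Function.update_self, Function.update_self] at this
  have hstep : ∀ R : Setoid ℕ, R cur (V + 1) →
      relStep R (V + 2) (Folding.addEdge T (V + 1) l (V + 2)) cur l (V + 2) := by
    intro R hR
    refine ⟨V + 1, ham, hR, ?_⟩
    rw [hlef, if_pos rfl]
    exact ⟨by omega, R.refl' _⟩
  refine ⟨⟨by omega, by rw [hφ 1 hpos, h.base], ⟨h.data.det, ?_, ?_, ?_, ?_⟩, ?_, ?_, ?_⟩, ?_⟩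
  · intro l' x hx
    rcases hcases x hx with hx | rfl | rfl
    · rw [addEdge_old _ (Finset.mem_Icc.1 hx).2]
      exact fun h0 => hup _ (h.data.mem l' x hx h0)
    · rw [hlef]
      split_ifs
      · exact fun _ => hbm
      · exact fun h0 => absurd rfl h0
    · rw [hrig]
      split_ifs
      · exact fun _ => ham
      · exact fun h0 => absurd rfl h0
  · intro l' x hx
    rcases hcases x hx with hx | rfl | rfl
    · rw [addEdge_old _ (Finset.mem_Icc.1 hx).2]
      intro h0
      rw [hφ x (Finset.mem_Icc.1 hx).2, hφ _ (Finset.mem_Icc.1 (h.data.mem l' x hx h0)).2]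
      exact h.data.step l' x hx h0
    · rw [hlef]
      split_ifs with hl
      · rw [hl, hφa, hφb]
        exact fun _ => hs
      · exact fun h0 => absurd rfl h0
    · rw [hrig]
      split_ifs with hl
      · rw [hl, hφa, hφb]
        exact fun _ => hS.symm hs
      · exact fun h0 => absurd rfl h0
  · intro i hi
    rcases Nat.lt_succ_iff_lt_or_eq.1 hi with hi | rfl
    · rw [Function.update_of_ne (by omega), Function.update_of_ne (by omega)]
      exact ⟨hup _ (h.data.pair_mem i hi).1, hup _ (h.data.pair_mem i hi).2⟩
    · rw [Function.update_self, Function.update_self]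
      exact ⟨hup _ hcur, ham⟩
  · intro i hi
    rcases Nat.lt_succ_iff_lt_or_eq.1 hi with hi | rfl
    · rw [Function.update_of_ne (by omega), Function.update_of_ne (by omega),
        hφ _ (Finset.mem_Icc.1 (h.data.pair_mem i hi).1).2,
        hφ _ (Finset.mem_Icc.1 (h.data.pair_mem i hi).2).2]
      exact h.data.pair_eq i hi
    · rw [Function.update_self, Function.update_self, hφa, hφ _ hcur'.2]
  · intro l' x hx
    rcases hcases x hx with hx | rfl | rfl
    · rw [addEdge_old _ (Finset.mem_Icc.1 hx).2]
      intro h0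
      rw [addEdge_old _ (Finset.mem_Icc.1 (h.data.mem l' x hx h0)).2]
      exact h.symm l' x hx h0
    · rw [hlef]
      split_ifs with hl
      · intro _
        rw [hrig, hl, if_pos rfl]
      · exact fun h0 => absurd rfl h0
    · rw [hrig]
      split_ifs with hl
      · intro _
        rw [hlef, hl, linv_linv, if_pos rfl]
      · exact fun h0 => absurd rfl h0
  · intro l' x hx
    unfold Folding.addEdge
    split_ifs
    · rw [Function.update_of_ne (by omega), h.fresh _ _ (by omega)]
    · rw [Function.update_of_ne (by omega), h.fresh _ _ (by omega)]
    · exact h.fresh _ _ (by omega)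
  · intro R hR x hx
    obtain ⟨hR₁, hR₂⟩ := hjoin R hR
    have hold : ∀ x ∈ Finset.Icc 1 V, ∃ w,
        PathIn (relStep R (V + 2) (Folding.addEdge T (V + 1) l (V + 2))) 1 w x := by
      intro x hx
      obtain ⟨w, hw⟩ := h.conn R hR₁ x hx
      exact ⟨w, hw.map id relStep_addEdge⟩
    obtain ⟨w, hw⟩ := hold cur hcur
    have hb : PathIn (relStep R (V + 2) (Folding.addEdge T (V + 1) l (V + 2))) 1 (w ++ [l])
        (V + 2) := pathIn_append.2 ⟨_, hw, pathIn_singleton.2 (hstep R hR₂)⟩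
    rcases hcases x hx with hx | rfl | rfl
    · exact hold x hx
    · refine ⟨w ++ [l] ++ [linv l], pathIn_append.2 ⟨_, hb, pathIn_singleton.2 ⟨V + 2, hbm,
        R.refl' _, ?_⟩⟩⟩
      rw [hrig, if_pos rfl]
      exact ⟨by omega, R.refl' _⟩
    · exact ⟨_, hb⟩
  · exact fun R hR => ⟨(hjoin R hR).1, hstep R (hjoin R hR).2⟩

theorem ParseInv.addPair {n : ℕ} {D : Type} {S : D → Letter n → D → Prop} {d₀ : D} {φ : ℕ → D}
    {V m : ℕ} {T : Letter n → ℕ → ℕ} {qa qb : ℕ → ℕ} (h : ParseInv S d₀ φ V m T qa qb)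
    {x y : ℕ} (hx : x ∈ Finset.Icc 1 V) (hy : y ∈ Finset.Icc 1 V) (he : φ x = φ y) :
    ParseInv S d₀ φ V (m + 1) T (Function.update qa m x) (Function.update qb m y) ∧
    ∀ R : Setoid ℕ, Joins R (m + 1) (Function.update qa m x) (Function.update qb m y) →
      Joins R m qa qb ∧ R x y := by
  have hjoin : ∀ R : Setoid ℕ, Joins R (m + 1) (Function.update qa m x)
      (Function.update qb m y) → Joins R m qa qb ∧ R x y := by
    intro R hR
    constructor
    · intro i hi
      have := hR i (by omega)
      rwa [Function.update_of_ne (by omega), Function.update_of_ne (by omega)] at this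
    · have := hR m (by omega)
      rwa [Function.update_self, Function.update_self] at this
  refine ⟨⟨h.pos, h.base, ⟨h.data.det, h.data.mem, h.data.step, ?_, ?_⟩, h.symm, h.fresh,
    fun R hR => h.conn R (hjoin R hR).1⟩, hjoin⟩
  · intro i hi
    rcases Nat.lt_succ_iff_lt_or_eq.1 hi with hi | rfl
    · rw [Function.update_of_ne (by omega), Function.update_of_ne (by omega)]
      exact h.data.pair_mem i hi
    · rw [Function.update_self, Function.update_self]
      exact ⟨hx, hy⟩
  · intro i hi
    rcases Nat.lt_succ_iff_lt_or_eq.1 hi with hi | rfl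
    · rw [Function.update_of_ne (by omega), Function.update_of_ne (by omega)]
      exact h.data.pair_eq i hi
    · rwa [Function.update_self, Function.update_self]

theorem parseInv_init {n : ℕ} {D : Type} {S : D → Letter n → D → Prop} (hS : IsInverse S) (d₀ : D)
    (qa qb : ℕ → ℕ) : ParseInv S d₀ (fun _ => d₀) 1 0 (fun _ _ => 0) qa qb where
  pos := le_rfl
  base := rfl
  data := ⟨hS.det, fun _ _ _ h => absurd rfl h, fun _ _ _ h => absurd rfl h,
    fun _ h => absurd h (by omega), fun _ h => absurd h (by omega)⟩
  symm _ _ _ h := absurd rfl h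
  fresh _ _ _ := rfl
  conn R _ x hx := by
    obtain rfl : x = 1 := by simpa using hx
    exact ⟨[], rfl⟩

/-! ### The program that reads the input. -/

/-- Read one word, letter by letter. -/
noncomputable def parseWord (n : ℕ) : Cmd := .loop (.lt Reg.zero Reg.c) (block [
  .succ Reg.a Reg.nv, .succ Reg.b Reg.a, .copy Reg.nv Reg.b,
  dispatch fun l : Letter n => block [.store (Arr.tr l) Reg.a Reg.b,
    .store (Arr.tr (linv l)) Reg.b Reg.a],
  enqueue n .cur .a, .copy Reg.cur Reg.b, .succ Reg.pos Reg.pos,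
  .load Reg.c (Arr.input (n := n)) Reg.pos])

/-- Read all words. -/
noncomputable def parse (n : ℕ) : Cmd := block [
  .const Reg.zero 0, .const Reg.one 1, .const Reg.pos 0, .const Reg.w 0, .const Reg.nv 1,
  .const Reg.tl 0,
  .loop (.lt Reg.w Reg.words) (block [
    .const Reg.cur 1, .load Reg.c (Arr.input (n := n)) Reg.pos,
    parseWord n,
    .ite (.lt Reg.one Reg.cur) (enqueue n .cur .one) .skip,
    .succ Reg.pos Reg.pos, .succ Reg.w Reg.w])]

/-- The state of the memory after reading the words `D`, and the part `p` of the next one. -/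
structure ParseState {n : ℕ} {A : Type} (S : A → Letter n → A → Prop) (d₀ : A) (φ : ℕ → A)
    (J D : List (Word n)) (p : Word n) (σ : State) : Prop where
  zero : σ.reg Reg.zero = 0
  one : σ.reg Reg.one = 1
  words : σ.reg Reg.words = J.length
  input : σ.arr (Arr.input (n := n)) = fun i => (encodeWords J).getD i 0
  w : σ.reg Reg.w = D.length
  pos : σ.reg Reg.pos = (encodeWords D).length + p.length
  inv : ParseInv S d₀ φ (σ.reg Reg.nv) (σ.reg Reg.tl) (trTable n σ) (σ.arr (Arr.qa (n := n)))
    (σ.arr (Arr.qb (n := n)))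
  nv : σ.reg Reg.nv = 2 * (totalLength D + p.length) + 1
  tl : σ.reg Reg.tl ≤ 2 * totalLength D + p.length
  loops : ∀ R : Setoid ℕ, Joins R (σ.reg Reg.tl) (σ.arr (Arr.qa (n := n)))
    (σ.arr (Arr.qb (n := n))) → ∀ w ∈ D, PathIn (relStep R (σ.reg Reg.nv) (trTable n σ)) 1 w 1

/-- The state of the memory inside a word. -/
structure WordState {n : ℕ} {A : Type} (S : A → Letter n → A → Prop) (d₀ : A) (φ : ℕ → A)
    (J D : List (Word n)) (p s : Word n) (σ : State) : Prop extends
    ParseState S d₀ φ J D p σ where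
  cur_mem : σ.reg Reg.cur ∈ Finset.Icc 1 (σ.reg Reg.nv)
  c : σ.reg Reg.c = (encodeWord s).getD 0 0
  left : PathIn S d₀ p (φ (σ.reg Reg.cur))
  right : PathIn S (φ (σ.reg Reg.cur)) s d₀
  cur_one : σ.reg Reg.cur = 1 ↔ p = []
  read : ∀ R : Setoid ℕ, Joins R (σ.reg Reg.tl) (σ.arr (Arr.qa (n := n)))
    (σ.arr (Arr.qb (n := n))) →
    PathIn (relStep R (σ.reg Reg.nv) (trTable n σ)) 1 p (σ.reg Reg.cur)

theorem getD_append_length {α : Type*} (A B : List α) (k : ℕ) (d : α) :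
    (A ++ B).getD (A.length + k) d = B.getD k d := by
  rw [List.getD_eq_getElem?_getD, List.getD_eq_getElem?_getD,
    List.getElem?_append_right (by omega), Nat.add_sub_cancel_left]

theorem encodeWords_append {n : ℕ} (D R : List (Word n)) :
    encodeWords (D ++ R) = encodeWords D ++ encodeWords R := by
  simp [encodeWords]

theorem encodeWords_getD {n : ℕ} (D R : List (Word n)) (p s : Word n) :
    (encodeWords (D ++ (p ++ s) :: R)).getD ((encodeWords D).length + p.length) 0 =
      (encodeWord s).getD 0 0 := by
  rw [encodeWords_append, getD_append_length]
  have : encodeWords ((p ++ s) :: R) = p.map code ++ (encodeWord s ++ encodeWords R) := by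
    simp [encodeWords, encodeWord]
  rw [this]
  have h := getD_append_length (p.map code) (encodeWord s ++ encodeWords R) 0 0
  rw [List.length_map, Nat.add_zero] at h
  rw [h]
  cases s with
  | nil => simp [encodeWord]
  | cons a s => simp [encodeWord]

theorem totalLength_append {n : ℕ} (D R : List (Word n)) :
    totalLength (D ++ R) = totalLength D + totalLength R := by
  simp [totalLength]

theorem totalLength_cons {n : ℕ} (w : Word n) (R : List (Word n)) :
    totalLength (w :: R) = w.length + totalLength R := by
  simp [totalLength]

theorem WordState.next {n : ℕ} {A : Type} {S : A → Letter n → A → Prop} (hS : IsInverse S)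
    {d₀ : A} {φ : ℕ → A} {J D R : List (Word n)} {p s : Word n} {l : Letter n}
    (hJ : J = D ++ (p ++ l :: s) :: R) {σ σ' : State} (h : WordState S d₀ φ J D p (l :: s) σ) {d : A}
    (hd : S (φ (σ.reg Reg.cur)) l d) (hs : PathIn S d s d₀)
    (hz : σ'.reg Reg.zero = σ.reg Reg.zero) (ho : σ'.reg Reg.one = σ.reg Reg.one)
    (hwords : σ'.reg Reg.words = σ.reg Reg.words) (hw : σ'.reg Reg.w = σ.reg Reg.w)
    (hpos : σ'.reg Reg.pos = σ.reg Reg.pos + 1) (hnv : σ'.reg Reg.nv = σ.reg Reg.nv + 2)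
    (htl : σ'.reg Reg.tl = σ.reg Reg.tl + 1) (hcur : σ'.reg Reg.cur = σ.reg Reg.nv + 2)
    (hc : σ'.reg Reg.c = σ.arr (Arr.input (n := n)) (σ.reg Reg.pos + 1))
    (hin : σ'.arr (Arr.input (n := n)) = σ.arr (Arr.input (n := n)))
    (hqa : σ'.arr (Arr.qa (n := n)) =
      Function.update (σ.arr (Arr.qa (n := n))) (σ.reg Reg.tl) (σ.reg Reg.cur))
    (hqb : σ'.arr (Arr.qb (n := n)) =
      Function.update (σ.arr (Arr.qb (n := n))) (σ.reg Reg.tl) (σ.reg Reg.nv + 1))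
    (htr : trTable n σ' = addEdge (trTable n σ) (σ.reg Reg.nv + 1) l (σ.reg Reg.nv + 2)) :
    WordState S d₀ (Function.update (Function.update φ (σ.reg Reg.nv + 1) (φ (σ.reg Reg.cur)))
      (σ.reg Reg.nv + 2) d) J D (p ++ [l]) s σ' := by
  obtain ⟨hinv, hR⟩ := h.inv.addEdge hS h.cur_mem hd
  have hp := h.pos
  have hn := h.nv
  have ht := h.tl
  refine ⟨⟨hz.trans h.zero, ho.trans h.one, hwords.trans h.words, hin.trans h.input,
    hw.trans h.w, ?_, ?_, ?_, ?_, ?_⟩, ?_, ?_, ?_, ?_, ?_, ?_⟩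
  · rw [hpos, hp, List.length_append, List.length_singleton]
    omega
  · rw [hnv, htl, htr, hqa, hqb]
    exact hinv
  · rw [hnv, hn, List.length_append, List.length_singleton]
    omega
  · rw [htl, List.length_append, List.length_singleton]
    omega
  · rw [htl, hqa, hqb, hnv, htr]
    intro R' hR' u hu
    exact (h.loops R' (hR R' hR').1 u hu).map id relStep_addEdge
  · rw [hcur, hnv]
    exact Finset.mem_Icc.2 ⟨by omega, le_rfl⟩
  · have h1 := encodeWords_getD D R (p ++ [l]) s
    rw [List.length_append, List.length_singleton, List.append_assoc, List.singleton_append,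
      ← hJ] at h1
    rw [hc, h.input, hp, Nat.add_assoc]
    exact h1
  · rw [hcur, Function.update_self]
    exact pathIn_append.2 ⟨_, h.left, pathIn_singleton.2 hd⟩
  · rw [hcur, Function.update_self]
    exact hs
  · rw [hcur]
    simp
  · rw [htl, hqa, hqb, hnv, htr, hcur]
    intro R' hR'
    exact pathIn_append.2 ⟨_, (h.read R' (hR R' hR').1).map id relStep_addEdge,
      pathIn_singleton.2 (hR R' hR').2⟩

theorem parseWord_spec {n : ℕ} {A : Type} {S : A → Letter n → A → Prop} (hS : IsInverse S)
    {d₀ : A} {φ : ℕ → A} {J D R : List (Word n)} {w : Word n} (hJ : J = D ++ w :: R) {σ : State}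
    (h : WordState S d₀ φ J D [] w σ) :
    WP (parseWord n) σ fun σ' t => (∃ φ', WordState S d₀ φ' J D w [] σ') ∧
      t ≤ (16 * n + 20) * w.length + 1 := by
  unfold parseWord
  refine (wp_loop (fun k σ => ∃ φ p s, w = p ++ s ∧ WordState S d₀ φ J D p s σ ∧
    k = (16 * n + 20) * s.length) ?_ ⟨φ, [], w, rfl, h, rfl⟩).mono ?_
  · clear h σ φ
    rintro k σ ⟨φ, p, s, hw, h, rfl⟩ hb
    rw [holds_lt, h.zero, h.c] at hb
    cases s with
    | nil => simp [encodeWord] at hb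
    | cons l s =>
      obtain ⟨d, hd, hright⟩ := h.right
      have hc : σ.reg Reg.c = code l := by rw [h.c]; simp [encodeWord]
      simp only [wp_block_cons, wp_succ, wp_copy]
      simp only [setReg_reg, Reg.num_inj, reduceCtorEq, if_false, if_true]
      set σ₁ := ((σ.setReg Reg.a.num (σ.reg Reg.nv.num + 1)).setReg Reg.b.num
        (σ.reg Reg.nv.num + 1 + 1)).setReg Reg.nv.num (σ.reg Reg.nv.num + 1 + 1) with hσ₁
      have hd' := wp_dispatch (f := fun l : Letter n => block [.store (Arr.tr l) Reg.a Reg.b,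
        .store (Arr.tr (linv l)) Reg.b Reg.a]) (σ := σ₁) (l := l)
        (Q := fun σ' => σ'.arr = ((σ.setArr (Arr.tr l) (σ.reg Reg.nv + 1)
            (σ.reg Reg.nv + 2)).setArr (Arr.tr (linv l)) (σ.reg Reg.nv + 2)
            (σ.reg Reg.nv + 1)).arr ∧ ∀ r : Reg, r ≠ .k → σ'.reg r = σ₁.reg r) (T := 3)
        (by simpa [hσ₁] using hc) (by simp [Cmd.KeepsReg]) (by
          rintro σ' v ⟨h₁, h₂⟩
          refine ⟨h₁, fun r hr => ?_⟩
          rw [setReg_reg, if_neg (by simpa using hr)]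
          exact h₂ r hr) (by
          simp only [wp_block_cons, wp_store, wp_block_nil, hσ₁]
          simp only [setReg_reg, setArr_reg, Reg.num_inj, reduceCtorEq, if_false, if_true]
          refine ⟨⟨rfl, fun r hr => ?_⟩, by omega⟩
          simp only [setReg_reg, setArr_reg, Reg.num_inj, hr, if_false])
      refine hd'.mono ?_
      rintro σ₂ t₂ ⟨⟨harr, hreg⟩, ht₂⟩
      have e₁ : ∀ l', σ₂.arr (Arr.tr l').id =
          addEdge (trTable n σ) (σ.reg Reg.nv + 1) l (σ.reg Reg.nv + 2) l' := by
        intro l'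
        rw [harr]
        simp only [setArr_arr, Arr.id_inj, Arr.tr.injEq, addEdge, trTable]
        split_ifs with h₁ h₂ h₃
        · exact absurd h₂ (linv_ne l)
        · rw [h₁]
        · rw [h₃]
        · rfl
      have e₂ : ∀ a : Arr n, (∀ l, a ≠ .tr l) → σ₂.arr a = σ.arr a := by
        intro a ha
        rw [harr]
        simp [setArr_arr, ha]
      have hin := e₂ .input (by simp)
      have hqa := e₂ .qa (by simp)
      have hqb := e₂ .qb (by simp)
      have hgz := hreg .zero (by simp)
      have hgo := hreg .one (by simp)
      have hgw := hreg .words (by simp)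
      have hgw' := hreg .w (by simp)
      have hgp := hreg .pos (by simp)
      have hgn := hreg .nv (by simp)
      have hgt := hreg .tl (by simp)
      have hgc := hreg .cur (by simp)
      have hga := hreg .a (by simp)
      have hgb := hreg .b (by simp)
      simp only [hσ₁, setReg_reg, Reg.num_inj, reduceCtorEq, if_false, if_true]
        at hgz hgo hgw hgw' hgp hgn hgt hgc hga hgb
      clear hreg harr hd' hσ₁
      unfold enqueue
      simp only [wp_block_cons, wp_block_nil, wp_store, wp_succ, wp_copy, wp_load]
      simp only [setReg_reg, setReg_arr, setArr_reg, setArr_arr, Reg.num_inj, reduceCtorEq,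
        if_false, if_true, Arr.id_inj, hgz, hgo, hgw, hgw', hgp, hgn, hgt, hgc, hga, hgb, hqa, hqb,
        hin]
      refine ⟨(16 * n + 20) * s.length, ⟨_, p ++ [l], s, by simp [hw], h.next hS (hw ▸ hJ) hd hright
        ?_ ?_ ?_ ?_ ?_ ?_ ?_ ?_ ?_ ?_ ?_ ?_ ?_, rfl⟩, ?_⟩
      rotate_right
      · rw [List.length_cons, mul_add]
        omega
      rotate_right
      · funext l'
        rw [← e₁ l']
        simp only [trTable, setReg_arr, setArr_arr, Arr.id_inj, reduceCtorEq, if_false]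
      all_goals simp only [setReg_reg, setReg_arr, setArr_reg, setArr_arr, Reg.num_inj,
        reduceCtorEq, if_false, if_true, Arr.id_inj, hgz, hgo, hgw, hgw', hgp, hgn, hgt, hgc, hga,
        hgb, hqa, hqb, hin]
  · rintro σ' t ⟨k', ⟨φ, p, s, hw, h, rfl⟩, hb, ht⟩
    rw [holds_lt, h.zero, h.c] at hb
    cases s with
    | nil =>
      rw [List.append_nil] at hw
      subst hw
      exact ⟨⟨φ, h⟩, by simpa using ht⟩
    | cons l s =>
      have := code_pos l
      simp [encodeWord] at hb
      omega

theorem WordState.finish {n : ℕ} {A : Type} {S : A → Letter n → A → Prop}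
    {d₀ : A} {φ : ℕ → A} {J D : List (Word n)} {w : Word n} {σ σ' : State}
    (h : WordState S d₀ φ J D w [] σ)
    (hz : σ'.reg Reg.zero = σ.reg Reg.zero) (ho : σ'.reg Reg.one = σ.reg Reg.one)
    (hwords : σ'.reg Reg.words = σ.reg Reg.words) (hw : σ'.reg Reg.w = σ.reg Reg.w + 1)
    (hpos : σ'.reg Reg.pos = σ.reg Reg.pos + 1) (hnv : σ'.reg Reg.nv = σ.reg Reg.nv)
    (hin : σ'.arr (Arr.input (n := n)) = σ.arr (Arr.input (n := n)))
    (htr : trTable n σ' = trTable n σ)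
    (hq : 1 < σ.reg Reg.cur ∧ σ'.reg Reg.tl = σ.reg Reg.tl + 1 ∧ σ'.arr (Arr.qa (n := n)) =
        Function.update (σ.arr (Arr.qa (n := n))) (σ.reg Reg.tl) (σ.reg Reg.cur) ∧
        σ'.arr (Arr.qb (n := n)) = Function.update (σ.arr (Arr.qb (n := n))) (σ.reg Reg.tl) 1 ∨
      ¬ 1 < σ.reg Reg.cur ∧ σ'.reg Reg.tl = σ.reg Reg.tl ∧
        σ'.arr (Arr.qa (n := n)) = σ.arr (Arr.qa (n := n)) ∧
        σ'.arr (Arr.qb (n := n)) = σ.arr (Arr.qb (n := n))) :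
    ParseState S d₀ φ J (D ++ [w]) [] σ' := by
  have hp := h.pos
  have hn := h.nv
  have ht := h.tl
  have hr := h.right
  have hcm := Finset.mem_Icc.1 h.cur_mem
  have hlen : totalLength (D ++ [w]) = totalLength D + w.length := by
    simp [totalLength]
  refine ⟨hz.trans h.zero, ho.trans h.one, hwords.trans h.words, hin.trans h.input, ?_, ?_, ?_, ?_,
    ?_, ?_⟩
  · rw [hw, h.w, List.length_append, List.length_singleton]
  · rw [hpos, hp]
    simp [encodeWords, encodeWord]
    omega
  · rw [hnv, htr]
    rcases hq with ⟨h₁, h₂, h₃, h₄⟩ | ⟨h₁, h₂, h₃, h₄⟩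
    · rw [h₂, h₃, h₄]
      exact (h.inv.addPair h.cur_mem (Finset.mem_Icc.2 ⟨le_rfl, h.inv.pos⟩)
        (hr.trans h.inv.base.symm)).1
    · rw [h₂, h₃, h₄]
      exact h.inv
  · rw [hnv, hn, hlen, List.length_nil]
    omega
  · rw [hlen, List.length_nil]
    rcases hq with ⟨h₁, h₂, h₃, h₄⟩ | ⟨h₁, h₂, h₃, h₄⟩
    -- The pair that closes a circle is queued only after a nonempty word. Its one extra pair is
    -- then covered by the length of the word, and the queue is bounded by `2 * N` independently of
    -- the number of words.
    · have : 0 < w.length := List.length_pos_iff.2 fun h0 => by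
        have := h.cur_one.2 h0
        omega
      omega
    · omega
  · rw [hnv, htr]
    rcases hq with ⟨h₁, h₂, h₃, h₄⟩ | ⟨h₁, h₂, h₃, h₄⟩
    · rw [h₂, h₃, h₄]
      intro R hR u hu
      obtain ⟨hR₁, hR₂⟩ := (h.inv.addPair h.cur_mem (Finset.mem_Icc.2 ⟨le_rfl, h.inv.pos⟩)
        (hr.trans h.inv.base.symm)).2 R hR
      rcases List.mem_append.1 hu with hu | hu
      · exact h.loops R hR₁ u hu
      · rw [List.mem_singleton] at hu
        subst hu
        refine (h.read R hR₁).relStep_trans (fun h0 => ?_) hR₂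
        have := h.cur_one.2 h0
        omega
    · rw [h₂, h₃, h₄]
      intro R hR u hu
      rcases List.mem_append.1 hu with hu | hu
      · exact h.loops R hR u hu
      · rw [List.mem_singleton] at hu
        rw [hu, h.cur_one.1 (by omega)]
        rfl

theorem inputState_arr {n : ℕ} (J : List (Word n)) {a : Arr n} (ha : a ≠ .input) :
    (inputState J).arr a = fun _ => 0 := by
  have : a.id ≠ arrInput := fun h => ha (Arr.id_inj.1 (h.trans (rfl : _ = Arr.input.id)))
  funext i
  exact if_neg this

/-- The target graph is arbitrary as long as the generators label loops in it. It will be the folded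
graph, known to exist beforehand; the morphism `φ` to it certifies that later joins are correct. -/
theorem parse_spec {n : ℕ} {A : Type} {S : A → Letter n → A → Prop} (hS : IsInverse S)
    {d₀ : A} {J : List (Word n)} (hJ : ∀ w ∈ J, PathIn S d₀ w d₀) :
    WP (parse n) (inputState J) fun σ' t => (∃ φ, ParseState S d₀ φ J J [] σ') ∧
      t ≤ (16 * n + 20) * totalLength J + 20 * J.length + 10 := by
  unfold parse
  simp only [wp_block_cons, wp_const, wp_block_nil]
  refine (wp_loop (fun k σ => ∃ φ D R, J = D ++ R ∧ ParseState S d₀ φ J D [] σ ∧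
    k = (16 * n + 20) * totalLength R + 20 * R.length) (k := (16 * n + 20) * totalLength J +
      20 * J.length) ?_ ⟨fun _ => d₀, [], J, rfl, ?_, rfl⟩).mono ?_
  · rintro k σ ⟨φ, D, R, hR, h, rfl⟩ hb
    rw [holds_lt, h.w, h.words, hR, List.length_append] at hb
    obtain ⟨w, R, rfl⟩ : ∃ w R', R = w :: R' :=
      List.exists_cons_of_length_pos (by omega)
    simp only [wp_block_cons, wp_const, wp_load]
    simp only [setReg_reg, setReg_arr, Reg.num_inj, reduceCtorEq, if_false]
    have hin := h.input
    have hpos := h.pos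
    have h0 : WordState S d₀ φ J D [] w ((σ.setReg Reg.cur 1).setReg Reg.c
        (σ.arr (Arr.input (n := n)) (σ.reg Reg.pos))) := by
      have htr : trTable n ((σ.setReg Reg.cur 1).setReg Reg.c
        (σ.arr (Arr.input (n := n)) (σ.reg Reg.pos))) = trTable n σ := rfl
      refine ⟨⟨?_, ?_, ?_, ?_, ?_, ?_, ?_, ?_, ?_, ?_⟩, ?_, ?_, ?_, ?_, ?_, ?_⟩
      all_goals simp only [setReg_reg, setReg_arr, Reg.num_inj, reduceCtorEq, if_false, if_true,
        htr]
      · exact h.zero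
      · exact h.one
      · exact h.words
      · exact h.input
      · exact h.w
      · exact h.pos
      · exact h.inv
      · exact h.nv
      · exact h.tl
      · exact h.loops
      · exact Finset.mem_Icc.2 ⟨le_rfl, h.inv.pos⟩
      · rw [hin, hpos, hR]
        exact encodeWords_getD D R [] w
      · exact h.inv.base.symm
      · rw [h.inv.base]
        exact hJ w (by simp [hR])
      · intro _ _
        rfl
    refine (parseWord_spec hS hR h0).mono ?_
    rintro σ₁ t₁ ⟨⟨φ', h₁⟩, ht₁⟩
    have hcost : (16 * n + 20) * totalLength (w :: R) + 20 * (w :: R).length =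
        (16 * n + 20) * w.length + ((16 * n + 20) * totalLength R + 20 * R.length) + 20 := by
      rw [totalLength_cons, List.length_cons]
      ring
    rw [hcost]
    have hone := h₁.one
    rw [wp_ite]
    constructor
    all_goals
      intro hb₁
      rw [holds_lt, hone] at hb₁
      simp only [enqueue, wp_block_cons, wp_store, wp_succ, wp_block_nil, wp_skip]
      simp only [setReg_reg, setReg_arr, setArr_reg, setArr_arr, Reg.num_inj, Arr.id_inj,
        reduceCtorEq, if_false, if_true, hone]
      refine ⟨(16 * n + 20) * totalLength R + 20 * R.length, ⟨φ', D ++ [w], R, by simp [hR],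
        h₁.finish ?_ ?_ ?_ ?_ ?_ ?_ ?_ ?_ ?_, rfl⟩, by omega⟩
      rotate_right
      · simp [setReg_reg, setReg_arr, setArr_reg, setArr_arr, hb₁]
      rotate_right
      · funext l'
        simp only [trTable, setReg_arr, setArr_arr, Arr.id_inj, reduceCtorEq, if_false]
      all_goals simp only [setReg_reg, setReg_arr, setArr_reg, setArr_arr, Reg.num_inj,
        Arr.id_inj, reduceCtorEq, if_false, if_true]
  · refine ⟨?_, ?_, ?_, ?_, ?_, ?_, ?_, ?_, ?_, ?_⟩
    all_goals simp only [setReg_reg, setReg_arr, Reg.num_inj, reduceCtorEq, if_false, if_true]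
    · rfl
    · rfl
    · rfl
    · simp [encodeWords]
    · convert parseInv_init hS d₀ _ _ using 1
      funext l
      exact inputState_arr J (by simp)
    · rfl
    · rfl
    · intro _ _ w hw
      simp at hw
  · rintro σ' t ⟨k', ⟨φ, D, R, hR, h, rfl⟩, hb, ht⟩
    rw [holds_lt, h.w, h.words, hR, List.length_append] at hb
    obtain rfl : R = [] := List.length_eq_zero_iff.1 (by omega)
    rw [List.append_nil] at hR
    subst hR
    exact ⟨⟨φ, h⟩, by omega⟩

/-! ### The graph on the roots of the classes -/

/-- The nodes with `rt x = x`, with the transitions `T`, form a copy of the graph `Γ`. -/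
structure RootGraph {n : ℕ} (Γ : LGraph n) (φ : ℕ → Γ.V) (V : ℕ) (T : Letter n → ℕ → ℕ)
    (rt : ℕ → ℕ) : Prop where
  pos : 1 ≤ V
  base : φ 1 = Γ.base
  rt_mem : ∀ x ∈ Finset.Icc 1 V, rt x ∈ Finset.Icc 1 V
  rt_rt : ∀ x ∈ Finset.Icc 1 V, rt (rt x) = rt x
  rt_eq : ∀ x ∈ Finset.Icc 1 V, φ (rt x) = φ x
  rt_iff : ∀ x ∈ Finset.Icc 1 V, ∀ y ∈ Finset.Icc 1 V, φ x = φ y → rt x = rt y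
  mem : ∀ l, ∀ x ∈ Finset.Icc 1 V, rt x = x → T l x ≠ 0 → T l x ∈ Finset.Icc 1 V
  step : ∀ l, ∀ x ∈ Finset.Icc 1 V, rt x = x → T l x ≠ 0 → Γ.Step (φ x) l (φ (T l x))
  complete : ∀ l d, ∀ x ∈ Finset.Icc 1 V, rt x = x → Γ.Step (φ x) l d → T l x ≠ 0

theorem RootGraph.congr {n : ℕ} {Γ : LGraph n} {φ : ℕ → Γ.V} {V : ℕ} {T : Letter n → ℕ → ℕ}
    {rt rt' : ℕ → ℕ} (h : RootGraph Γ φ V T rt) (he : ∀ x ∈ Finset.Icc 1 V, rt' x = rt x) :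
    RootGraph Γ φ V T rt' where
  pos := h.pos
  base := h.base
  rt_mem x hx := by rw [he x hx]; exact h.rt_mem x hx
  rt_rt x hx := by rw [he x hx, he _ (h.rt_mem x hx)]; exact h.rt_rt x hx
  rt_eq x hx := by rw [he x hx]; exact h.rt_eq x hx
  rt_iff x hx y hy hxy := by rw [he x hx, he y hy]; exact h.rt_iff x hx y hy hxy
  mem l x hx hr := h.mem l x hx (he x hx ▸ hr)
  step l x hx hr := h.step l x hx (he x hx ▸ hr)
  complete l d x hx hr := h.complete l d x hx (he x hx ▸ hr)

/-- With the queue empty, the classes form a deterministic graph `S'` in which the generators label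
loops at the base, and `φ` maps it to `Γ`. It remains to see that this map is injective and that no
transition of `Γ` is missing at a root. -/
theorem FoldInv.rootGraph {n : ℕ} {J : List (Word n)} {Γ : LGraph n} (hf : Γ.IsFolded)
    (hc : Carries J Γ) {φ : ℕ → Γ.V} {V m k : ℕ} {T₀ T : Letter n → ℕ → ℕ}
    {qa₀ qb₀ qa qb par rk rep : ℕ → ℕ} (hp : ParseInv Γ.Step Γ.base φ V m T₀ qa₀ qb₀)
    (hl : ∀ R : Setoid ℕ, Joins R m qa₀ qb₀ → ∀ w ∈ J, PathIn (relStep R V T₀) 1 w 1)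
    (hu : UnionFind V par rk rep) (h : FoldInv φ V T₀ T qa qb rep k k)
    (hj : ∀ i < m, rep (qa₀ i) = rep (qb₀ i)) : RootGraph Γ φ V T rep := by
  have hS := hf.isInverse
  have h1 : 1 ∈ Finset.Icc 1 V := Finset.mem_Icc.2 ⟨le_rfl, hp.pos⟩
  have hcompl : ∀ l, ∀ u ∈ Finset.Icc 1 V, T₀ l u ≠ 0 →
      T l (rep u) ≠ 0 ∧ rep (T l (rep u)) = rep (T₀ l u) := by
    refine h.complete (Setoid.ker rep) ?_ ?_
    · intro x hx
      exact (hu.rep_rep hx).symm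
    · intro i h₁ h₂
      omega
  let S' : ℕ → Letter n → ℕ → Prop := fun a l b =>
    ∃ u ∈ Finset.Icc 1 V, rep u = a ∧ T₀ l u ≠ 0 ∧ rep (T₀ l u) = b
  have hS' : IsInverse S' := by
    constructor
    · rintro a l b b' ⟨u, hu, rfl, hT, rfl⟩ ⟨u', hu', he, hT', rfl⟩
      rw [← (hcompl l u hu hT).2, ← (hcompl l u' hu' hT').2, he]
    · rintro a l b ⟨u, hu, rfl, hT, rfl⟩
      refine ⟨T₀ l u, hp.data.mem l u hu hT, rfl, ?_⟩
      rw [hp.symm l u hu hT]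
      exact ⟨by have := (Finset.mem_Icc.1 hu).1; omega, rfl⟩
  have hmap : ∀ {x w y}, PathIn (relStep (Setoid.ker rep) V T₀) x w y →
      PathIn S' (rep x) w (rep y) := by
    intro x w y hxy
    refine hxy.map rep ?_
    rintro v l w ⟨u, hu, h₁, h₂, h₃⟩
    exact ⟨u, hu, Eq.symm h₁, h₂, h₃⟩
  have hstep : ∀ {a l b}, S' a l b → Γ.Step (φ a) l (φ b) := by
    rintro a l b ⟨u, hu, rfl, hT, rfl⟩
    rw [h.rep_eq u hu, h.rep_eq _ (hp.data.mem l u hu hT)]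
    exact hp.data.step l u hu hT
  have hb : φ (rep 1) = Γ.base := (h.rep_eq 1 h1).trans hp.base
  have hdown : ∀ {w a}, PathIn S' (rep 1) w a → PathIn Γ.Step Γ.base w (φ a) := by
    intro w a ha
    have := ha.map φ hstep
    rwa [hb] at this
  have hloop : ∀ w ∈ J, PathIn S' (rep 1) w (rep 1) := fun w hw => hmap (hl (Setoid.ker rep) hj w hw)
  have hconn : ∀ x ∈ Finset.Icc 1 V, ∃ w, PathIn S' (rep 1) w (rep x) := by
    intro x hx
    obtain ⟨w, hw⟩ := hp.conn (Setoid.ker rep) hj x hx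
    exact ⟨w, hmap hw⟩
  have hiff : ∀ x ∈ Finset.Icc 1 V, ∀ y ∈ Finset.Icc 1 V, φ x = φ y → rep x = rep y := by
    intro x hx y hy he
    obtain ⟨w, hw⟩ := hconn x hx
    obtain ⟨w', hw'⟩ := hconn y hy
    have h₁ := hdown hw
    have h₂ := hdown hw'
    rw [h.rep_eq x hx] at h₁
    rw [h.rep_eq y hy, ← he] at h₂
    -- Paths `w` and `w'` in `S'` to the classes of `x` and `y` have the same end in `Γ`, so `w
    -- w'⁻¹` lies in the subgroup. It is therefore also represented by a loop in `S'`, and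
    -- determinism makes the two classes equal.
    have h₃ := hc.mem_of_loop (pathIn_append.2 ⟨_, h₁, hS.path_invRev h₂⟩)
    obtain ⟨z, hz, hz'⟩ := hS'.exists_loop hloop h₃
    refine hS'.path_unique_of_mk_eq hw (pathIn_append.2 ⟨_, hz', hw'⟩) ?_
    rw [← FreeGroup.mul_mk, hz, ← FreeGroup.mul_mk, ← FreeGroup.inv_mk, inv_mul_cancel_right]
  have hfwd : ∀ {a l b}, S' a l b → ∀ x ∈ Finset.Icc 1 V, φ a = φ x → T l (rep x) ≠ 0 := by
    rintro a l b ⟨u, hu, rfl, hT, rfl⟩ x hx he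
    rw [h.rep_eq u hu] at he
    rw [← hiff u hu x hx he]
    exact (hcompl l u hu hT).1
  refine ⟨hp.pos, hp.base, hu.rep_mem, fun x hx => hu.rep_rep hx, h.rep_eq, hiff, ?_, ?_, ?_⟩
  · intro l x hx _ h0
    obtain ⟨u, hu, -, hT⟩ := h.orig l x hx h0
    rw [← hT]
    exact hp.data.mem l u hu (hT ▸ h0)
  · intro l x hx _ h0
    obtain ⟨u, hu, he, hT⟩ := h.orig l x hx h0
    rw [← hT, ← h.rep_eq x hx, ← he, h.rep_eq u hu]
    exact hp.data.step l u hu (hT ▸ h0)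
  · intro l d x hx hr hd
    rw [← hr]
    -- The edge of `Γ` is passed by a generator. The same generator is read around a loop of `S'`,
    -- and injectivity locates the corresponding edge at the class of `x`.
    obtain ⟨w, hw, p, s, ⟨rfl, hps⟩ | ⟨rfl, hps⟩⟩ := hc.edge hd
    · obtain ⟨a, ha, b, hab, -⟩ := pathIn_append.1 (hloop _ hw)
      exact hfwd hab x hx (hS.path_unique (hdown ha) hps)
    · obtain ⟨a, ha, b, hab, -⟩ := pathIn_append.1 (hloop _ hw)
      have he := hS.path_unique (hdown ha) hps
      have hba := hS'.symm hab
      rw [linv_linv] at hba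
      refine hfwd hba x hx (hS.det (hstep hab) ?_)
      rw [he]
      exact hS.symm hd

/-! ### Looking up all roots -/

/-- Store the roots of all nodes in the array `rt`. -/
noncomputable def flatten (n : ℕ) : Cmd := block [
  .const Reg.i 1, .succ Reg.lim Reg.nv,
  .loop (.lt Reg.i Reg.lim) (block [
    .copy Reg.x Reg.i, findRoot n, .store (Arr.rt (n := n)) Reg.i Reg.x, .succ Reg.i Reg.i])]

/-- Halving moves parents but no representatives, so the recorded roots remain valid. One find per
node costs `O(L)` on average, by the same potential as before. -/
theorem flatten_spec {n V L : ℕ} {rep : ℕ → ℕ} {σ : State} (hz : σ.reg Reg.zero = 0)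
    (hV : σ.reg Reg.nv = V) (hL : V < tower (L + 1))
    (huf : UnionFind V (σ.arr (Arr.par (n := n))) (σ.arr (Arr.rk (n := n))) rep) :
    WP (flatten n) σ fun σ' t =>
      (∀ x ∈ Finset.Icc 1 V, σ'.arr (Arr.rt (n := n)) x = rep x) ∧
      t ≤ (12 * (L + 2) + 10) * V + 24 * L * V + 4 := by
  unfold flatten
  simp only [wp_block_cons, wp_const, wp_succ, wp_block_nil]
  refine (wp_loop (fun k σ' => σ'.reg Reg.zero = 0 ∧ σ'.reg Reg.lim = V + 1 ∧
    σ'.reg Reg.i ∈ Finset.Icc 1 (V + 1) ∧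
    UnionFind V (σ'.arr (Arr.par (n := n))) (σ'.arr (Arr.rk (n := n))) rep ∧
    (∀ x ∈ Finset.Ico 1 (σ'.reg Reg.i), σ'.arr (Arr.rt (n := n)) x = rep x) ∧
    k + 12 * potential V (σ'.arr (Arr.par (n := n))) (σ'.arr (Arr.rk (n := n))) =
      (12 * (L + 2) + 10) * (V + 1 - σ'.reg Reg.i) + 12 * (2 * L * V)) (k :=
    (12 * (L + 2) + 10) * V + 12 * (2 * L * V) -
      12 * potential V (σ.arr (Arr.par (n := n))) (σ.arr (Arr.rk (n := n)))) ?_ ?_).mono ?_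
  · rintro k σ ⟨hz, hlim, hi, huf, hrt, hk⟩ hb
    rw [holds_lt, hlim] at hb
    rw [Finset.mem_Icc] at hi
    simp only [wp_block_cons, wp_copy]
    refine (findRoot_spec (L := L) (rep := rep) (V := V) (n := n) ?_ hL ?_ ?_).frame.mono ?_
    · simpa [setReg_reg] using hz
    · simpa [setReg_arr] using huf
    · simp [setReg_reg]
      omega
    rintro σ₁ t₁ ⟨⟨h₁, h₂, -, h₄⟩, hfr⟩
    have g₁ := hfr.reg Reg.zero (findRoot_keepsReg (by simp))
    have g₂ := hfr.reg Reg.lim (findRoot_keepsReg (by simp))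
    have g₃ := hfr.reg Reg.i (findRoot_keepsReg (by simp))
    have g₄ := hfr.arr (Arr.rt (n := n)) (findRoot_keepsArr (by simp))
    have g₅ := hfr.arr (Arr.rk (n := n)) (findRoot_keepsArr (by simp))
    simp only [setReg_reg, setReg_arr, Reg.num_inj, reduceCtorEq, if_true, if_false]
      at g₁ g₂ g₃ g₄ g₅ h₁ h₂ h₄
    simp only [wp_block_nil, wp_store, wp_succ]
    simp only [setReg_reg, setReg_arr, setArr_reg, setArr_arr, Reg.num_inj, Arr.id_inj,
      reduceCtorEq, if_true, if_false, g₁, g₂, g₃, g₄, g₅, h₂]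
    have hpot := h₁.potential_le hL
    have e : V + 1 - σ.reg Reg.i = (V + 1 - (σ.reg Reg.i + 1)) + 1 := by omega
    rw [e, mul_add] at hk
    refine ⟨(12 * (L + 2) + 10) * (V + 1 - (σ.reg Reg.i + 1)) + 12 * (2 * L * V) -
      12 * potential V (σ₁.arr (Arr.par (n := n))) (σ.arr (Arr.rk (n := n))), ⟨hz, hlim, ?_, h₁, ?_,
      ?_⟩, ?_⟩
    · rw [Finset.mem_Icc]
      omega
    · intro x hx
      rw [Finset.mem_Ico] at hx
      by_cases he : x = σ.reg Reg.i
      · rw [he, Function.update_self]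
      · rw [Function.update_of_ne he]
        exact hrt x (Finset.mem_Ico.2 (by omega))
    · omega
    · omega
  · have hpot := huf.potential_le hL
    simp only [setReg_reg, setReg_arr, Reg.num_inj, reduceCtorEq, if_true, if_false, hV]
    refine ⟨hz, trivial, Finset.mem_Icc.2 (by omega), huf, ?_, ?_⟩
    · intro x hx
      simp at hx
    · rw [Nat.add_sub_cancel]
      omega
  · rintro σ' t ⟨k, ⟨-, hlim, hi, -, hrt, -⟩, hb, ht⟩
    rw [holds_lt, hlim] at hb
    rw [Finset.mem_Icc] at hi
    refine ⟨fun x hx => hrt x ?_, ?_⟩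
    · rw [Finset.mem_Icc] at hx
      rw [Finset.mem_Ico]
      omega
    · have : 12 * (2 * L * V) = 24 * L * V := by ring
      omega

theorem flatten_keepsReg {n : ℕ} {r : Reg}
    (h : r ≠ .x ∧ r ≠ .p ∧ r ≠ .q ∧ r ≠ .i ∧ r ≠ .lim) : (flatten n).KeepsReg r := by
  have := findRoot_keepsReg (n := n) (r := r) ⟨h.1, h.2.1, h.2.2.1⟩
  simp [flatten, Cmd.KeepsReg, h, this]

theorem flatten_keepsArr {n : ℕ} {a : Arr n} (h : a ≠ .par ∧ a ≠ .rt) :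
    (flatten n).KeepsArr a := by
  have := findRoot_keepsArr h.1
  simp [flatten, Cmd.KeepsArr, h, this]

/-! ### Breadth first search -/

/-- The row `i` of the transition table, for the letter `l`, is filled in correctly. -/
def BfsEntry {n : ℕ} (Γ : LGraph n) (φ : ℕ → Γ.V) (root parent : ℕ → ℕ) (k i : ℕ) (l : Letter n)
    (q : ℕ) : Prop :=
  (q ∈ Finset.Icc 1 k ∧ Γ.Step (φ (root i)) l (φ (root q)) ∧ parent q ≤ i) ∨
    (q = 0 ∧ ¬ ∃ d, Γ.Step (φ (root i)) l d)

/-- The invariant of the search: `k` vertices have been found, the rows below `i` of the table are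
complete, and so are the entries in the row `i` for the letters in `D`. -/
structure BfsInv {n : ℕ} (Γ : LGraph n) (φ : ℕ → Γ.V) (V : ℕ) (rt root num parent letter : ℕ → ℕ)
    (tbl : Letter n → ℕ → ℕ) (k i : ℕ) (D : List (Letter n)) (full : ℕ) : Prop where
  pos : 1 ≤ k
  root_mem : ∀ j ∈ Finset.Icc 1 k, root j ∈ Finset.Icc 1 V ∧ rt (root j) = root j ∧
    num (root j) = j
  num_root : ∀ x, num x ≠ 0 → num x ∈ Finset.Icc 1 k ∧ root (num x) = x
  root_one : root 1 = rt 1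
  parent_one : parent 1 = 0
  tree : ∀ j ∈ Finset.Icc 2 k, 1 ≤ parent j ∧ parent j < j ∧ parent j ≤ i ∧
    ∃ l, letter j = code l ∧ Γ.Step (φ (root (parent j))) l (φ (root j))
  -- The queue discipline of breadth first search. It makes the depth monotone in the numbering.
  mono : ∀ j j', 2 ≤ j → j ≤ j' → j' ≤ k → parent j ≤ parent j'
  table : ∀ j l, 1 ≤ j → (j < i ∨ j = i ∧ l ∈ D) → BfsEntry Γ φ root parent k j l (tbl l j)
  full_iff : full = 1 ↔ ∀ j l, 1 ≤ j → (j < i ∨ j = i ∧ l ∈ D) → ∃ d, Γ.Step (φ (root j)) l d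

namespace BfsInv

variable {n : ℕ} {Γ : LGraph n} {φ : ℕ → Γ.V} {V : ℕ} {rt root num parent letter : ℕ → ℕ}
    {tbl : Letter n → ℕ → ℕ} {k i : ℕ} {D : List (Letter n)} {full : ℕ}

theorem le_nodes (h : BfsInv Γ φ V rt root num parent letter tbl k i D full) : k ≤ V := by
  have := Finset.card_le_card_of_injOn (s := Finset.Icc 1 k) (t := Finset.Icc 1 V) root
    (fun j hj => (h.root_mem j hj).1) (fun j hj j' hj' he => by
      rw [← (h.root_mem j hj).2.2, ← (h.root_mem j' hj').2.2, he])
  simpa using this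

theorem record (h : BfsInv Γ φ V rt root num parent letter tbl k i D full) (hi : 1 ≤ i)
    {l : Letter n} {q full' : ℕ} (hq : BfsEntry Γ φ root parent k i l q)
    (hf : full' = if q = 0 then 0 else full) {tbl' : Letter n → ℕ → ℕ}
    (ht : ∀ l', tbl' l' = if l' = l then Function.update (tbl l) i q else tbl l') :
    BfsInv Γ φ V rt root num parent letter tbl' k i (D ++ [l]) full' := by
  refine ⟨h.pos, h.root_mem, h.num_root, h.root_one, h.parent_one, h.tree, h.mono, ?_, ?_⟩
  · intro j l' hj hd
    rw [ht]
    by_cases hl : l' = l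
    · subst hl
      rw [if_pos rfl]
      by_cases hji : j = i
      · rw [hji, Function.update_self]
        exact hq
      · rw [Function.update_of_ne hji]
        exact h.table j l' hj (Or.inl (by tauto))
    · rw [if_neg hl]
      refine h.table j l' hj ?_
      simpa [hl] using hd
  · have hq' : q ≠ 0 ↔ ∃ d, Γ.Step (φ (root i)) l d := by
      rcases hq with ⟨h₁, h₂, -⟩ | ⟨h₁, h₂⟩
      · exact ⟨fun _ => ⟨_, h₂⟩, fun _ => by have := (Finset.mem_Icc.1 h₁).1; omega⟩
      · exact ⟨fun h' => absurd h₁ h', fun h' => absurd h' h₂⟩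
    have hpos : full' = 1 ↔ q ≠ 0 ∧ full = 1 := by
      rw [hf]
      split_ifs with h0
      · simp [h0]
      · simp [h0]
    rw [hpos, hq', h.full_iff]
    constructor
    · rintro ⟨h₁, h₂⟩ j l' hj hd
      by_cases hc : j = i ∧ l' = l
      · rw [hc.1, hc.2]
        exact h₁
      · refine h₂ j l' hj ?_
        simp only [List.mem_append, List.mem_singleton] at hd
        tauto
    · intro h'
      refine ⟨?_, fun j l' hj hd => h' j l' hj ?_⟩
      · exact h' i l hi (by simp)
      · simp only [List.mem_append, List.mem_singleton]
        tauto

/-- All parents so far are at most the current row `i`, so a vertex whose parent is `i` can be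
appended without breaking monotonicity. Former entries stay correct because only the new number `k +
1` is written. -/
theorem discover (h : BfsInv Γ φ V rt root num parent letter tbl k i D full) {l : Letter n}
    {p : ℕ} (hp : p ∈ Finset.Icc 1 V) (hrt : rt p = p) (hnum : num p = 0)
    (hi : i ∈ Finset.Icc 1 k) (hs : Γ.Step (φ (root i)) l (φ p)) :
    BfsInv Γ φ V rt (Function.update root (k + 1) p) (Function.update num p (k + 1))
      (Function.update parent (k + 1) i) (Function.update letter (k + 1) (code l)) tbl (k + 1) i D
      full := by
  rw [Finset.mem_Icc] at hi
  have hr : ∀ j ≤ k, Function.update root (k + 1) p j = root j := fun j hj =>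
    Function.update_of_ne (by omega) _ _
  have hpa : ∀ j ≤ k, Function.update parent (k + 1) i j = parent j := fun j hj =>
    Function.update_of_ne (by omega) _ _
  have hcases : ∀ {a j}, j ∈ Finset.Icc a (k + 1) → j ∈ Finset.Icc a k ∨ j = k + 1 := by
    intro a j hj
    rw [Finset.mem_Icc] at hj ⊢
    omega
  refine ⟨by omega, ?_, ?_, ?_, ?_, ?_, ?_, ?_, ?_⟩
  · intro j hj
    rcases hcases hj with hj | rfl
    · have h₁ := h.root_mem j hj
      rw [hr j (Finset.mem_Icc.1 hj).2]
      refine ⟨h₁.1, h₁.2.1, ?_⟩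
      rw [Function.update_of_ne, h₁.2.2]
      rintro he
      rw [he, hnum] at h₁
      have := (Finset.mem_Icc.1 hj).1
      omega
    · simp only [Function.update_self]
      exact ⟨hp, hrt, trivial⟩
  · intro x hx
    by_cases he : x = p
    · subst he
      simp only [Function.update_self]
      exact ⟨Finset.mem_Icc.2 (by omega), trivial⟩
    · rw [Function.update_of_ne he] at hx ⊢
      obtain ⟨h₁, h₂⟩ := h.num_root x hx
      rw [Finset.mem_Icc] at h₁
      rw [hr _ h₁.2]
      exact ⟨Finset.mem_Icc.2 (by omega), h₂⟩
  · rw [hr 1 h.pos, h.root_one]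
  · rw [hpa 1 h.pos, h.parent_one]
  · intro j hj
    rcases hcases hj with hj | rfl
    · obtain ⟨h₁, h₂, h₃, l', h₄, h₅⟩ := h.tree j hj
      rw [Finset.mem_Icc] at hj
      rw [hpa j hj.2, hr _ (by omega), hr _ (by omega), Function.update_of_ne (by omega)]
      exact ⟨h₁, h₂, h₃, l', h₄, h₅⟩
    · simp only [Function.update_self]
      rw [hr i hi.2]
      exact ⟨hi.1, by omega, le_rfl, l, rfl, hs⟩
  · intro j j' h₁ h₂ h₃
    by_cases he : j' = k + 1
    · rw [he, Function.update_self]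
      by_cases hj : j = k + 1
      · rw [hj, Function.update_self]
      · rw [hpa j (by omega)]
        exact (h.tree j (Finset.mem_Icc.2 (by omega))).2.2.1
    · rw [hpa j (by omega), hpa j' (by omega)]
      exact h.mono j j' h₁ h₂ (by omega)
  · intro j l' hj hd
    have hji : j ≤ i := by omega
    rcases h.table j l' hj hd with ⟨h₁, h₂, h₃⟩ | ⟨h₁, h₂⟩
    · rw [Finset.mem_Icc] at h₁
      refine Or.inl ⟨Finset.mem_Icc.2 (by omega), ?_, ?_⟩
      · rw [hr _ (by omega), hr _ h₁.2]
        exact h₂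
      · rw [hpa _ h₁.2]
        exact h₃
    · refine Or.inr ⟨h₁, ?_⟩
      rw [hr _ (by omega)]
      exact h₂
  · rw [h.full_iff]
    refine forall_congr' fun j => forall_congr' fun l' => forall_congr' fun hj =>
      forall_congr' fun hd => ?_
    rw [hr j (by omega)]

theorem nextRow (h : BfsInv Γ φ V rt root num parent letter tbl k i (letters n) full) :
    BfsInv Γ φ V rt root num parent letter tbl k (i + 1) [] full := by
  have hd : ∀ {j : ℕ} {l : Letter n}, (j < i + 1 ∨ j = i + 1 ∧ l ∈ []) ↔
      (j < i ∨ j = i ∧ l ∈ letters n) := by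
    intro j l
    simp only [List.not_mem_nil, and_false, or_false, mem_letters, and_true]
    omega
  refine ⟨h.pos, h.root_mem, h.num_root, h.root_one, h.parent_one, ?_, h.mono, ?_, ?_⟩
  · intro j hj
    obtain ⟨h₁, h₂, h₃, h₄⟩ := h.tree j hj
    exact ⟨h₁, h₂, by omega, h₄⟩
  · intro j l hj
    rw [hd]
    exact h.table j l hj
  · simp only [hd]
    exact h.full_iff

end BfsInv

theorem bfsInv_init {n : ℕ} {Γ : LGraph n} {φ : ℕ → Γ.V} {V : ℕ} {T : Letter n → ℕ → ℕ}
    {rt : ℕ → ℕ} (hg : RootGraph Γ φ V T rt) {root num parent : ℕ → ℕ} (letter : ℕ → ℕ)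
    (tbl : Letter n → ℕ → ℕ) (hr : root 1 = rt 1)
    (hn : num = Function.update (fun _ => 0) (rt 1) 1) (hp : parent 1 = 0) :
    BfsInv Γ φ V rt root num parent letter tbl 1 1 [] 1 where
  pos := le_rfl
  root_mem j hj := by
    have h1 : 1 ∈ Finset.Icc 1 V := Finset.mem_Icc.2 ⟨le_rfl, hg.pos⟩
    obtain rfl : j = 1 := by simpa using hj
    rw [hr, hn, Function.update_self]
    exact ⟨hg.rt_mem 1 h1, hg.rt_rt 1 h1, rfl⟩
  num_root x hx := by
    rw [hn] at hx ⊢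
    by_cases he : x = rt 1
    · rw [he, Function.update_self]
      exact ⟨by simp, hr⟩
    · rw [Function.update_of_ne he] at hx
      exact absurd rfl hx
  root_one := hr
  parent_one := hp
  tree j hj := by
    rw [Finset.mem_Icc] at hj
    omega
  mono j j' _ _ _ := by omega
  table j l hj hd := by
    simp at hd
    omega
  full_iff := by
    simp only [true_iff]
    intro j l hj hd
    simp at hd
    omega

/-- Examine the edge with label `l` at the vertex in the register `i`, whose root is in `r`. -/
noncomputable def bfsLetter {n : ℕ} (l : Letter n) : Cmd := block [
  .load Reg.p (Arr.tr l) Reg.r,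
  .ite (.lt Reg.zero Reg.p)
    (block [.load Reg.p (Arr.rt (n := n)) Reg.p, .load Reg.q (Arr.num (n := n)) Reg.p,
      .ite (.eq Reg.q Reg.zero)
        (block [.succ Reg.verts Reg.verts, .copy Reg.q Reg.verts,
          .store (Arr.num (n := n)) Reg.p Reg.q, .store (Arr.root (n := n)) Reg.q Reg.p,
          .store (Arr.parent (n := n)) Reg.q Reg.i, .const Reg.k (code l),
          .store (Arr.letter (n := n)) Reg.q Reg.k])
        .skip])
    (block [.const Reg.full 0, .copy Reg.q Reg.zero]),
  .store (Arr.tbl l) Reg.i Reg.q]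

/-- Number the vertices, fill in the transition table and build the spanning tree. -/
noncomputable def bfs (n : ℕ) : Cmd := block [
  .const Reg.verts 1, .load Reg.x (Arr.rt (n := n)) Reg.one,
  .store (Arr.root (n := n)) Reg.one Reg.x, .store (Arr.num (n := n)) Reg.x Reg.one,
  .store (Arr.parent (n := n)) Reg.one Reg.zero, .const Reg.full 1, .const Reg.i 1,
  .const Reg.lim 2,
  .loop (.lt Reg.i Reg.lim) (block [.load Reg.r (Arr.root (n := n)) Reg.i,
    block ((letters n).map bfsLetter), .succ Reg.i Reg.i, .succ Reg.lim Reg.verts]),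
  .ite (.eq Reg.full Reg.one) (.copy Reg.index Reg.verts) (.const Reg.index 0)]

/-- The transition table in the memory. -/
def tblTable (n : ℕ) (σ : State) : Letter n → ℕ → ℕ := fun l => σ.arr (Arr.tbl l)

/-- The invariant of the search, in terms of the memory. -/
structure BfsState {n : ℕ} (Γ : LGraph n) (φ : ℕ → Γ.V) (V : ℕ) (T : Letter n → ℕ → ℕ)
    (rt : ℕ → ℕ) (i : ℕ) (D : List (Letter n)) (σ : State) : Prop where
  zero : σ.reg Reg.zero = 0
  one : σ.reg Reg.one = 1
  rt_eq : σ.arr (Arr.rt (n := n)) = rt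
  tr : trTable n σ = T
  reg_i : σ.reg Reg.i = i
  inv : BfsInv Γ φ V rt (σ.arr (Arr.root (n := n))) (σ.arr (Arr.num (n := n)))
    (σ.arr (Arr.parent (n := n))) (σ.arr (Arr.letter (n := n))) (tblTable n σ) (σ.reg Reg.verts) i D
    (σ.reg Reg.full)

theorem bfsLetter_spec {n : ℕ} {Γ : LGraph n} {φ : ℕ → Γ.V} {V : ℕ}
    {T : Letter n → ℕ → ℕ} {rt : ℕ → ℕ}
    (hg : RootGraph Γ φ V T rt) {i : ℕ} {D : List (Letter n)} (l : Letter n) {σ : State}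
    (h : BfsState Γ φ V T rt i D σ) (hi : i ∈ Finset.Icc 1 (σ.reg Reg.verts))
    (hr : σ.reg Reg.r = σ.arr (Arr.root (n := n)) i) :
    WP (bfsLetter l) σ fun σ' t => (BfsState Γ φ V T rt i (D ++ [l]) σ' ∧
      i ∈ Finset.Icc 1 (σ'.reg Reg.verts) ∧
      σ'.reg Reg.r = σ'.arr (Arr.root (n := n)) i) ∧ t ≤ 20 := by
  obtain ⟨hm, hroot, hnum⟩ := h.inv.root_mem i hi
  have htr : σ.arr (Arr.tr l) = T l := congrFun h.tr l
  have hz := h.zero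
  have hri := h.reg_i
  have hrt := h.rt_eq
  unfold bfsLetter
  simp only [wp_block_cons, wp_block_nil, wp_load, wp_ite, wp_store, wp_const, wp_copy, wp_succ,
    wp_skip, holds_lt, holds_eq]
  simp only [setReg_reg, setReg_arr, setArr_reg, setArr_arr, Reg.num_inj, Arr.id_inj,
    reduceCtorEq, if_true, if_false, hz, hr, htr, hri, hrt]
  have hi' := Finset.mem_Icc.1 hi
  have hpm₀ : 0 < T l (σ.arr (Arr.root (n := n)) i) →
      T l (σ.arr (Arr.root (n := n)) i) ∈ Finset.Icc 1 V := fun hp => hg.mem l _ hm hroot hp.ne'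
  have hs : 0 < T l (σ.arr (Arr.root (n := n)) i) →
      Γ.Step (φ (σ.arr (Arr.root (n := n)) i)) l (φ (rt (T l (σ.arr (Arr.root (n := n)) i)))) := by
    intro hp
    rw [hg.rt_eq _ (hpm₀ hp)]
    exact hg.step l _ hm hroot hp.ne'
  refine ⟨fun hp => ?_, fun hp => ?_⟩
  · replace hpm₀ := hpm₀ hp
    replace hs := hs hp
    have hpm := hg.rt_mem _ hpm₀
    refine ⟨fun hq => ?_, fun hq => ?_⟩
    · have hd := h.inv.discover hpm (hg.rt_rt _ hpm₀) hq hi hs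
      refine ⟨⟨⟨?_, ?_, ?_, ?_, ?_, ?_⟩, ?_, ?_⟩, by omega⟩
      all_goals try simp only [setReg_reg, setReg_arr, setArr_reg, setArr_arr, Reg.num_inj,
        Arr.id_inj, reduceCtorEq, if_true, if_false, hz, hri, hrt]
      · exact h.one
      · rw [← h.tr]
        funext l'
        simp only [trTable, setReg_arr, setArr_arr, Arr.id_inj, reduceCtorEq, if_false]
      · refine hd.record hi'.1 (q := σ.reg Reg.verts + 1) (Or.inl ⟨?_, ?_, ?_⟩) ?_ ?_
        · exact Finset.mem_Icc.2 (by omega)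
        · rw [Function.update_self, Function.update_of_ne (by omega)]
          exact hs
        · rw [Function.update_self]
        · simp
        · intro l'
          simp only [tblTable, setReg_arr, setArr_arr, Arr.id_inj, Arr.tbl.injEq, reduceCtorEq,
            if_false]
      · exact Finset.mem_Icc.2 (by omega)
      · rw [Function.update_of_ne (by omega)]
    · obtain ⟨hqm, hqr⟩ := h.inv.num_root _ hq
      refine ⟨⟨⟨?_, ?_, ?_, ?_, ?_, ?_⟩, ?_, ?_⟩, by omega⟩
      all_goals try simp only [setReg_reg, setReg_arr, setArr_reg, setArr_arr, Reg.num_inj,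
        Arr.id_inj, reduceCtorEq, if_true, if_false, hz, hri, hrt]
      · exact h.one
      · rw [← h.tr]
        funext l'
        simp only [trTable, setReg_arr, setArr_arr, Arr.id_inj, reduceCtorEq, if_false]
      · refine h.inv.record hi'.1 (Or.inl ⟨hqm, ?_, ?_⟩) ?_ ?_
        · rw [hqr]
          exact hs
        · by_cases h1 : σ.arr (Arr.num (n := n)) (rt (T l (σ.arr (Arr.root (n := n)) i))) = 1
          · rw [h1, h.inv.parent_one]
            omega
          · rw [Finset.mem_Icc] at hqm
            exact (h.inv.tree _ (Finset.mem_Icc.2 (by omega))).2.2.1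
        · rw [if_neg hq]
        · intro l'
          simp only [tblTable, setReg_arr, setArr_arr, Arr.id_inj, Arr.tbl.injEq, reduceCtorEq,
            if_false]
      · exact hi
  · refine ⟨⟨⟨?_, ?_, ?_, ?_, ?_, ?_⟩, ?_, ?_⟩, by omega⟩
    all_goals try simp only [setReg_reg, setReg_arr, setArr_reg, setArr_arr, Reg.num_inj, Arr.id_inj,
      reduceCtorEq, if_true, if_false, hz, hri, hrt]
    · exact h.one
    · rw [← h.tr]
      funext l'
      simp only [trTable, setReg_arr, setArr_arr, Arr.id_inj, reduceCtorEq, if_false]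
    · refine h.inv.record hi'.1 (q := 0) (Or.inr ⟨rfl, ?_⟩) ?_ ?_
      · rintro ⟨d, hd⟩
        exact hg.complete l d _ hm hroot hd (by omega)
      · simp
      · intro l'
        simp only [tblTable, setReg_arr, setArr_arr, Arr.id_inj, Arr.tbl.injEq, reduceCtorEq,
          if_false]
    · exact hi

/-- A row is processed for each number, in `40 * n` steps up to a constant, and the numbers belong
to different roots, so there are at most `V` rows. The limit follows `verts` as vertices are found.
-/
theorem bfs_spec {n : ℕ} {Γ : LGraph n} {φ : ℕ → Γ.V} {V : ℕ} {σ : State}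
    (hg : RootGraph Γ φ V (trTable n σ) (σ.arr (Arr.rt (n := n)))) (hz : σ.reg Reg.zero = 0)
    (ho : σ.reg Reg.one = 1) (hn : σ.arr (Arr.num (n := n)) = fun _ => 0) :
    WP (bfs n) σ fun σ' t => (∃ i full, σ'.reg Reg.verts < i ∧
      BfsInv Γ φ V (σ.arr (Arr.rt (n := n))) (σ'.arr (Arr.root (n := n)))
        (σ'.arr (Arr.num (n := n))) (σ'.arr (Arr.parent (n := n))) (σ'.arr (Arr.letter (n := n)))
        (tblTable n σ') (σ'.reg Reg.verts) i [] full ∧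
      σ'.reg Reg.index = if full = 1 then σ'.reg Reg.verts else 0) ∧
      t ≤ (40 * n + 10) * V + 20 := by
  unfold bfs
  simp only [wp_block_cons, wp_const, wp_load, wp_store]
  simp only [setReg_reg, setReg_arr, setArr_reg, setArr_arr, Reg.num_inj, Arr.id_inj,
    reduceCtorEq, if_true, if_false, hz, ho, hn]
  refine (wp_loop (fun k σ' => ∃ i, 1 ≤ i ∧ BfsState Γ φ V (trTable n σ) (σ.arr (Arr.rt (n := n)))
    i [] σ' ∧ σ'.reg Reg.lim = σ'.reg Reg.verts + 1 ∧ k = (40 * n + 10) * (V + 1 - i))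
    (k := (40 * n + 10) * V) ?_ ⟨1, le_rfl, ⟨?_, ?_, ?_, ?_, ?_, ?_⟩, ?_, ?_⟩).mono ?_
  · rintro k σ₁ ⟨i, hi, h, hlim, rfl⟩ hb
    have hri := h.reg_i
    rw [holds_lt, hlim, hri] at hb
    have hle := h.inv.le_nodes
    simp only [wp_block_cons, wp_block_nil, wp_load]
    refine (wp_block_map (L := letters n) (fun D σ' => BfsState Γ φ V (trTable n σ)
      (σ.arr (Arr.rt (n := n))) i D σ' ∧ i ∈ Finset.Icc 1 (σ'.reg Reg.verts) ∧
      σ'.reg Reg.r = σ'.arr (Arr.root (n := n)) i) (fun _ => 20) ?_ ⟨⟨?_, ?_, ?_, ?_, ?_, ?_⟩,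
      ?_, ?_⟩).mono ?_
    · rintro D l R σ₂ - ⟨h₁, h₂, h₃⟩
      exact bfsLetter_spec hg l h₁ h₂ h₃
    iterate 8
      · (try simp only [setReg_reg, setReg_arr, Reg.num_inj, reduceCtorEq, if_true, if_false, hri]) <;>
          first
        | exact h.zero | exact h.one | exact h.rt_eq | exact h.tr | exact h.inv
        | exact Finset.mem_Icc.2 (by omega)
    rintro σ₂ t ⟨⟨h₁, h₂, h₃⟩, ht⟩
    have hri₂ := h₁.reg_i
    simp only [wp_succ]
    simp only [setReg_reg, setReg_arr, Reg.num_inj, reduceCtorEq, if_true, if_false, hri₂]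
    refine ⟨_, ⟨i + 1, by omega, ⟨?_, ?_, ?_, ?_, ?_, ?_⟩, ?_, rfl⟩, ?_⟩
    iterate 7
      · (try simp only [setReg_reg, setReg_arr, Reg.num_inj, reduceCtorEq, if_true, if_false, hri]) <;>
          first
        | exact h₁.zero | exact h₁.one | exact h₁.rt_eq | exact h₁.tr | exact h₁.inv.nextRow
    have e : V + 1 - i = (V + 1 - (i + 1)) + 1 := by omega
    rw [e, mul_add]
    simp only [List.map_const', List.sum_replicate, length_letters, smul_eq_mul] at ht
    omega
  iterate 5
    · (try simp only [setReg_reg, setReg_arr, setArr_reg, setArr_arr, Reg.num_inj, Arr.id_inj,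
      reduceCtorEq, if_true, if_false]) <;>
        first
        | exact hz | exact ho | rfl
        | (funext l; simp only [trTable, setReg_arr, setArr_arr, Arr.id_inj, reduceCtorEq,
            if_false])
  · simp only [setReg_reg, setReg_arr, setArr_reg, setArr_arr, Reg.num_inj, Arr.id_inj,
      reduceCtorEq, if_true, if_false]
    exact bfsInv_init hg _ _ (by rw [Function.update_self]) (by rw [hn]) (by rw [Function.update_self])
  · simp only [setReg_reg, setReg_arr, setArr_reg, setArr_arr, Reg.num_inj, Arr.id_inj,
      reduceCtorEq, if_true, if_false]
  · rw [Nat.add_sub_cancel]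
  rintro σ₁ t ⟨k', ⟨i, hi, h, hlim, rfl⟩, hb, ht⟩
  rw [holds_lt, hlim, h.reg_i] at hb
  have ho₁ := h.one
  simp only [wp_ite, wp_copy, wp_const, wp_block_nil, holds_eq]
  rw [ho₁]
  constructor
  · intro hf
    refine ⟨⟨i, 1, ?_⟩, by omega⟩
    have := h.inv
    rw [hf] at this
    simp only [setReg_reg, setReg_arr, Reg.num_inj, reduceCtorEq, if_true, if_false]
    exact ⟨by omega, this, trivial⟩
  · intro hf
    refine ⟨⟨i, σ₁.reg Reg.full, ?_⟩, by omega⟩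
    simp only [setReg_reg, setReg_arr, Reg.num_inj, reduceCtorEq, if_true, if_false, hf]
    exact ⟨by omega, h.inv, trivial⟩

/-! ### The result of the search -/

/-- The label of the path from the root to a vertex, if each vertex is numbered higher than its
parent. -/
noncomputable def treeWord {n : ℕ} (parent letter : ℕ → ℕ) (j : ℕ) : Word n :=
  if _h : 1 < j ∧ parent j < j then
    treeWord parent letter (parent j) ++ (letters n).filter (fun l => code l = letter j)
  else []
termination_by j
decreasing_by omega

theorem filter_code_eq {n : ℕ} (l : Letter n) :
    (letters n).filter (fun l' => code l' = code l) = [l] := by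
  simp only [code_inj]
  rw [List.filter_eq, (List.count_eq_one_of_mem (nodup_letters n) (mem_letters l))]
  rfl

theorem treeWord_eq {n : ℕ} {parent letter : ℕ → ℕ} {j : ℕ} (hj : 1 < j) (hp : parent j < j)
    {l : Letter n} (hl : letter j = code l) :
    treeWord parent letter j = treeWord parent letter (parent j) ++ [l] := by
  rw [treeWord, dif_pos ⟨hj, hp⟩, hl, filter_code_eq]

/-- The tables contain a numbering `ν` of the vertices of `Γ` from `1` to `k`, the transitions, and
a spanning tree such that `τ v` is the label of the path to `v`. -/
structure TreeTables {n : ℕ} (Γ : LGraph n) (ν : Γ.V → ℕ) (τ : Γ.V → Word n) (k : ℕ)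
    (tbl : Letter n → ℕ → ℕ) (parent letter : ℕ → ℕ) : Prop where
  inj : Function.Injective ν
  range : Set.range ν = Set.Icc 1 k
  base : ν Γ.base = 1
  step : ∀ {v l u}, Γ.Step v l u → tbl l (ν v) = ν u
  no_step : ∀ v l, (¬ ∃ u, Γ.Step v l u) → tbl l (ν v) = 0
  parent_base : parent 1 = 0
  tree : ∀ v, v ≠ Γ.base → ∃ p l, Γ.Step p l v ∧ parent (ν v) = ν p ∧ letter (ν v) = code l ∧
    τ v = τ p ++ [l] ∧ ν p < ν v
  geo : GeodesicTree Γ τ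

/-- The numbered vertices contain the base and are closed under transitions, so connectedness of `Γ`
makes them all vertices. The remaining point is that the tree is geodesic, which rests on the
monotonicity of the parents. -/
theorem BfsInv.treeTables {n : ℕ} {J : List (Word n)} {Γ : LGraph n} (hf : Γ.IsFolded)
    (hc : Carries J Γ) {φ : ℕ → Γ.V} {V : ℕ} {T : Letter n → ℕ → ℕ}
    {rt root num parent letter : ℕ → ℕ} (hg : RootGraph Γ φ V T rt) {tbl : Letter n → ℕ → ℕ}
    {k i full : ℕ} (h : BfsInv Γ φ V rt root num parent letter tbl k i [] full) (hi : k < i) :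
    ∃ ν τ, TreeTables Γ ν τ k tbl parent letter ∧ (full = 1 ↔ ∀ v l, ∃ u, Γ.Step v l u) := by
  have hS := hf.isInverse
  have hinj : ∀ j ∈ Finset.Icc 1 k, ∀ j' ∈ Finset.Icc 1 k, φ (root j) = φ (root j') → j = j' := by
    intro j hj j' hj' he
    obtain ⟨h₁, h₂, h₃⟩ := h.root_mem j hj
    obtain ⟨h₁', h₂', h₃'⟩ := h.root_mem j' hj'
    have := hg.rt_iff _ h₁ _ h₁' he
    rw [h₂, h₂'] at this
    rw [← h₃, this, h₃']
  have hone : 1 ∈ Finset.Icc 1 k := Finset.mem_Icc.2 ⟨le_rfl, h.pos⟩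
  have hbase : φ (root 1) = Γ.base := by
    rw [h.root_one, hg.rt_eq 1 (Finset.mem_Icc.2 ⟨le_rfl, hg.pos⟩), hg.base]
  have hentry : ∀ j ∈ Finset.Icc 1 k, ∀ l, BfsEntry Γ φ root parent k j l (tbl l j) := by
    intro j hj l
    rw [Finset.mem_Icc] at hj
    exact h.table j l hj.1 (Or.inl (by omega))
  have hclosed : ∀ j ∈ Finset.Icc 1 k, ∀ l u, Γ.Step (φ (root j)) l u →
      tbl l j ∈ Finset.Icc 1 k ∧ φ (root (tbl l j)) = u ∧ parent (tbl l j) ≤ j := by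
    intro j hj l u hu
    rcases hentry j hj l with ⟨h₁, h₂, h₃⟩ | ⟨_, h₂⟩
    · exact ⟨h₁, hS.det h₂ hu, h₃⟩
    · exact absurd ⟨u, hu⟩ h₂
  have hpath : ∀ (w : Word n), ∀ j ∈ Finset.Icc 1 k, ∀ v, PathIn Γ.Step (φ (root j)) w v →
      ∃ j' ∈ Finset.Icc 1 k, φ (root j') = v := by
    intro w
    induction w with
    | nil => exact fun j hj v hv => ⟨j, hj, hv⟩
    | cons l w ih =>
      rintro j hj v ⟨u, hu, hv⟩
      obtain ⟨h₁, h₂, -⟩ := hclosed j hj l u hu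
      exact ih _ h₁ v (h₂ ▸ hv)
  have hsurj : ∀ v, ∃ j ∈ Finset.Icc 1 k, φ (root j) = v := by
    intro v
    obtain ⟨w, hw⟩ := hc.conn v
    exact hpath w 1 hone v (hbase ▸ hw)
  choose ν hν hφν using hsurj
  have hν' : ∀ j ∈ Finset.Icc 1 k, ν (φ (root j)) = j := fun j hj => hinj _ (hν _) _ hj (hφν _)
  have hνb : ν Γ.base = 1 := by rw [← hbase, hν' 1 hone]
  have hν1 : ∀ v, v ≠ Γ.base → ν v ∈ Finset.Icc 2 k := by
    intro v hv
    have h₁ := Finset.mem_Icc.1 (hν v)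
    have : ν v ≠ 1 := fun he => hv (by rw [← hφν v, he, hbase])
    exact Finset.mem_Icc.2 (by omega)
  set τ : Γ.V → Word n := fun v => treeWord parent letter (ν v) with hτ
  have htree : ∀ v, v ≠ Γ.base → ∃ p l, Γ.Step p l v ∧ parent (ν v) = ν p ∧
      letter (ν v) = code l ∧ τ v = τ p ++ [l] ∧ ν p < ν v := by
    intro v hv
    have hm := hν1 v hv
    obtain ⟨h₁, h₂, -, l, h₃, h₄⟩ := h.tree _ hm
    rw [Finset.mem_Icc] at hm
    have hp : parent (ν v) = ν (φ (root (parent (ν v)))) :=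
      (hν' _ (Finset.mem_Icc.2 (by omega))).symm
    rw [hφν v] at h₄
    refine ⟨_, l, h₄, hp, h₃, ?_, hp ▸ h₂⟩
    rw [hτ]
    simp only
    rw [treeWord_eq (by omega) h₂ h₃, ← hp]
  -- Depth does not decrease with the number: both vertices are one step deeper than their parents,
  -- and the parents are ordered in the same way.
  have hdepth : ∀ j' ≤ k, ∀ j, 1 ≤ j → j ≤ j' → (treeWord (n := n) parent letter j).length ≤
      (treeWord (n := n) parent letter j').length := by
    intro j'
    induction j' using Nat.strong_induction_on with
    | _ j' ih =>
      intro hj' j hj hjj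
      by_cases h1 : j = 1
      · rw [h1, treeWord, dif_neg (by omega)]
        simp
      · obtain ⟨h₁, h₂, -, l, h₃, -⟩ := h.tree j (Finset.mem_Icc.2 (by omega))
        obtain ⟨h₁', h₂', -, l', h₃', -⟩ := h.tree j' (Finset.mem_Icc.2 (by omega))
        rw [treeWord_eq (by omega) h₂ h₃, treeWord_eq (by omega) h₂' h₃', List.length_append,
          List.length_append, List.length_singleton, List.length_singleton]
        exact Nat.add_le_add_right
          (ih _ h₂' (by omega) _ h₁ (h.mono j j' (by omega) hjj hj')) 1
  refine ⟨ν, τ, ⟨?_, ?_, hνb, ?_, ?_, h.parent_one, htree, ⟨hf, ?_, ?_, ?_⟩⟩, ?_⟩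
  · intro v u he
    rw [← hφν v, he, hφν u]
  · ext j
    constructor
    · rintro ⟨v, rfl⟩
      exact Finset.mem_Icc.1 (hν v)
    · intro hj
      exact ⟨_, hν' j (Finset.mem_Icc.2 hj)⟩
  · intro v l u hu
    rw [← hφν v] at hu
    obtain ⟨h₁, h₂, -⟩ := hclosed _ (hν v) l u hu
    rw [← h₂, hν' _ h₁]
  · intro v l hn
    rcases hentry _ (hν v) l with ⟨_, h₂, _⟩ | ⟨h₁, _⟩
    · rw [hφν v] at h₂
      exact absurd ⟨_, h₂⟩ hn
    · exact h₁
  · rw [hτ]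
    simp only
    rw [hνb, treeWord, dif_neg (by omega)]
  · intro v hv
    obtain ⟨p, l, h₁, -, -, h₂, -⟩ := htree v hv
    exact ⟨p, l, h₁, h₂⟩
  · intro v l u hu
    by_cases hub : u = Γ.base
    · rw [hub, hτ]
      simp only
      rw [hνb, treeWord, dif_neg (by omega)]
      simp
    · have hum := hν1 u hub
      obtain ⟨h₁, h₂, -, l', h₃, -⟩ := h.tree _ hum
      -- When the row of `v` was completed, `u` had already been found, from `v` or from an earlier
      -- vertex. So its depth is at most one more than that of `v`.
      have hle : parent (ν u) ≤ ν v := by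
        rw [← hφν v] at hu
        obtain ⟨h₁, h₂, h₃⟩ := hclosed _ (hν v) l u hu
        rwa [← h₂, hν' _ h₁]
      rw [Finset.mem_Icc] at hum
      rw [hτ]
      simp only
      rw [treeWord_eq (by omega) h₂ h₃, List.length_append, List.length_singleton]
      exact Nat.add_le_add_right (hdepth _ (Finset.mem_Icc.1 (hν v)).2 _ h₁ hle) 1
  · rw [h.full_iff]
    constructor
    · intro h' v l
      have h₁ := Finset.mem_Icc.1 (hν v)
      have := h' (ν v) l h₁.1 (Or.inl (by omega))
      rwa [hφν v] at this
    · intro h' j l _ _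
      exact h' _ l

theorem bfsLetter_keepsReg {n : ℕ} {l : Letter n} {r : Reg}
    (h : r ≠ .p ∧ r ≠ .q ∧ r ≠ .k ∧ r ≠ .verts ∧ r ≠ .full) : (bfsLetter l).KeepsReg r := by
  simp [bfsLetter, Cmd.KeepsReg, h]

theorem bfs_keepsReg {n : ℕ} {r : Reg} (h : r ≠ .p ∧ r ≠ .q ∧ r ≠ .k ∧ r ≠ .verts ∧ r ≠ .full ∧
    r ≠ .x ∧ r ≠ .i ∧ r ≠ .lim ∧ r ≠ .r ∧ r ≠ .index) : (bfs n).KeepsReg r := by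
  have : (block ((letters n).map bfsLetter)).KeepsReg r := by
    rw [keepsReg_block_map]
    exact fun l _ => bfsLetter_keepsReg ⟨h.1, h.2.1, h.2.2.1, h.2.2.2.1, h.2.2.2.2.1⟩
  unfold bfs
  rw [keepsReg_block]
  simp only [List.forall_mem_cons, Cmd.KeepsReg, keepsReg_block, ne_eq, Reg.num_inj]
  simp [h, Cmd.KeepsReg]
  simpa using this

/-! ### The table of inverse letters -/

/-- Store the codes of the inverses of all letters. -/
noncomputable def fillInv (n : ℕ) : Cmd := block ((letters n).map fun l => block [
  .const Reg.c (code l), .const Reg.k (code (linv l)), .store (Arr.inv (n := n)) Reg.c Reg.k])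

theorem fillInv_spec {n : ℕ} (σ : State) : WP (fillInv n) σ fun σ' t =>
    (∀ l : Letter n, σ'.arr (Arr.inv (n := n)) (code l) = code (linv l)) ∧ t ≤ 8 * n + 1 := by
  refine (wp_block_map (L := letters n) (fun D σ' => ∀ l ∈ D,
    σ'.arr (Arr.inv (n := n)) (code l) = code (linv l)) (fun _ => 4) ?_ (by simp)).mono ?_
  · rintro D l R σ' - h
    simp only [wp_block_cons, wp_block_nil, wp_const, wp_store]
    simp only [setReg_reg, setReg_arr, setArr_arr, Reg.num_inj, reduceCtorEq, if_true, if_false]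
    refine ⟨fun l' hl' => ?_, by omega⟩
    by_cases he : l' = l
    · rw [he, Function.update_self]
    · rw [Function.update_of_ne (by simpa using he)]
      exact h l' (by simpa [he] using hl')
  · rintro σ' t ⟨h, ht⟩
    simp only [List.map_const', List.sum_replicate, length_letters, smul_eq_mul] at ht
    exact ⟨fun l => h l (mem_letters l), by omega⟩

theorem fillInv_keepsReg {n : ℕ} {r : Reg} (h : r ≠ .c ∧ r ≠ .k) : (fillInv n).KeepsReg r := by
  unfold fillInv
  rw [keepsReg_block_map]
  intro l _
  simp [Cmd.KeepsReg, h]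

theorem fillInv_keepsArr {n : ℕ} {a : Arr n} (h : a ≠ .inv) : (fillInv n).KeepsArr a := by
  unfold fillInv
  rw [keepsArr_block_map]
  intro l _
  simp [Cmd.KeepsArr, h]

/-! ### Writing the basis -/

/-- The list `L` has been written to the array `basis`, and `o` points behind it. -/
structure Written (n : ℕ) (L : List ℕ) (σ : State) : Prop where
  o : σ.reg Reg.o = L.length
  basis : ∀ j < L.length, σ.arr (Arr.basis (n := n)) j = L.getD j 0

theorem Written.push {n : ℕ} {L : List ℕ} {σ σ' : State} (h : Written n L σ) {v : ℕ}
    (ho : σ'.reg Reg.o = σ.reg Reg.o + 1) (hb : σ'.arr (Arr.basis (n := n)) =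
      Function.update (σ.arr (Arr.basis (n := n))) (σ.reg Reg.o) v) : Written n (L ++ [v]) σ' := by
  refine ⟨by rw [ho, h.o]; simp, fun j hj => ?_⟩
  rw [hb, h.o]
  rw [List.length_append, List.length_singleton] at hj
  by_cases he : j = L.length
  · subst he
    rw [Function.update_self]
    exact (getD_append_length L [v] 0 0).symm
  · rw [Function.update_of_ne he, h.basis j (by omega),
      List.getD_append _ _ _ _ (by omega)]

theorem Written.congr {n : ℕ} {L : List ℕ} {σ σ' : State} (h : Written n L σ)
    (ho : σ'.reg Reg.o = σ.reg Reg.o) (hb : σ'.arr (Arr.basis (n := n)) =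
      σ.arr (Arr.basis (n := n))) : Written n L σ' :=
  ⟨ho.trans h.o, fun j hj => by rw [hb]; exact h.basis j hj⟩

/-- Append the number in a register to the output. -/
def emitReg (n : ℕ) (r : Reg) : Cmd :=
  block [.store (Arr.basis (n := n)) Reg.o r, .succ Reg.o Reg.o]

/-- Write the word of the loop through the edge from `i` to `q` with label `l`. -/
def emit {n : ℕ} (l : Letter n) : Cmd := block [
  .copy Reg.x Reg.i,
  .loop (.lt Reg.one Reg.x) (block [.load Reg.y (Arr.parent (n := n)) Reg.x,
    .store (Arr.nxt (n := n)) Reg.y Reg.x, .copy Reg.x Reg.y]),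
  .loop (.lt Reg.x Reg.i) (block [.load Reg.x (Arr.nxt (n := n)) Reg.x,
    .load Reg.c (Arr.letter (n := n)) Reg.x, emitReg n .c]),
  .const Reg.c (code l), emitReg n .c, .copy Reg.x Reg.q,
  .loop (.lt Reg.one Reg.x) (block [.load Reg.c (Arr.letter (n := n)) Reg.x,
    .load Reg.c (Arr.inv (n := n)) Reg.c, emitReg n .c,
    .load Reg.x (Arr.parent (n := n)) Reg.x]),
  emitReg n .zero, .succ Reg.rank Reg.rank]

/-- The pointers `nxt` lead from a vertex to a child. -/
def NextStep {n : ℕ} {V : Type} (ν : V → ℕ) (nxt letter : ℕ → ℕ) (v : V) (l : Letter n) (u : V) :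
    Prop :=
  nxt (ν v) = ν u ∧ letter (ν u) = code l ∧ ν v < ν u

/-- Numbers grow along the pointers. Hence the descent, which runs while the current number is below
that of `v`, stops exactly at `v`. -/
theorem NextStep.path_le {n : ℕ} {V : Type} {ν : V → ℕ} {nxt letter : ℕ → ℕ} {s : Word n} {v u : V}
    (h : PathIn (NextStep ν nxt letter) v s u) : ν v + s.length ≤ ν u := by
  induction s generalizing v with
  | nil =>
    obtain rfl : v = u := h
    simp
  | cons l s ih =>
    obtain ⟨x, hx, h⟩ := h
    have h₁ := ih h
    have h₂ := hx.2.2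
    rw [List.length_cons]
    omega

/-- While climbing, pointers are written at ever smaller numbers, so the part of the path recorded
before is not damaged, whatever older words have left in the array. -/
theorem NextStep.path_update {n : ℕ} {V : Type} {ν : V → ℕ} {nxt letter : ℕ → ℕ} {s : Word n}
    {v u : V} (h : PathIn (NextStep ν nxt letter) v s u) {a b : ℕ} (ha : a < ν v) :
    PathIn (NextStep ν (Function.update nxt a b) letter) v s u := by
  induction s generalizing v with
  | nil => exact h
  | cons l s ih =>
    obtain ⟨x, hx, h⟩ := h
    refine ⟨x, ⟨?_, hx.2⟩, ih h (by have := hx.2.2; omega)⟩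
    rw [Function.update_of_ne (by omega)]
    exact hx.1

theorem TreeTables.one_lt_iff {n : ℕ} {Γ : LGraph n} {ν : Γ.V → ℕ} {τ : Γ.V → Word n} {k : ℕ}
    {tbl : Letter n → ℕ → ℕ} {parent letter : ℕ → ℕ}
    (h : TreeTables Γ ν τ k tbl parent letter) {v : Γ.V} : 1 < ν v ↔ v ≠ Γ.base := by
  have h₁ : ν v ∈ Set.Icc 1 k := h.range ▸ ⟨v, rfl⟩
  rw [Set.mem_Icc] at h₁
  rw [← h.inj.ne_iff, h.base]
  omega

/-- Parents are known but children are not, so the label from the root to `v` has to be read by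
first reversing the pointers on the path. The inverse of the label to `u` comes in the right order
by climbing. Each letter costs a bounded number of steps. -/
theorem emit_spec {n : ℕ} {Γ : LGraph n} {ν : Γ.V → ℕ} {τ : Γ.V → Word n} {k : ℕ} {σ : State}
    (h : TreeTables Γ ν τ k (tblTable n σ) (σ.arr (Arr.parent (n := n)))
      (σ.arr (Arr.letter (n := n)))) (hz : σ.reg Reg.zero = 0) (ho : σ.reg Reg.one = 1)
    (hinv : ∀ l : Letter n, σ.arr (Arr.inv (n := n)) (code l) = code (linv l)) {v u : Γ.V}
    (hv : σ.reg Reg.i = ν v) (hu : σ.reg Reg.q = ν u) {L : List ℕ} (hL : Written n L σ)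
    (a : Fin n) :
    WP (emit (a, true)) σ fun σ' t => Written n (L ++ encodeWord (cotreeWord τ (v, a, u))) σ' ∧
      σ'.reg Reg.rank = σ.reg Reg.rank + 1 ∧ t ≤ 12 * (cotreeWord τ (v, a, u)).length + 20 := by
  set P := σ.arr (Arr.parent (n := n)) with hP
  set Q := σ.arr (Arr.letter (n := n)) with hQ
  unfold emit
  rw [wp_block_cons, wp_copy, wp_block_cons]
  -- climbing from `v`
  refine (wp_loop (fun c σ' => ∃ x s, σ'.reg Reg.one = 1 ∧ σ'.arr (Arr.parent (n := n)) = P ∧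
    σ'.reg Reg.x = ν x ∧ τ v = τ x ++ s ∧
    PathIn (NextStep ν (σ'.arr (Arr.nxt (n := n))) Q) x s v ∧ c = 5 * (τ x).length) ?_
    ⟨v, [], ?_, ?_, ?_, ?_, ?_, rfl⟩).frame.mono ?_
  · rintro c σ' ⟨x, s, h₁, h₂, h₃, h₄, h₅, rfl⟩ hb
    rw [holds_lt, h₁, h₃, h.one_lt_iff] at hb
    obtain ⟨p, l, hs, hp, hl, hτ, hlt⟩ := h.tree x hb
    simp only [wp_block_cons, wp_block_nil, wp_load, wp_store, wp_copy]
    simp only [setReg_reg, setReg_arr, setArr_reg, setArr_arr, Reg.num_inj, Arr.id_inj,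
      reduceCtorEq, if_true, if_false, h₂, h₃, hp]
    refine ⟨_, ⟨p, l :: s, ?_, ?_, ?_, ?_, ?_, rfl⟩, ?_⟩
    rotate_right
    · rw [hτ, List.length_append, List.length_singleton]
      omega
    all_goals try simp only [setReg_reg, setReg_arr, setArr_reg, setArr_arr, Reg.num_inj,
      Arr.id_inj, reduceCtorEq, if_true, if_false, h₂, h₃, hp]
    · exact h₁
    · rw [h₄, hτ, List.append_assoc]
      rfl
    · exact ⟨x, ⟨by rw [Function.update_self], hl, hlt⟩, NextStep.path_update h₅ hlt⟩
  all_goals try simp only [setReg_reg, setReg_arr, Reg.num_inj, reduceCtorEq, if_true, if_false]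
  · exact ho
  · rfl
  · exact hv
  · simp
  · rfl
  rintro σ₁ t₁ ⟨⟨c₁, ⟨x, s, h₁, h₂, h₃, h₄, h₅, rfl⟩, hb, ht₁⟩, hfr⟩
  rw [holds_lt, h₁, h₃, h.one_lt_iff, not_not] at hb
  subst hb
  rw [h.geo.base, List.nil_append] at h₄
  subst h₄
  have f₁ := hfr.reg Reg.i (by simp [Cmd.KeepsReg])
  have f₂ := hfr.reg Reg.q (by simp [Cmd.KeepsReg])
  have f₃ := hfr.reg Reg.zero (by simp [Cmd.KeepsReg])
  have f₄ := hfr.reg Reg.rank (by simp [Cmd.KeepsReg])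
  have f₅ := hfr.reg Reg.o (by simp [Cmd.KeepsReg])
  have f₆ := hfr.arr (Arr.letter (n := n)) (by simp [Cmd.KeepsArr])
  have f₇ := hfr.arr (Arr.inv (n := n)) (by simp [Cmd.KeepsArr])
  have f₈ := hfr.arr (Arr.basis (n := n)) (by simp [Cmd.KeepsArr])
  simp only [setReg_reg, setReg_arr, Reg.num_inj, reduceCtorEq, if_false] at f₁ f₂ f₃ f₄ f₅ f₆ f₇ f₈
  rw [← hQ] at f₆
  have hL₁ := hL.congr f₅ f₈
  rw [wp_block_cons]
  -- writing `τ v`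
  refine (wp_loop (fun c σ' => ∃ x p s, σ'.reg Reg.i = ν v ∧
    σ'.arr (Arr.letter (n := n)) = Q ∧ σ'.arr (Arr.nxt (n := n)) = σ₁.arr (Arr.nxt (n := n)) ∧
    σ'.reg Reg.x = ν x ∧ τ v = p ++ s ∧ Written n (L ++ p.map code) σ' ∧
    PathIn (NextStep ν (σ₁.arr (Arr.nxt (n := n))) Q) x s v ∧ c = 7 * s.length) ?_
    ⟨Γ.base, [], τ v, f₁.trans hv, f₆, rfl, h₃, rfl, by simpa using hL₁, h₅, rfl⟩).frame.mono ?_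
  · rintro c σ' ⟨x, p, s, g₁, g₂, g₃, g₄, g₅, g₆, g₇, rfl⟩ hb
    rw [holds_lt, g₁, g₄] at hb
    cases s with
    | nil =>
      obtain rfl : x = v := g₇
      omega
    | cons l s =>
      obtain ⟨y, ⟨hy₁, hy₂, hy₃⟩, g₇⟩ := g₇
      simp only [emitReg, wp_block_cons, wp_block_nil, wp_load, wp_store, wp_succ]
      simp only [setReg_reg, setReg_arr, setArr_reg, setArr_arr, Reg.num_inj, Arr.id_inj,
        reduceCtorEq, if_true, if_false, g₂, g₃, g₄, hy₁, hy₂]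
      refine ⟨_, ⟨y, p ++ [l], s, ?_, ?_, ?_, ?_, ?_, ?_, g₇, rfl⟩, ?_⟩
      rotate_right
      · rw [List.length_cons]
        omega
      rotate_right
      · rw [List.map_append, ← List.append_assoc]
        refine g₆.push ?_ ?_
        all_goals simp only [setReg_reg, setReg_arr, setArr_reg, setArr_arr, Reg.num_inj,
          Arr.id_inj, reduceCtorEq, if_true, if_false]
      all_goals try simp only [setReg_reg, setReg_arr, setArr_reg, setArr_arr, Reg.num_inj,
        Arr.id_inj, reduceCtorEq, if_true, if_false]
      · exact g₁
      · rw [g₅, List.append_assoc]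
        rfl
  rintro σ₂ t₂ ⟨⟨c₂, ⟨x, p, s, g₁, g₂, g₃, g₄, g₅, g₆, g₇, rfl⟩, hb, ht₂⟩, hfr₂⟩
  rw [holds_lt, g₁, g₄] at hb
  have hs : s = [] := by
    have := NextStep.path_le g₇
    exact List.length_eq_zero_iff.1 (by omega)
  rw [hs, List.append_nil] at g₅
  rw [← g₅] at g₆
  clear g₃ g₅ g₇ hb hs
  have e₁ := hfr₂.reg Reg.one (by simp [Cmd.KeepsReg, emitReg])
  have e₂ := hfr₂.reg Reg.q (by simp [Cmd.KeepsReg, emitReg])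
  have e₃ := hfr₂.reg Reg.zero (by simp [Cmd.KeepsReg, emitReg])
  have e₄ := hfr₂.reg Reg.rank (by simp [Cmd.KeepsReg, emitReg])
  have e₅ := hfr₂.arr (Arr.parent (n := n)) (by simp [Cmd.KeepsArr, emitReg])
  have e₇ := hfr₂.arr (Arr.inv (n := n)) (by simp [Cmd.KeepsArr, emitReg])
  rw [h₁] at e₁
  rw [f₂, hu] at e₂
  rw [f₃, hz] at e₃
  rw [f₄] at e₄
  rw [h₂] at e₅
  rw [f₇] at e₇
  simp only [emitReg, wp_block_cons, wp_block_nil, wp_const, wp_store, wp_succ, wp_copy]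
  -- climbing from `u`
  refine (wp_loop (fun c σ' => ∃ x p, σ'.reg Reg.one = 1 ∧ σ'.arr (Arr.parent (n := n)) = P ∧
    σ'.arr (Arr.letter (n := n)) = Q ∧ σ'.arr (Arr.inv (n := n)) = σ.arr (Arr.inv (n := n)) ∧
    σ'.reg Reg.x = ν x ∧ FreeGroup.invRev (τ u) = p ++ FreeGroup.invRev (τ x) ∧
    Written n (L ++ (τ v ++ (a, true) :: p).map code) σ' ∧ c = 8 * (τ x).length) ?_
    ⟨u, [], ?_, ?_, ?_, ?_, ?_, ?_, ?_, rfl⟩).frame.mono ?_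
  · rintro c σ' ⟨x, p, k₁, k₂, k₃, k₄, k₅, k₆, k₇, rfl⟩ hb
    rw [holds_lt, k₁, k₅, h.one_lt_iff] at hb
    obtain ⟨y, l, hs, hp, hl, hτ, hlt⟩ := h.tree x hb
    simp only [wp_block_cons, wp_block_nil, wp_load, wp_store, wp_succ]
    simp only [setReg_reg, setReg_arr, setArr_reg, setArr_arr, Reg.num_inj, Arr.id_inj,
      reduceCtorEq, if_true, if_false, k₂, k₃, k₄, k₅, hp, hl, hinv]
    refine ⟨_, ⟨y, p ++ [linv l], ?_, ?_, ?_, ?_, ?_, ?_, ?_, rfl⟩, ?_⟩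
    rotate_right
    · rw [hτ, List.length_append, List.length_singleton]
      omega
    rotate_right
    · have : L ++ (τ v ++ (a, true) :: (p ++ [linv l])).map code =
          (L ++ (τ v ++ (a, true) :: p).map code) ++ [code (linv l)] := by simp
      rw [this]
      refine k₇.push ?_ ?_
      all_goals simp only [setReg_reg, setReg_arr, setArr_reg, setArr_arr, Reg.num_inj,
        Arr.id_inj, reduceCtorEq, if_true, if_false]
    all_goals try simp only [setReg_reg, setReg_arr, setArr_reg, setArr_arr, Reg.num_inj,
      Arr.id_inj, reduceCtorEq, if_true, if_false]
    · exact k₁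
    · rw [k₆, hτ]
      simp [FreeGroup.invRev, linv]
  rotate_right
  rotate_right
  · have : L ++ (τ v ++ [(a, true)]).map code = (L ++ (τ v).map code) ++ [code (a, true)] := by simp
    rw [this]
    refine g₆.push ?_ ?_
    all_goals simp only [setReg_reg, setReg_arr, setArr_reg, setArr_arr, Reg.num_inj,
        Arr.id_inj, reduceCtorEq, if_true, if_false]
  rotate_right 6
  all_goals try simp only [setReg_reg, setReg_arr, setArr_reg, setArr_arr, Reg.num_inj, Arr.id_inj,
    reduceCtorEq, if_true, if_false]
  · exact e₁
  · exact e₅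
  · exact g₂
  · exact e₇
  · exact e₂
  · simp
  rintro σ₃ t₃ ⟨⟨c₃, ⟨x, p, k₁, k₂, k₃, k₄, k₅, k₆, k₇, rfl⟩, hb, ht₃⟩, hfr₃⟩
  rw [holds_lt, k₁, k₅, h.one_lt_iff, not_not] at hb
  subst hb
  rw [h.geo.base, FreeGroup.invRev_empty, List.append_nil] at k₆
  have d₃ := hfr₃.reg Reg.zero (by simp [Cmd.KeepsReg])
  have d₄ := hfr₃.reg Reg.rank (by simp [Cmd.KeepsReg])
  simp only [setReg_reg, setReg_arr, setArr_reg, setArr_arr, Reg.num_inj, Arr.id_inj,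
    reduceCtorEq, if_true, if_false] at d₃ d₄
  rw [e₃] at d₃
  rw [e₄] at d₄
  refine ⟨?_, by rw [d₄], ?_⟩
  · have : L ++ encodeWord (cotreeWord τ (v, a, u)) =
        (L ++ (τ v ++ (a, true) :: p).map code) ++ [0] := by
      simp [encodeWord, cotreeWord, k₆]
    rw [this]
    refine k₇.push ?_ ?_
    all_goals simp only [setReg_reg, setReg_arr, setArr_reg, setArr_arr, Reg.num_inj,
        Arr.id_inj, reduceCtorEq, if_true, if_false, d₃]
  · simp only [cotreeWord, List.length_append, List.length_cons, FreeGroup.invRev_length]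
    omega

theorem emit_keepsReg {n : ℕ} {l : Letter n} {r : Reg}
    (h : r ≠ .x ∧ r ≠ .y ∧ r ≠ .c ∧ r ≠ .o ∧ r ≠ .rank) : (emit l).KeepsReg r := by
  simp [emit, emitReg, Cmd.KeepsReg, h]

theorem emit_keepsArr {n : ℕ} {l : Letter n} {a : Arr n} (h : a ≠ .nxt ∧ a ≠ .basis) :
    (emit l).KeepsArr a := by
  simp [emit, emitReg, Cmd.KeepsArr, h]

/-- Set `f` to `0` if there is an edge with label `a` at the vertex in the register `i` that is not in
the tree, and to `1` otherwise. -/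
def testEdge {n : ℕ} (a : Fin n) : Cmd := block [
  .load Reg.q (Arr.tbl (a, true)) Reg.i, .const Reg.f 1,
  .ite (.lt Reg.zero Reg.q) (block [
    .const Reg.f 0,
    .load Reg.p (Arr.parent (n := n)) Reg.q, .load Reg.c (Arr.letter (n := n)) Reg.q,
    .const Reg.k (code (a, true)),
    .ite (.eq Reg.p Reg.i) (.ite (.eq Reg.c Reg.k) (.const Reg.f 1) .skip) .skip,
    .load Reg.p (Arr.parent (n := n)) Reg.i, .load Reg.c (Arr.letter (n := n)) Reg.i,
    .const Reg.k (code (a, false)),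
    .ite (.eq Reg.p Reg.q) (.ite (.eq Reg.c Reg.k) (.const Reg.f 1) .skip) .skip]) .skip]

/-- Write the basis element that belongs to the edge with label `a` at the vertex in the register
`i`, if there is one outside the tree. -/
def emitEdge {n : ℕ} (a : Fin n) : Cmd := block [
  testEdge a, .ite (.eq Reg.f Reg.zero) (emit (a, true)) .skip]

/-- Write the basis. -/
noncomputable def writeBasis (n : ℕ) : Cmd := block [
  fillInv n, .const Reg.rank 0, .const Reg.o 0, .const Reg.i 1, .succ Reg.lim Reg.verts,
  .loop (.lt Reg.i Reg.lim) (block [block ((List.finRange n).map emitEdge), .succ Reg.i Reg.i])]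

/-! ### Listing the edges outside the tree. -/

open Classical in
/-- The edge with label `a` at `v`, if it is not in the tree. -/
noncomputable def edgeAt {n : ℕ} (Γ : LGraph n) (τ : Γ.V → Word n) (v : Γ.V) (a : Fin n) :
    List (Γ.V × Fin n × Γ.V) :=
  if h : ∃ u, Γ.Step v (a, true) u ∧ ¬ IsTreeEdge τ v (a, true) u then [(v, a, h.choose)] else []

theorem mem_edgeAt {n : ℕ} {Γ : LGraph n} (hf : Γ.IsFolded) {τ : Γ.V → Word n} {v w u : Γ.V}
    {a b : Fin n} : (w, b, u) ∈ edgeAt Γ τ v a ↔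
      w = v ∧ b = a ∧ Γ.Step w (b, true) u ∧ ¬ IsTreeEdge τ w (b, true) u := by
  unfold edgeAt
  split_ifs with h
  · simp only [List.mem_singleton, Prod.mk.injEq]
    constructor
    · rintro ⟨rfl, rfl, rfl⟩
      exact ⟨rfl, rfl, h.choose_spec⟩
    · rintro ⟨rfl, rfl, h₁, h₂⟩
      exact ⟨rfl, rfl, hf.isInverse.det h₁ h.choose_spec.1⟩
  · simp only [List.not_mem_nil, false_iff]
    rintro ⟨rfl, rfl, h'⟩
    exact h ⟨u, h'⟩

theorem edgeAt_eq {n : ℕ} {Γ : LGraph n} (hf : Γ.IsFolded) {τ : Γ.V → Word n} {v u : Γ.V}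
    {a : Fin n} (h : Γ.Step v (a, true) u) (ht : ¬ IsTreeEdge τ v (a, true) u) :
    edgeAt Γ τ v a = [(v, a, u)] := by
  have h' : ∃ u, Γ.Step v (a, true) u ∧ ¬ IsTreeEdge τ v (a, true) u := ⟨u, h, ht⟩
  unfold edgeAt
  rw [dif_pos h', hf.isInverse.det h h'.choose_spec.1]

theorem edgeAt_eq_nil {n : ℕ} {Γ : LGraph n} {τ : Γ.V → Word n} {v : Γ.V} {a : Fin n}
    (h : ∀ u, Γ.Step v (a, true) u → IsTreeEdge τ v (a, true) u) : edgeAt Γ τ v a = [] := by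
  unfold edgeAt
  rw [dif_neg]
  rintro ⟨u, h₁, h₂⟩
  exact h₂ (h u h₁)

theorem nodup_edgeAt {n : ℕ} {Γ : LGraph n} {τ : Γ.V → Word n} {v : Γ.V} {a : Fin n} :
    (edgeAt Γ τ v a).Nodup := by
  unfold edgeAt
  split_ifs <;> simp

/-- The edges outside the tree that begin in one of the vertices in a list. -/
noncomputable def edgesFrom {n : ℕ} (Γ : LGraph n) (τ : Γ.V → Word n) (A : List Γ.V) :
    List (Γ.V × Fin n × Γ.V) :=
  A.flatMap fun v => (List.finRange n).flatMap (edgeAt Γ τ v)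

theorem mem_edgesFrom {n : ℕ} {Γ : LGraph n} (hf : Γ.IsFolded) {τ : Γ.V → Word n} {A : List Γ.V}
    {v u : Γ.V} {a : Fin n} : (v, a, u) ∈ edgesFrom Γ τ A ↔
      v ∈ A ∧ Γ.Step v (a, true) u ∧ ¬ IsTreeEdge τ v (a, true) u := by
  simp only [edgesFrom, List.mem_flatMap, List.mem_finRange, true_and, mem_edgeAt hf]
  constructor
  · rintro ⟨w, hw, b, rfl, rfl, h⟩
    exact ⟨hw, h⟩
  · rintro ⟨hw, h⟩
    exact ⟨v, hw, a, rfl, rfl, h⟩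

theorem nodup_edgesFrom {n : ℕ} {Γ : LGraph n} (hf : Γ.IsFolded) {τ : Γ.V → Word n} {A : List Γ.V}
    (hA : A.Nodup) : (edgesFrom Γ τ A).Nodup := by
  unfold edgesFrom
  rw [List.nodup_flatMap]
  constructor
  · intro v _
    rw [List.nodup_flatMap]
    refine ⟨fun a _ => nodup_edgeAt, (List.nodup_finRange n).pairwise_of_forall_ne ?_⟩
    rintro a - b - hab ⟨v', c, u⟩ h₁ h₂
    rw [mem_edgeAt hf] at h₁ h₂
    exact hab (h₁.2.1.symm.trans h₂.2.1)
  · refine hA.pairwise_of_forall_ne ?_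
    rintro v - w - hvw ⟨v', c, u⟩ h₁ h₂
    simp only [List.mem_flatMap, mem_edgeAt hf] at h₁ h₂
    obtain ⟨_, _, h₁, _⟩ := h₁
    obtain ⟨_, _, h₂, _⟩ := h₂
    exact hvw (h₁.symm.trans h₂)

theorem TreeTables.pos {n : ℕ} {Γ : LGraph n} {ν : Γ.V → ℕ} {τ : Γ.V → Word n} {k : ℕ}
    {tbl : Letter n → ℕ → ℕ} {parent letter : ℕ → ℕ}
    (h : TreeTables Γ ν τ k tbl parent letter) (v : Γ.V) : 1 ≤ ν v :=
  (show ν v ∈ Set.Icc 1 k from h.range ▸ ⟨v, rfl⟩).1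

/-- Makes membership of an edge in the tree a comparison of two table entries. At the base both
sides fail: its label is empty, and its parent entry `0` is not the number of a vertex. -/
theorem TreeTables.child_iff {n : ℕ} {Γ : LGraph n} {ν : Γ.V → ℕ} {τ : Γ.V → Word n} {k : ℕ}
    {tbl : Letter n → ℕ → ℕ} {parent letter : ℕ → ℕ}
    (h : TreeTables Γ ν τ k tbl parent letter) {v u : Γ.V} {l : Letter n} :
    τ u = τ v ++ [l] ↔ parent (ν u) = ν v ∧ letter (ν u) = code l := by
  by_cases hu : u = Γ.base
  · have := h.pos v
    rw [hu, h.geo.base, h.base, h.parent_base]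
    simp
    omega
  · obtain ⟨p, l', -, h₁, h₂, h₃, -⟩ := h.tree u hu
    rw [h₁, h₂, h₃, h.inj.eq_iff, code_inj]
    constructor
    · intro he
      obtain ⟨e₁, e₂⟩ := List.append_inj' he rfl
      exact ⟨h.geo.injective e₁, by simpa using e₂⟩
    · rintro ⟨rfl, rfl⟩
      rfl

/-- The invariant for writing the basis. -/
structure BasisState {n : ℕ} (Γ : LGraph n) (ν : Γ.V → ℕ) (τ : Γ.V → Word n) (σ₀ : State)
    (E : List (Γ.V × Fin n × Γ.V)) (σ : State) : Prop where
  zero : σ.reg Reg.zero = 0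
  one : σ.reg Reg.one = 1
  parent : σ.arr (Arr.parent (n := n)) = σ₀.arr (Arr.parent (n := n))
  letter : σ.arr (Arr.letter (n := n)) = σ₀.arr (Arr.letter (n := n))
  tbl : tblTable n σ = tblTable n σ₀
  inv : ∀ l : Letter n, σ.arr (Arr.inv (n := n)) (code l) = code (linv l)
  rank : σ.reg Reg.rank = E.length
  written : Written n (encodeWords (E.map (cotreeWord τ))) σ

theorem testEdge_spec {n : ℕ} {Γ : LGraph n} {ν : Γ.V → ℕ} {τ : Γ.V → Word n} {k : ℕ}
    {σ : State} (h : TreeTables Γ ν τ k (tblTable n σ) (σ.arr (Arr.parent (n := n)))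
      (σ.arr (Arr.letter (n := n)))) (hz : σ.reg Reg.zero = 0) {v : Γ.V}
    (hv : σ.reg Reg.i = ν v) (a : Fin n) :
    WP (testEdge a) σ fun σ' t => (σ'.reg Reg.f = 0 ∧ (∃ u, Γ.Step v (a, true) u ∧
        ¬ IsTreeEdge τ v (a, true) u ∧ σ'.reg Reg.q = ν u) ∨
      σ'.reg Reg.f = 1 ∧ ∀ u, Γ.Step v (a, true) u → IsTreeEdge τ v (a, true) u) ∧ t ≤ 25 := by
  unfold testEdge
  rw [wp_block_cons, wp_load, wp_block_cons, wp_const, wp_block_cons, wp_ite]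
  simp only [holds_lt, setReg_reg, setReg_arr, Reg.num_inj, reduceCtorEq, if_true, if_false, hz, hv]
  by_cases hu : ∃ u, Γ.Step v (a, true) u
  · obtain ⟨u, hu⟩ := hu
    have hq : σ.arr (Arr.tbl (a, true)) (ν v) = ν u := h.step hu
    have hpu := h.pos u
    have e₁ := h.child_iff (v := v) (u := u) (l := (a, true))
    have e₂ := h.child_iff (v := u) (u := v) (l := (a, false))
    have ht : IsTreeEdge τ v (a, true) u ↔ _ := or_congr e₁ e₂
    rw [hq]
    refine ⟨fun _ => ?_, fun h0 => absurd hpu h0⟩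
    have hall : (∀ u, Γ.Step v (a, true) u → IsTreeEdge τ v (a, true) u) ↔
        IsTreeEdge τ v (a, true) u :=
      ⟨fun h' => h' u hu, fun h' u' hu' => h.geo.folded.isInverse.det hu hu' ▸ h'⟩
    rw [hall]
    have hex : ∀ {m : ℕ}, m = ν u → ((∃ w, Γ.Step v (a, true) w ∧ ¬ IsTreeEdge τ v (a, true) w ∧
        m = ν w) ↔ ¬ IsTreeEdge τ v (a, true) u) := by
      intro m hm
      refine ⟨?_, fun h' => ⟨u, hu, h', hm⟩⟩
      rintro ⟨w, h₁, h₂, -⟩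
      rwa [← h.geo.folded.isInverse.det hu h₁] at h₂
    simp only [wp_block_cons, wp_block_nil, wp_load, wp_const, wp_ite, wp_skip, holds_eq]
    simp only [setReg_reg, setReg_arr, Reg.num_inj, reduceCtorEq, if_true, if_false, hv]
    simp only [hex, ht]
    refine ⟨fun c₁ => ⟨fun c₂ => ⟨fun c₃ => ⟨fun c₄ => ?_, fun c₄ => ?_⟩, fun c₃ => ?_⟩,
      fun c₂ => ⟨fun c₃ => ⟨fun c₄ => ?_, fun c₄ => ?_⟩, fun c₃ => ?_⟩⟩,
      fun c₁ => ⟨fun c₃ => ⟨fun c₄ => ?_, fun c₄ => ?_⟩, fun c₃ => ?_⟩⟩ <;>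
    exact ⟨by simp [*], by omega⟩
  · have hq : σ.arr (Arr.tbl (a, true)) (ν v) = 0 := h.no_step v _ hu
    rw [hq]
    refine ⟨fun h0 => absurd h0 (lt_irrefl 0), fun _ => ?_⟩
    simp only [wp_skip, wp_block_nil]
    refine ⟨Or.inr ⟨?_, fun u h' => absurd ⟨u, h'⟩ hu⟩, by omega⟩
    simp only [setReg_reg, if_true]

theorem testEdge_keepsReg {n : ℕ} {a : Fin n} {r : Reg}
    (h : r ≠ .q ∧ r ≠ .f ∧ r ≠ .p ∧ r ≠ .c ∧ r ≠ .k) : (testEdge a).KeepsReg r := by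
  simp [testEdge, Cmd.KeepsReg, h]

theorem testEdge_keepsArr {n : ℕ} {a : Fin n} (b : ℕ) : (testEdge a).KeepsArr b := by
  simp [testEdge, Cmd.KeepsArr]

theorem encodeWords_singleton {n : ℕ} (w : Word n) : encodeWords [w] = encodeWord w := by
  simp [encodeWords]

theorem emitEdge_spec {n : ℕ} {Γ : LGraph n} {ν : Γ.V → ℕ} {τ : Γ.V → Word n} {k : ℕ}
    {σ₀ σ : State} (h : TreeTables Γ ν τ k (tblTable n σ₀) (σ₀.arr (Arr.parent (n := n)))
      (σ₀.arr (Arr.letter (n := n)))) {E : List (Γ.V × Fin n × Γ.V)}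
    (hE : BasisState Γ ν τ σ₀ E σ) {v : Γ.V} (hv : σ.reg Reg.i = ν v) (a : Fin n) :
    WP (emitEdge a) σ fun σ' t => (BasisState Γ ν τ σ₀ (E ++ edgeAt Γ τ v a) σ' ∧
      σ'.reg Reg.i = ν v) ∧ t ≤ 12 * totalLength ((edgeAt Γ τ v a).map (cotreeWord τ)) + 50 := by
  have hf := h.geo.folded
  unfold emitEdge
  rw [wp_block_cons]
  have h' := h
  rw [← hE.parent, ← hE.letter, ← hE.tbl] at h'
  refine (testEdge_spec h' hE.zero hv a).frame.mono ?_
  rintro σ₁ t₁ ⟨⟨hc, ht₁⟩, hfr⟩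
  have harr : σ₁.arr = σ.arr := funext fun b => hfr.arr b (testEdge_keepsArr b)
  have hz := (hfr.reg Reg.zero (testEdge_keepsReg (by simp))).trans hE.zero
  have ho := (hfr.reg Reg.one (testEdge_keepsReg (by simp))).trans hE.one
  have hi := (hfr.reg Reg.i (testEdge_keepsReg (by simp))).trans hv
  have hr := (hfr.reg Reg.rank (testEdge_keepsReg (by simp))).trans hE.rank
  have hoo := hfr.reg Reg.o (testEdge_keepsReg (by simp))
  have hE₁ : BasisState Γ ν τ σ₀ E σ₁ := ⟨hz, ho, by rw [harr, hE.parent], by rw [harr, hE.letter],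
    by rw [← hE.tbl]; unfold tblTable; rw [harr], by rw [harr]; exact hE.inv, hr,
    hE.written.congr hoo (by rw [harr])⟩
  have h₁ := h
  rw [← hE₁.parent, ← hE₁.letter, ← hE₁.tbl] at h₁
  rw [wp_block_cons, wp_ite]
  simp only [holds_eq, hz, wp_skip, wp_block_nil]
  rcases hc with ⟨hc, u, hu, hut, hq⟩ | ⟨hc, hu⟩
  · refine ⟨fun _ => ?_, fun h0 => absurd hc h0⟩
    refine (emit_spec h₁ hz ho hE₁.inv hi hq hE₁.written a).frame.mono ?_
    rintro σ₂ t₂ ⟨⟨g₁, g₂, ht₂⟩, hfr₂⟩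
    rw [edgeAt_eq hf hu hut]
    refine ⟨⟨⟨?_, ?_, ?_, ?_, ?_, ?_, ?_, ?_⟩, ?_⟩, ?_⟩
    · exact (hfr₂.reg Reg.zero (emit_keepsReg (by simp))).trans hz
    · exact (hfr₂.reg Reg.one (emit_keepsReg (by simp))).trans ho
    · exact (hfr₂.arr _ (emit_keepsArr (by simp))).trans hE₁.parent
    · exact (hfr₂.arr _ (emit_keepsArr (by simp))).trans hE₁.letter
    · rw [← hE₁.tbl]
      funext l
      exact hfr₂.arr _ (emit_keepsArr (by simp))
    · rw [hfr₂.arr _ (emit_keepsArr (by simp))]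
      exact hE₁.inv
    · rw [g₂, hr, List.length_append, List.length_singleton]
    · rw [List.map_append, encodeWords_append, List.map_singleton, encodeWords_singleton]
      exact g₁
    · exact (hfr₂.reg Reg.i (emit_keepsReg (by simp))).trans hi
    · simp only [List.map_cons, List.map_nil, totalLength, List.sum_cons, List.sum_nil]
      omega
  · refine ⟨fun h0 => by omega, fun _ => ?_⟩
    rw [edgeAt_eq_nil hu, List.append_nil]
    exact ⟨⟨hE₁, hi⟩, by omega⟩

theorem totalLength_flatMap {n : ℕ} {α β : Type*} (A : List α) (f : α → List β) (g : β → Word n) :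
    totalLength ((A.flatMap f).map g) = (A.map fun a => totalLength ((f a).map g)).sum := by
  induction A with
  | nil => rfl
  | cons a A ih =>
    rw [List.flatMap_cons, List.map_append, totalLength_append, ih, List.map_cons, List.sum_cons]

theorem emitRow_spec {n : ℕ} {Γ : LGraph n} {ν : Γ.V → ℕ} {τ : Γ.V → Word n} {k : ℕ}
    {σ₀ σ : State} (h : TreeTables Γ ν τ k (tblTable n σ₀) (σ₀.arr (Arr.parent (n := n)))
      (σ₀.arr (Arr.letter (n := n)))) {E : List (Γ.V × Fin n × Γ.V)}
    (hE : BasisState Γ ν τ σ₀ E σ) {v : Γ.V} (hv : σ.reg Reg.i = ν v) :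
    WP (block ((List.finRange n).map emitEdge)) σ fun σ' t =>
      (BasisState Γ ν τ σ₀ (E ++ edgesFrom Γ τ [v]) σ' ∧ σ'.reg Reg.i = ν v) ∧
      t ≤ 12 * totalLength ((edgesFrom Γ τ [v]).map (cotreeWord τ)) + 50 * n + 1 := by
  refine (wp_block_map (fun D σ' => BasisState Γ ν τ σ₀ (E ++ D.flatMap (edgeAt Γ τ v)) σ' ∧
    σ'.reg Reg.i = ν v) (fun a => 12 * totalLength ((edgeAt Γ τ v a).map (cotreeWord τ)) + 50) ?_
    ⟨by simpa using hE, hv⟩).mono ?_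
  · rintro D a R σ' - ⟨h₁, h₂⟩
    rw [List.flatMap_append, ← List.append_assoc, List.flatMap_singleton]
    exact emitEdge_spec h h₁ h₂ a
  · rintro σ' t ⟨⟨h₁, h₂⟩, ht⟩
    have he : edgesFrom Γ τ [v] = (List.finRange n).flatMap (edgeAt Γ τ v) := by
      simp [edgesFrom]
    rw [he]
    refine ⟨⟨h₁, h₂⟩, ?_⟩
    rw [totalLength_flatMap]
    rw [List.sum_map_add, List.sum_map_mul_left] at ht
    simp only [List.map_const', List.sum_replicate, List.length_finRange, smul_eq_mul] at ht
    omega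

/-- Writing costs a multiple of the total length of the basis, which `isNielsenBasis_of_list` bounds
by the length of the input, plus constant work for each vertex and generator. -/
theorem writeBasis_spec {n : ℕ} {J : List (Word n)} {Γ : LGraph n} (hc : Carries J Γ)
    {ν : Γ.V → ℕ} {τ : Γ.V → Word n} {σ : State}
    (h : TreeTables Γ ν τ (σ.reg Reg.verts) (tblTable n σ) (σ.arr (Arr.parent (n := n)))
      (σ.arr (Arr.letter (n := n)))) (hz : σ.reg Reg.zero = 0) (ho : σ.reg Reg.one = 1) :
    WP (writeBasis n) σ fun σ' t => (∃ U, IsNielsenBasis (generated J) U ∧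
      σ'.reg Reg.rank = U.length ∧ σ'.Holds arrBasis (encodeWords U)) ∧
      t ≤ 12 * totalLength J + (50 * n + 5) * σ.reg Reg.verts + 8 * n + 10 := by
  have hf := h.geo.folded
  set k := σ.reg Reg.verts with hk
  have : Nonempty Γ.V := ⟨Γ.base⟩
  -- The vertices with numbers `1, …, m`; the shift is there because the numbering begins with `1`.
  set A : ℕ → List Γ.V := fun m => (List.range m).map fun j => Function.invFun ν (j + 1) with hA
  have hν : ∀ j, 1 ≤ j → j ≤ k → ν (Function.invFun ν j) = j := fun j h₁ h₂ =>
    Function.invFun_eq (show j ∈ Set.range ν from h.range ▸ ⟨h₁, h₂⟩)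
  have hAs : ∀ m, edgesFrom Γ τ (A (m + 1)) =
      edgesFrom Γ τ (A m) ++ edgesFrom Γ τ [Function.invFun ν (m + 1)] := by
    intro m
    simp [hA, List.range_succ, edgesFrom]
  have hnd : (A k).Nodup := by
    refine List.Nodup.map_on ?_ List.nodup_range
    intro x hx y hy he
    rw [List.mem_range] at hx hy
    have := congrArg ν he
    rw [hν _ (by omega) (by omega), hν _ (by omega) (by omega)] at this
    omega
  have hmem : ∀ v, v ∈ A k := by
    intro v
    have hv : ν v ∈ Set.Icc 1 k := h.range ▸ ⟨v, rfl⟩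
    obtain ⟨h₁, h₂⟩ := hv
    refine List.mem_map.2 ⟨ν v - 1, List.mem_range.2 (by omega), ?_⟩
    rw [Nat.sub_add_cancel h₁, Function.leftInverse_invFun h.inj v]
  obtain ⟨hN, hlen⟩ := isNielsenBasis_of_list h.geo hc (nodup_edgesFrom hf hnd)
    (fun v i u => by rw [mem_edgesFrom hf]; exact and_iff_right (hmem v))
  unfold writeBasis
  rw [wp_block_cons]
  refine (fillInv_spec σ).frame.mono ?_
  rintro σ₁ t₁ ⟨⟨hinv, ht₁⟩, hfr⟩
  have g₁ := (hfr.reg Reg.zero (fillInv_keepsReg (by simp))).trans hz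
  have g₂ := (hfr.reg Reg.one (fillInv_keepsReg (by simp))).trans ho
  have g₃ := (hfr.reg Reg.verts (fillInv_keepsReg (by simp))).trans hk.symm
  have g₄ := hfr.arr (Arr.parent (n := n)) (fillInv_keepsArr (by simp))
  have g₅ := hfr.arr (Arr.letter (n := n)) (fillInv_keepsArr (by simp))
  have g₆ : tblTable n σ₁ = tblTable n σ := by
    funext l
    exact hfr.arr (Arr.tbl l) (fillInv_keepsArr (by simp))
  simp only [wp_block_cons, wp_block_nil, wp_const, wp_succ]
  refine (wp_for (fun i σ' => BasisState Γ ν τ σ (edgesFrom Γ τ (A (i - 1))) σ' ∧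
    σ'.reg Reg.i = i ∧ σ'.reg Reg.lim = k + 1 ∧ 1 ≤ i ∧ i ≤ k + 1)
    (fun i => 12 * totalLength ((edgesFrom Γ τ [Function.invFun ν i]).map (cotreeWord τ)) +
      50 * n + 3) (e := k + 1) (s := 1) ?_ ?_ ⟨⟨?_, ?_, ?_, ?_, ?_, ?_, ?_, ?_⟩, ?_, ?_, le_rfl,
      by omega⟩).mono ?_
  · rintro i σ' ⟨-, h₁, h₂, h₃, h₄⟩
    rw [holds_lt, h₁, h₂]
    exact ⟨h₄, Iff.rfl⟩
  · rintro i σ' ⟨h₀, h₁, h₂, h₃, -⟩ hlt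
    rw [wp_block_cons]
    refine (emitRow_spec h h₀ (h₁.trans (hν i h₃ (by omega)).symm)).frame.mono ?_
    rintro σ₂ t₂ ⟨⟨⟨q₁, q₂⟩, ht₂⟩, hfr₂⟩
    have q₃ := hfr₂.reg Reg.lim (by
      rw [keepsReg_block_map]
      intro a _
      simp [emitEdge, emit, emitReg, testEdge, Cmd.KeepsReg])
    simp only [wp_block_cons, wp_block_nil, wp_succ]
    rw [hν i h₃ (by omega)] at q₂
    obtain ⟨m, rfl⟩ : ∃ m, i = m + 1 := ⟨i - 1, by omega⟩
    rw [Nat.add_sub_cancel, ← hAs] at q₁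
    refine ⟨⟨⟨?_, ?_, ?_, ?_, ?_, ?_, ?_, ?_⟩, ?_, ?_, by omega, by omega⟩, by omega⟩
    all_goals try simp only [setReg_reg, setReg_arr, Reg.num_inj, reduceCtorEq, if_true, if_false]
    · exact q₁.zero
    · exact q₁.one
    · exact q₁.parent
    · exact q₁.letter
    · exact q₁.tbl
    · exact q₁.inv
    · exact q₁.rank
    · refine q₁.written.congr ?_ rfl
      simp only [setReg_reg, Reg.num_inj, reduceCtorEq, if_false]
    · rw [q₂]
    · rw [q₃, h₂]
  all_goals try simp only [setReg_reg, setReg_arr, Reg.num_inj, reduceCtorEq, if_true, if_false]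
  · exact g₁
  · exact g₂
  · exact g₄
  · exact g₅
  · exact g₆
  · exact hinv
  · rfl
  · refine ⟨?_, fun j hj => ?_⟩
    · simp only [setReg_reg, Reg.num_inj, reduceCtorEq, if_true, if_false]
      rfl
    · simp [hA, edgesFrom, encodeWords] at hj
  · rw [g₃]
  rintro σ₂ t₂ ⟨⟨q₁, -⟩, ht₂⟩
  rw [Nat.add_sub_cancel] at q₁
  have hsum : ∀ m, ∑ i ∈ Finset.Ico 1 (m + 1), (12 * totalLength ((edgesFrom Γ τ
      [Function.invFun ν i]).map (cotreeWord τ)) + 50 * n + 3 + 1) =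
      12 * totalLength ((edgesFrom Γ τ (A m)).map (cotreeWord τ)) + (50 * n + 4) * m := by
    intro m
    induction m with
    | zero => simp [hA, edgesFrom, totalLength]
    | succ m ih =>
      rw [Finset.sum_Ico_succ_top (by omega), ih, hAs, List.map_append, totalLength_append]
      ring
  rw [hsum] at ht₂
  refine ⟨⟨_, hN, by rw [q₁.rank, List.length_map], fun i => ?_⟩, ?_⟩
  · have := q₁.written.basis i i.2
    rw [List.getD_eq_getElem _ _ i.2] at this
    exact this
  · have e : (50 * n + 5) * k = (50 * n + 4) * k + k := by ring
    unfold totalLength at *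
    omega

theorem emitEdge_keepsReg {n : ℕ} {a : Fin n} {r : Reg} (h : r ≠ .x ∧ r ≠ .y ∧ r ≠ .c ∧ r ≠ .o ∧
    r ≠ .rank ∧ r ≠ .q ∧ r ≠ .f ∧ r ≠ .p ∧ r ≠ .k) : (emitEdge a).KeepsReg r := by
  simp [emitEdge, emit, emitReg, testEdge, Cmd.KeepsReg, h]

theorem emitEdge_keepsArr {n : ℕ} {a : Fin n} {b : Arr n} (h : b ≠ .nxt ∧ b ≠ .basis) :
    (emitEdge a).KeepsArr b := by
  simp [emitEdge, emit, emitReg, testEdge, Cmd.KeepsArr, h]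

theorem writeBasis_keepsReg {n : ℕ} {r : Reg} (h : r ≠ .x ∧ r ≠ .y ∧ r ≠ .c ∧ r ≠ .o ∧
    r ≠ .rank ∧ r ≠ .q ∧ r ≠ .f ∧ r ≠ .p ∧ r ≠ .k ∧ r ≠ .i ∧ r ≠ .lim) :
    (writeBasis n).KeepsReg r := by
  have h₁ : (fillInv n).KeepsReg r := fillInv_keepsReg (by simp [h])
  have h₂ : ∀ a : Fin n, (emitEdge a).KeepsReg r := fun a => emitEdge_keepsReg (by simp [h])
  simp [writeBasis, Cmd.KeepsReg, h, h₁, h₂]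

theorem writeBasis_keepsArr {n : ℕ} {b : Arr n} (h : b ≠ .nxt ∧ b ≠ .basis ∧ b ≠ .inv) :
    (writeBasis n).KeepsArr b := by
  have h₁ : (fillInv n).KeepsArr b := fillInv_keepsArr (by simp [h])
  have h₂ : ∀ a : Fin n, (emitEdge a).KeepsArr b := fun a => emitEdge_keepsArr (by simp [h])
  simp [writeBasis, Cmd.KeepsArr, h, h₁, h₂]

/-! ### Membership -/

/-- Reduce the word in the array `query`; the result is left on the stack `stk`, whose height is in
the register `cur`. -/
noncomputable def reduceQuery (n : ℕ) : Cmd := .loop (.lt Reg.zero Reg.c) (block [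
  .load Reg.p (Arr.stk (n := n)) Reg.cur, .load Reg.q (Arr.inv (n := n)) Reg.c,
  .ite (.eq Reg.p Reg.q) (.load Reg.cur (Arr.prd (n := n)) Reg.cur)
    (block [.succ Reg.q Reg.cur, .store (Arr.prd (n := n)) Reg.q Reg.cur, .copy Reg.cur Reg.q,
      .store (Arr.stk (n := n)) Reg.cur Reg.c]),
  .succ Reg.pos Reg.pos, .load Reg.c (Arr.query (n := n)) Reg.pos])

/-- Read the word on the stack, starting from the vertex in the register `x`. -/
noncomputable def walk (n : ℕ) : Cmd := .loop (.lt Reg.i Reg.cur) (block [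
  .succ Reg.i Reg.i, .load Reg.c (Arr.stk (n := n)) Reg.i,
  dispatch fun l : Letter n => .ite (.lt Reg.zero Reg.x) (.load Reg.x (Arr.tbl l) Reg.x) .skip])

/-- Decide membership. -/
noncomputable def membership (n : ℕ) : Cmd := block [
  fillInv n, .const Reg.zero 0, .const Reg.one 1, .const Reg.pos 0, .const Reg.cur 0,
  .store (Arr.stk (n := n)) Reg.zero Reg.zero, .load Reg.c (Arr.query (n := n)) Reg.pos,
  reduceQuery n, .const Reg.i 0, .const Reg.x 1, walk n,
  .ite (.eq Reg.x Reg.one) (.const Reg.ans 1) (.const Reg.ans 0)]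

/-- The word `s` is on the stack. -/
structure OnStack (n : ℕ) (s : Word n) (σ : State) : Prop where
  cur : σ.reg Reg.cur = s.length
  bottom : σ.arr (Arr.stk (n := n)) 0 = 0
  stk : ∀ p l q, s = p ++ l :: q → σ.arr (Arr.stk (n := n)) (p.length + 1) = code l
  prd : ∀ p l q, s = p ++ l :: q → σ.arr (Arr.prd (n := n)) (p.length + 1) = p.length

/-- There is no predecessor operation, so every push records the previous height in `prd`, and
popping looks it up. Entries above the new height may remain. -/
theorem OnStack.pop {n : ℕ} {s : Word n} {l : Letter n} {σ σ' : State}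
    (h : OnStack n (s ++ [l]) σ) (hc : σ'.reg Reg.cur = s.length)
    (hs : σ'.arr (Arr.stk (n := n)) = σ.arr (Arr.stk (n := n)))
    (hp : σ'.arr (Arr.prd (n := n)) = σ.arr (Arr.prd (n := n))) : OnStack n s σ' where
  cur := hc
  bottom := by rw [hs, h.bottom]
  stk p m q he := by rw [hs]; exact h.stk p m (q ++ [l]) (by simp [he])
  prd p m q he := by rw [hp]; exact h.prd p m (q ++ [l]) (by simp [he])

theorem OnStack.push {n : ℕ} {s : Word n} {l : Letter n} {σ σ' : State} (h : OnStack n s σ)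
    (hc : σ'.reg Reg.cur = s.length + 1) (hs : σ'.arr (Arr.stk (n := n)) =
      Function.update (σ.arr (Arr.stk (n := n))) (s.length + 1) (code l))
    (hp : σ'.arr (Arr.prd (n := n)) =
      Function.update (σ.arr (Arr.prd (n := n))) (s.length + 1) s.length) :
    OnStack n (s ++ [l]) σ' := by
  have hcases : ∀ {p m q}, s ++ [l] = p ++ m :: q → (p = s ∧ m = l) ∨
      p.length < s.length ∧ ∃ q', s = p ++ m :: q' := by
    intro p m q he
    rcases List.eq_nil_or_concat q with rfl | ⟨q', a, rfl⟩
    · obtain ⟨h₁, h₂⟩ := List.append_inj' he rfl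
      exact Or.inl ⟨h₁.symm, by simpa using h₂.symm⟩
    · have : s ++ [l] = (p ++ m :: q') ++ [a] := by simp [he]
      obtain ⟨h₁, -⟩ := List.append_inj' this rfl
      refine Or.inr ⟨?_, q', h₁⟩
      rw [h₁]
      simp
  refine ⟨by rw [hc]; simp, ?_, ?_, ?_⟩
  · rw [hs, Function.update_of_ne (by omega), h.bottom]
  · intro p m q he
    rw [hs]
    rcases hcases he with ⟨rfl, rfl⟩ | ⟨h₁, q', h₂⟩
    · rw [Function.update_self]
    · rw [Function.update_of_ne (by omega)]
      exact h.stk p m q' h₂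
  · intro p m q he
    rw [hp]
    rcases hcases he with ⟨rfl, rfl⟩ | ⟨h₁, q', h₂⟩
    · rw [Function.update_self]
    · rw [Function.update_of_ne (by omega)]
      exact h.prd p m q' h₂

/-- The invariant of the reduction: the part `p` of the word has been read. -/
structure ReduceState {n : ℕ} (w p r s : Word n) (σ : State) : Prop where
  zero : σ.reg Reg.zero = 0
  inv : ∀ l : Letter n, σ.arr (Arr.inv (n := n)) (code l) = code (linv l)
  query : ∀ p s, w = p ++ s → σ.arr (Arr.query (n := n)) p.length = (encodeWord s).getD 0 0
  split : w = p ++ r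
  pos : σ.reg Reg.pos = p.length
  c : σ.reg Reg.c = (encodeWord r).getD 0 0
  stack : OnStack n s σ
  reduced : FreeGroup.IsReduced s
  mk_eq : FreeGroup.mk s = FreeGroup.mk p
  le : s.length ≤ p.length

theorem mk_append_linv {n : ℕ} (s : Word n) (l : Letter n) :
    FreeGroup.mk (s ++ [linv l] ++ [l]) = FreeGroup.mk s := by
  rw [← FreeGroup.mul_mk, ← FreeGroup.mul_mk, mul_assoc]
  have : FreeGroup.mk [linv l] = (FreeGroup.mk [l])⁻¹ := by
    simp [FreeGroup.inv_mk, FreeGroup.invRev, linv]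
  rw [this, inv_mul_cancel, mul_one]

/-- The stack always holds the reduced form of the part read so far. The next letter either cancels
the top or can be appended to a reduced word. -/
theorem reduceQuery_spec {n : ℕ} {w : Word n} {σ : State} (h : ReduceState w [] w [] σ) :
    WP (reduceQuery n) σ fun σ' t => (∃ s, ReduceState w w [] s σ') ∧ t ≤ 15 * w.length + 1 := by
  unfold reduceQuery
  refine (wp_loop (fun c σ' => ∃ p r s, ReduceState w p r s σ' ∧ c = 15 * r.length) ?_
    ⟨[], w, [], h, rfl⟩).mono ?_
  · clear h σ
    rintro c σ ⟨p, r, s, h, rfl⟩ hb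
    rw [holds_lt, h.zero, h.c] at hb
    cases r with
    | nil => simp [encodeWord] at hb
    | cons l r =>
      have hc : σ.reg Reg.c = code l := by rw [h.c]; simp [encodeWord]
      have hinv := h.inv l
      have hcur := h.stack.cur
      have hpos := h.pos
      have hw : w = (p ++ [l]) ++ r := by simp [h.split]
      have hq := h.query _ _ hw
      rw [List.length_append, List.length_singleton] at hq
      simp only [wp_block_cons, wp_block_nil, wp_load, wp_ite, wp_succ, wp_store, wp_copy, holds_eq]
      simp only [setReg_reg, setReg_arr, setArr_reg, setArr_arr, Reg.num_inj, Arr.id_inj,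
        reduceCtorEq, if_true, if_false, hc, hinv, hcur, hpos]
      refine ⟨fun ht => ?_, fun ht => ?_⟩
      · obtain ⟨s', m, rfl⟩ : ∃ s' m, s = s' ++ [m] := by
          rcases List.eq_nil_or_concat s with rfl | ⟨s', m, rfl⟩
          -- The bottom entry `0` is a sentinel: codes are positive, so nothing cancels against an
          -- empty stack.
          · rw [List.length_nil, h.stack.bottom] at ht
            have := code_pos (linv l)
            omega
          · exact ⟨s', m, by simp⟩
        have h₁ := h.stack.stk s' m [] rfl
        have h₂ := h.stack.prd s' m [] rfl
        rw [List.length_append, List.length_singleton] at ht ⊢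
        rw [h₁, code_inj] at ht
        subst ht
        have hle := h.le
        rw [List.length_append, List.length_singleton] at hle
        refine ⟨15 * r.length, ⟨p ++ [l], r, s', ⟨?_, ?_, ?_, hw, ?_, ?_, h.stack.pop ?_ ?_ ?_,
          h.reduced.infix (List.prefix_append s' _).isInfix, ?_, ?_⟩, rfl⟩, ?_⟩
        all_goals try simp only [setReg_reg, setReg_arr, Reg.num_inj, reduceCtorEq, if_true,
          if_false]
        · exact h.zero
        · exact h.inv
        · exact h.query
        · simp
        · rw [hq]
        · exact h₂
        · rw [← FreeGroup.mul_mk, ← h.mk_eq, FreeGroup.mul_mk, mk_append_linv]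
        · rw [List.length_append]
          omega
        · rw [List.length_cons]
          omega
      · have hle := h.le
        refine ⟨15 * r.length, ⟨p ++ [l], r, s ++ [l], ⟨?_, ?_, ?_, hw, ?_, ?_,
          h.stack.push ?_ ?_ ?_, ?_, ?_, ?_⟩, rfl⟩, ?_⟩
        all_goals try simp only [setReg_reg, setReg_arr, setArr_reg, setArr_arr, Reg.num_inj,
          Arr.id_inj, reduceCtorEq, if_true, if_false]
        · exact h.zero
        · exact h.inv
        · exact h.query
        · simp
        · rw [hq]
        · unfold FreeGroup.IsReduced
          rw [List.isChain_append]
          refine ⟨h.reduced, by simp, ?_⟩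
          intro x hx y hy hxy
          simp only [List.head?_cons, Option.mem_def, Option.some.injEq] at hy
          subst hy
          by_contra hne
          obtain ⟨s', rfl⟩ : ∃ s', s = s' ++ [x] := by
            rcases List.eq_nil_or_concat s with rfl | ⟨s', m, rfl⟩
            · simp at hx
            · simp at hx
              exact ⟨s', by simp [hx]⟩
          have h₁ := h.stack.stk s' x [] rfl
          rw [List.length_append, List.length_singleton, h₁, code_inj] at ht
          refine ht (Prod.ext hxy ?_)
          simp only [linv]
          revert hne
          cases x.2 <;> cases l.2 <;> simp
        · rw [← FreeGroup.mul_mk, ← FreeGroup.mul_mk, h.mk_eq]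
        · rw [List.length_append, List.length_append]
          omega
        · rw [List.length_cons]
          omega
  · rintro σ' t ⟨c, ⟨p, r, s, h, rfl⟩, hb, ht⟩
    rw [holds_lt, h.zero, h.c] at hb
    cases r with
    | nil =>
      have hw := h.split
      rw [List.append_nil] at hw
      subst hw
      exact ⟨⟨s, h⟩, by simpa using ht⟩
    | cons l r =>
      have := code_pos l
      simp [encodeWord] at hb
      omega

theorem reduceQuery_keepsReg {n : ℕ} {r : Reg}
    (h : r ≠ .p ∧ r ≠ .q ∧ r ≠ .cur ∧ r ≠ .pos ∧ r ≠ .c) : (reduceQuery n).KeepsReg r := by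
  simp [reduceQuery, Cmd.KeepsReg, h]

theorem reduceQuery_keepsArr {n : ℕ} {a : Arr n} (h : a ≠ .stk ∧ a ≠ .prd) :
    (reduceQuery n).KeepsArr a := by
  simp [reduceQuery, Cmd.KeepsArr, h]

theorem walk_keepsReg {n : ℕ} {r : Reg} (h : r ≠ .i ∧ r ≠ .c ∧ r ≠ .k ∧ r ≠ .x) :
    (walk n).KeepsReg r := by
  have : (dispatch fun l : Letter n =>
      .ite (.lt Reg.zero Reg.x) (.load Reg.x (Arr.tbl l) Reg.x) .skip).KeepsReg r :=
    dispatch_keepsReg h.2.2.1 (by simp [Cmd.KeepsReg, h])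
  simp [walk, Cmd.KeepsReg, h, this]

theorem walk_keepsArr {n : ℕ} (a : Arr n) : (walk n).KeepsArr a := by
  have : (dispatch fun l : Letter n =>
      .ite (.lt Reg.zero Reg.x) (.load Reg.x (Arr.tbl l) Reg.x) .skip).KeepsArr a :=
    dispatch_keepsArr (by simp [Cmd.KeepsArr])
  simp [walk, Cmd.KeepsArr, this]

/-- The register `x` contains the end of the path with label `p` from the base point, or `0`. -/
def AtEnd {n : ℕ} (Γ : LGraph n) (ν : Γ.V → ℕ) (p : Word n) (x : ℕ) : Prop :=
  (∃ v, PathIn Γ.Step Γ.base p v ∧ x = ν v) ∨ (¬ ∃ v, PathIn Γ.Step Γ.base p v) ∧ x = 0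

/-- Once a letter cannot be read, `x` becomes `0` and stays there. The program tests for this
because nothing is known about the tables at `0` in an arbitrary memory. -/
theorem walk_spec {n : ℕ} {Γ : LGraph n} (hf : Γ.IsFolded) {ν : Γ.V → ℕ} {σ : State}
    (hν : ∀ v, 1 ≤ ν v) (hb : ν Γ.base = 1)
    (hstep : ∀ v l w, Γ.Step v l w → σ.arr (Arr.tbl l) (ν v) = ν w)
    (hno : ∀ v l, (¬ ∃ w, Γ.Step v l w) → σ.arr (Arr.tbl l) (ν v) = 0) {s : Word n}
    (hs : OnStack n s σ) (hz : σ.reg Reg.zero = 0) (hi : σ.reg Reg.i = 0) (hx : σ.reg Reg.x = 1) :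
    WP (walk n) σ fun σ' t => AtEnd Γ ν s (σ'.reg Reg.x) ∧ t ≤ (14 * n + 10) * s.length + 1 := by
  unfold walk
  refine (wp_loop (fun c σ' => ∃ p r, s = p ++ r ∧ σ'.arr = σ.arr ∧ σ'.reg Reg.zero = 0 ∧
    σ'.reg Reg.cur = s.length ∧ σ'.reg Reg.i = p.length ∧ AtEnd Γ ν p (σ'.reg Reg.x) ∧
    c = (14 * n + 10) * r.length) ?_
    ⟨[], s, rfl, rfl, hz, hs.cur, hi, Or.inl ⟨_, rfl, hx.trans hb.symm⟩, rfl⟩).mono ?_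
  · rintro c σ₁ ⟨p, r, hpr, h₁, h₂, h₃, h₄, h₅, rfl⟩ hlt
    rw [holds_lt, h₃, h₄, hpr, List.length_append] at hlt
    obtain ⟨l, r, rfl⟩ : ∃ l r', r = l :: r' := List.exists_cons_of_length_pos (by omega)
    have hst := hs.stk p l r hpr
    simp only [wp_block_cons, wp_block_nil, wp_succ, wp_load]
    simp only [setReg_reg, setReg_arr, Reg.num_inj, reduceCtorEq, if_true, if_false, h₄, h₁, hst]
    refine (wp_dispatch (l := l) (T := 2) (Q := fun σ' => σ'.arr = σ.arr ∧
      σ'.reg Reg.zero = 0 ∧ σ'.reg Reg.cur = s.length ∧ σ'.reg Reg.i = p.length + 1 ∧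
      AtEnd Γ ν (p ++ [l]) (σ'.reg Reg.x)) ?_ ?_ ?_ ?_).mono ?_
    · simp only [setReg_reg, if_true]
    · simp [Cmd.KeepsReg]
    · intro σ' v h
      simpa [setReg_reg] using h
    · simp only [wp_ite, wp_load, wp_skip, holds_lt]
      simp only [setReg_reg, setReg_arr, Reg.num_inj, reduceCtorEq, if_true, if_false, h₁, h₂, h₃]
      constructor
      · intro hxpos
        refine ⟨⟨trivial, trivial, trivial, trivial, ?_⟩, by omega⟩
        rcases h₅ with ⟨v, hv, hxv⟩ | ⟨_, hx0⟩
        · rw [hxv]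
          by_cases hu : ∃ u, Γ.Step v l u
          · obtain ⟨u, hu⟩ := hu
            exact Or.inl ⟨u, pathIn_append.2 ⟨v, hv, pathIn_singleton.2 hu⟩, hstep v l u hu⟩
          · refine Or.inr ⟨?_, hno v l hu⟩
            rintro ⟨u, hpu⟩
            obtain ⟨v', hv', hu'⟩ := pathIn_append.1 hpu
            rw [hf.isInverse.path_unique hv' hv] at hu'
            exact hu ⟨u, pathIn_singleton.1 hu'⟩
        · omega
      · intro hxpos
        refine ⟨⟨trivial, trivial, trivial, trivial, ?_⟩, by omega⟩
        rcases h₅ with ⟨v, hv, hxv⟩ | ⟨hnp, hx0⟩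
        · have := hν v
          omega
        · refine Or.inr ⟨?_, hx0⟩
          rintro ⟨u, hpu⟩
          obtain ⟨v', hv', -⟩ := pathIn_append.1 hpu
          exact hnp ⟨v', hv'⟩
    · rintro σ₂ t₂ ⟨⟨g₁, g₂, g₃, g₄, g₅⟩, ht₂⟩
      refine ⟨_, ⟨p ++ [l], r, by simp [hpr], g₁, g₂, g₃, by simp [g₄], g₅, rfl⟩, ?_⟩
      rw [List.length_cons, mul_add]
      omega
  · rintro σ' t ⟨c, ⟨p, r, hpr, h₁, h₂, h₃, h₄, h₅, rfl⟩, hlt, ht⟩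
    rw [holds_lt, h₃, h₄, hpr, List.length_append] at hlt
    obtain rfl : r = [] := List.length_eq_zero_iff.1 (by omega)
    rw [List.append_nil] at hpr
    subst hpr
    exact ⟨h₅, by omega⟩

theorem holds_encodeWord {n : ℕ} {σ : State} {a : ℕ} {w : Word n} (h : σ.Holds a (encodeWord w))
    {p s : Word n} (hw : w = p ++ s) : σ.arr a p.length = (encodeWord s).getD 0 0 := by
  have he : encodeWord w = p.map code ++ encodeWord s := by simp [hw, encodeWord]
  have hlt : p.length < (encodeWord w).length := by
    rw [he, List.length_append, List.length_map]
    simp [encodeWord]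
  have h₁ := h ⟨p.length, hlt⟩
  have h₂ := getD_append_length (p.map code) (encodeWord s) 0 0
  rw [← he, List.length_map, Nat.add_zero, List.getD_eq_getElem _ _ hlt] at h₂
  exact h₁.trans h₂

/-- The word is reduced first, since an unreduced word of the subgroup need not be readable in `Γ`.
Only the tables and the query are assumed about the memory, so the constants, the inverse letters
and the bottom of the stack are set anew. The tables and the number of vertices are never written
to. -/
theorem membership_spec {n : ℕ} {J : List (Word n)} {Γ : LGraph n} {ν : Γ.V → ℕ} {σ : State}
    {w : Word n} (hΓ : IsFoldedGraphOf J Γ) (hE : EncodesGraph σ Γ ν)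
    (hq : σ.Holds arrQuery (encodeWord w)) :
    WP (membership n) σ fun σ' t => t ≤ (22 * n + 60) * (w.length + 1) ∧
      (FreeGroup.mk w ∈ generated J → σ'.reg regAnswer = 1) ∧
      (FreeGroup.mk w ∉ generated J → σ'.reg regAnswer = 0) ∧ EncodesGraph σ' Γ ν := by
  have hf := hΓ.2
  obtain ⟨hinj, hrange, hbase, hstep, hno⟩ := hE
  have hν : ∀ v, 1 ≤ ν v := fun v =>
    (show ν v ∈ Set.Icc 1 (σ.reg regVertices) from hrange ▸ ⟨v, rfl⟩).1
  unfold membership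
  rw [wp_block_cons]
  refine (fillInv_spec σ).frame.mono ?_
  rintro σ₁ t₁ ⟨⟨hinv, ht₁⟩, hfr₁⟩
  have a₁ : ∀ a : Arr n, a ≠ .inv → σ₁.arr a = σ.arr a :=
    fun a ha => hfr₁.arr a (fillInv_keepsArr ha)
  have v₁ := hfr₁.reg Reg.verts (fillInv_keepsReg (by simp))
  simp only [wp_block_cons, wp_const, wp_store, wp_load]
  simp only [setReg_reg, setReg_arr, setArr_reg, setArr_arr, Reg.num_inj, Arr.id_inj,
    reduceCtorEq, if_true, if_false]
  refine (reduceQuery_spec (w := w) ⟨?_, ?_, ?_, rfl, ?_, ?_, ⟨?_, ?_, ?_, ?_⟩, ?_, rfl,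
    le_rfl⟩).frame.mono ?_
  all_goals try simp only [setReg_reg, setReg_arr, setArr_reg, setArr_arr, Reg.num_inj,
    Arr.id_inj, reduceCtorEq, if_true, if_false]
  · exact hinv
  · intro p s hps
    rw [a₁ _ (by simp)]
    exact holds_encodeWord hq hps
  · rfl
  · rw [a₁ _ (by simp)]
    exact holds_encodeWord hq (p := []) rfl
  · rfl
  · rw [Function.update_self]
  · intro p l q he
    simp at he
  · intro p l q he
    simp at he
  · exact .nil
  rintro σ₂ t₂ ⟨⟨⟨s, hs⟩, ht₂⟩, hfr₂⟩
  have hsw : FreeGroup.reduce w = s := by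
    rw [← FreeGroup.reduce.sound hs.mk_eq, hs.reduced.reduce_eq]
  have hmem := hΓ.carries.mem_generated_iff hf (w := w)
  rw [hsw] at hmem
  have a₂ : ∀ l : Letter n, σ₂.arr (Arr.tbl l) = σ.arr (Arr.tbl l) := by
    intro l
    rw [hfr₂.arr _ (reduceQuery_keepsArr (by simp)), ← a₁ _ (by simp)]
    simp only [setReg_arr, setArr_arr, Arr.id_inj, reduceCtorEq, if_false]
  have v₂ := hfr₂.reg Reg.verts (reduceQuery_keepsReg (by simp))
  have o₂ := hfr₂.reg Reg.one (reduceQuery_keepsReg (by simp))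
  simp only [setReg_reg, setArr_reg, Reg.num_inj, reduceCtorEq, if_true, if_false] at v₂ o₂
  refine (walk_spec hf (σ := (σ₂.setReg Reg.i 0).setReg Reg.x 1) (ν := ν) hν hbase ?_ ?_ (s := s)
    ⟨?_, ?_, ?_, ?_⟩ ?_ ?_ ?_).frame.mono ?_
  all_goals try simp only [setReg_reg, setReg_arr, Reg.num_inj, reduceCtorEq, if_true, if_false]
  · intro v l u hu
    rw [a₂]
    exact hstep v l u hu
  · intro v l hu
    rw [a₂]
    exact hno v l hu
  · exact hs.stack.cur
  · exact hs.stack.bottom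
  · exact hs.stack.stk
  · exact hs.stack.prd
  · exact hs.zero
  rintro σ₃ t₃ ⟨⟨hend, ht₃⟩, hfr₃⟩
  have a₃ : ∀ l : Letter n, σ₃.arr (Arr.tbl l) = σ.arr (Arr.tbl l) := fun l =>
    (hfr₃.arr _ (walk_keepsArr _)).trans (a₂ l)
  have v₃ := hfr₃.reg Reg.verts (walk_keepsReg (by simp))
  have o₃ := hfr₃.reg Reg.one (walk_keepsReg (by simp))
  simp only [setReg_reg, setArr_reg, Reg.num_inj, reduceCtorEq, if_true, if_false, o₂, v₂, v₁]
    at v₃ o₃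
  have henc : ∀ x, EncodesGraph (σ₃.setReg Reg.ans x) Γ ν := by
    intro x
    refine ⟨hinj, ?_, hbase, ?_, ?_⟩
    · rw [hrange]
      exact congrArg (Set.Icc 1) (v₃.symm.trans (by
        rw [show regVertices = Reg.verts.num from rfl, setReg_reg]
        simp only [Reg.num_inj, reduceCtorEq, if_false]))
    · intro v l u hu
      exact (congrFun (a₃ l) (ν v)).trans (hstep v l u hu)
    · intro v l hu
      exact (congrFun (a₃ l) (ν v)).trans (hno v l hu)
  have hans : σ₃.reg Reg.x = 1 ↔ FreeGroup.mk w ∈ generated J := by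
    rw [hmem]
    rcases hend with ⟨v, hv, hx⟩ | ⟨hnp, hx⟩
    · rw [hx, ← hbase, hinj.eq_iff]
      exact ⟨fun h => h ▸ hv, fun h => hf.isInverse.path_unique hv h⟩
    · rw [hx]
      exact ⟨fun h => by omega, fun h => absurd ⟨_, h⟩ hnp⟩
  have hreg : ∀ x, (σ₃.setReg Reg.ans x).reg regAnswer = x := by
    intro x
    rw [show regAnswer = Reg.ans.num from rfl, setReg_reg, if_pos rfl]
  have hlen : (14 * n + 10) * s.length ≤ (14 * n + 10) * w.length :=
    Nat.mul_le_mul_left _ hs.le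
  have hexp : (22 * n + 60) * (w.length + 1) =
      (14 * n + 10) * w.length + (8 * n + 50) * w.length + 22 * n + 60 := by ring
  have hexp' : 50 * w.length ≤ (8 * n + 50) * w.length := Nat.mul_le_mul_right _ (by omega)
  simp only [wp_ite, wp_const, wp_block_nil, holds_eq, o₃]
  constructor
  · intro hx
    refine ⟨by omega, fun _ => hreg 1, fun hn => absurd (hans.1 hx) hn, henc 1⟩
  · intro hx
    refine ⟨by omega, fun hn => absurd (hans.2 hn) hx, fun _ => hreg 0, henc 0⟩

/-! ### The whole construction -/

theorem parse_keepsReg {n : ℕ} {r : Reg} (h : r ≠ .zero ∧ r ≠ .one ∧ r ≠ .pos ∧ r ≠ .w ∧ r ≠ .nv ∧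
    r ≠ .tl ∧ r ≠ .cur ∧ r ≠ .c ∧ r ≠ .a ∧ r ≠ .b ∧ r ≠ .k) : (parse n).KeepsReg r := by
  have h₁ : (dispatch fun l : Letter n => block [.store (Arr.tr l) Reg.a Reg.b,
      .store (Arr.tr (linv l)) Reg.b Reg.a]).KeepsReg r :=
    dispatch_keepsReg (by simp [h]) (by simp [Cmd.KeepsReg])
  simp [parse, parseWord, enqueue, Cmd.KeepsReg, h, h₁]

theorem parse_keepsArr {n : ℕ} {a : Arr n} (h : a ≠ .qa ∧ a ≠ .qb ∧ ∀ l, a ≠ .tr l) :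
    (parse n).KeepsArr a := by
  have h₁ : (dispatch fun l : Letter n => block [.store (Arr.tr l) Reg.a Reg.b,
      .store (Arr.tr (linv l)) Reg.b Reg.a]).KeepsArr a :=
    dispatch_keepsArr (by simp [Cmd.KeepsArr, h])
  simp [parse, parseWord, enqueue, Cmd.KeepsArr, h, h₁]

theorem foldLoop_keepsReg {n : ℕ} {r : Reg}
    (h : r ≠ .x ∧ r ≠ .y ∧ r ≠ .p ∧ r ≠ .q ∧ r ≠ .hd ∧ r ≠ .tl) : (foldLoop n).KeepsReg r := by
  have h₁ : (findRoot n).KeepsReg r := findRoot_keepsReg (by simp [h])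
  have h₂ : (transfer n).KeepsReg r := transfer_keepsReg (by simp [h])
  have h₃ : (linkRoots n).KeepsReg r := linkRoots_keepsReg (by simp [h])
  simp [foldLoop, Cmd.KeepsReg, h, h₁, h₂, h₃]

theorem foldLoop_keepsArr {n : ℕ} {a : Arr n}
    (h : a ≠ .par ∧ a ≠ .rk ∧ a ≠ .qa ∧ a ≠ .qb ∧ ∀ l, a ≠ .tr l) : (foldLoop n).KeepsArr a := by
  have h₁ : (findRoot n).KeepsArr a := findRoot_keepsArr (by simp [h])
  have h₂ : (transfer n).KeepsArr a := transfer_keepsArr ⟨h.2.2.2.2, by simp [h], by simp [h]⟩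
  have h₃ : (linkRoots n).KeepsArr a := linkRoots_keepsArr (by simp [h])
  simp [foldLoop, Cmd.KeepsArr, h, h₁, h₂, h₃]

/-- The construction of the folded graph, the index, the basis and the spanning tree. -/
noncomputable def construction (n : ℕ) : Cmd :=
  block [parse n, foldLoop n, flatten n, bfs n, writeBasis n]

theorem inputState_reg {n : ℕ} (J : List (Word n)) {r : Reg} (hr : r ≠ .words) :
    (inputState J).reg r = 0 := by
  have : r.num ≠ regCount := fun h => hr (Reg.num_inj.1 (h.trans (rfl : _ = Reg.words.num)))
  exact if_neg this

theorem TreeTables.card_eq {n : ℕ} {Γ : LGraph n} {ν : Γ.V → ℕ} {τ : Γ.V → Word n} {k : ℕ}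
    {tbl : Letter n → ℕ → ℕ} {parent letter : ℕ → ℕ}
    (h : TreeTables Γ ν τ k tbl parent letter) : Nat.card Γ.V = k := by
  rw [← Nat.card_range_of_injective h.inj, h.range]
  simp

/-- The value `0` for an incomplete graph agrees with the convention that `Subgroup.index` is `0`
for infinite index. -/
theorem TreeTables.index_eq {n : ℕ} {J : List (Word n)} {Γ : LGraph n} (hc : Carries J Γ)
    {ν : Γ.V → ℕ} {τ : Γ.V → Word n} {k full : ℕ} {tbl : Letter n → ℕ → ℕ} {parent letter : ℕ → ℕ}
    (h : TreeTables Γ ν τ k tbl parent letter) (hf : full = 1 ↔ ∀ v l, ∃ u, Γ.Step v l u) :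
    (if full = 1 then k else 0) = (generated J).index := by
  split_ifs with h1
  · rw [h.geo.index_of_complete hc (hf.1 h1), h.card_eq]
  · by_contra h0
    exact h.geo.not_finiteIndex hc (fun h' => h1 (hf.2 h')) ⟨fun h' => h0 h'.symm⟩

theorem TreeTables.encodesGraph {n : ℕ} {Γ : LGraph n} {ν : Γ.V → ℕ} {τ : Γ.V → Word n}
    {parent letter : ℕ → ℕ} {σ : State}
    (h : TreeTables Γ ν τ (σ.reg Reg.verts) (tblTable n σ) parent letter) : EncodesGraph σ Γ ν :=
  ⟨h.inj, h.range, h.base, fun _ _ _ hs => h.step hs, h.no_step⟩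

theorem TreeTables.encodesSpanningTree {n : ℕ} {Γ : LGraph n} {ν : Γ.V → ℕ} {τ : Γ.V → Word n}
    {k : ℕ} {tbl : Letter n → ℕ → ℕ} {σ : State}
    (h : TreeTables Γ ν τ k tbl (σ.arr (Arr.parent (n := n))) (σ.arr (Arr.letter (n := n)))) :
    EncodesSpanningTree σ Γ ν τ := by
  refine ⟨?_, h.geo.base, fun v hv => ?_⟩
  · rw [h.base]
    exact h.parent_base
  · obtain ⟨p, l, h₁, h₂, h₃, h₄, -⟩ := h.tree v hv
    exact ⟨p, l, h₁, h₂, h₃, h₄⟩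

/-- The bound is the sum of the costs of the five programs, each at most a multiple of `L * V` plus
lower terms, for fixed `n`; the number of words enters only through reading the input. The forest
and the numbering need no initialisation, because unused memory is `0`. -/
theorem construction_spec {n : ℕ} {J : List (Word n)} {Γ : LGraph n} (hΓ : IsFoldedGraphOf J Γ)
    {L V : ℕ} (hV : V = 2 * totalLength J + 1) (hL : V < tower (L + 1)) :
    WP (construction n) (inputState J) fun σ' t => (∃ ν τ U,
      EncodesGraph σ' Γ ν ∧ EncodesSpanningTree σ' Γ ν τ ∧ GeodesicTree Γ τ ∧
      σ'.reg regIndex = (generated J).index ∧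
      (IsNielsenBasis (generated J) U ∧ σ'.reg regRank = U.length ∧
        σ'.Holds arrBasis (encodeWords U))) ∧
      t ≤ (16 * n + 20) * V + 20 * J.length + (24 * (L + 2) + 28 * n + 40) * (V + 2 * n * V) +
        24 * L * V + (12 * (L + 2) + 10) * V + 24 * L * V + (40 * n + 10) * V + 12 * V +
        (50 * n + 5) * V + 8 * n + 60 := by
  have hf := hΓ.2
  have hc := hΓ.carries
  have hS := hf.isInverse
  unfold construction
  simp only [wp_block_cons, wp_block_nil]
  refine (parse_spec hS hc.loop).frame.mono ?_
  rintro σ₁ t₁ ⟨⟨⟨φ, h₁⟩, ht₁⟩, hfr₁⟩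
  have hnv : σ₁.reg Reg.nv = V := by
    rw [h₁.nv, hV]
    rfl
  have hinv := h₁.inv
  have hloops := h₁.loops
  rw [hnv] at hinv hloops
  have htl := h₁.tl
  rw [List.length_nil] at htl
  refine (foldLoop_spec h₁.zero hL hinv.data
    ((hfr₁.reg Reg.hd (parse_keepsReg (by simp))).trans (inputState_reg J (by simp)))
    ((hfr₁.arr (Arr.par (n := n)) (parse_keepsArr (by simp))).trans (inputState_arr J (by simp)))
    ((hfr₁.arr (Arr.rk (n := n)) (parse_keepsArr (by simp))).trans
      (inputState_arr J (by simp)))).frame.mono ?_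
  rintro σ₂ t₂ ⟨⟨rep, huf, hfold, hjoin, ht₂⟩, hfr₂⟩
  have hroot := hfold.rootGraph hf hc hinv hloops huf hjoin
  have z₂ := (hfr₂.reg Reg.zero (foldLoop_keepsReg (by simp))).trans h₁.zero
  have o₂ := (hfr₂.reg Reg.one (foldLoop_keepsReg (by simp))).trans h₁.one
  have n₂ := (hfr₂.reg Reg.nv (foldLoop_keepsReg (by simp))).trans hnv
  have u₂ := ((hfr₂.arr (Arr.num (n := n)) (foldLoop_keepsArr (by simp))).trans
    (hfr₁.arr (Arr.num (n := n)) (parse_keepsArr (by simp)))).trans (inputState_arr J (by simp))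
  refine (flatten_spec z₂ n₂ hL huf).frame.mono ?_
  rintro σ₃ t₃ ⟨⟨hrt, ht₃⟩, hfr₃⟩
  have z₃ := (hfr₃.reg Reg.zero (flatten_keepsReg (by simp))).trans z₂
  have o₃ := (hfr₃.reg Reg.one (flatten_keepsReg (by simp))).trans o₂
  have u₃ := (hfr₃.arr (Arr.num (n := n)) (flatten_keepsArr (by simp))).trans u₂
  have tr₃ : trTable n σ₃ = trTable n σ₂ :=
    funext fun l => hfr₃.arr (Arr.tr l) (flatten_keepsArr (by simp))
  have hroot₃ : RootGraph Γ φ V (trTable n σ₃) (σ₃.arr (Arr.rt (n := n))) := by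
    rw [tr₃]
    exact hroot.congr hrt
  refine (bfs_spec hroot₃ z₃ o₃ u₃).frame.mono ?_
  rintro σ₄ t₄ ⟨⟨⟨i, full, hi, hbfs, hidx⟩, ht₄⟩, hfr₄⟩
  obtain ⟨ν, τ, htt, hfull⟩ := hbfs.treeTables hf hc hroot₃ hi
  have hle := hbfs.le_nodes
  have z₄ := (hfr₄.reg Reg.zero (bfs_keepsReg (by simp))).trans z₃
  have o₄ := (hfr₄.reg Reg.one (bfs_keepsReg (by simp))).trans o₃
  refine (writeBasis_spec hc htt z₄ o₄).frame.mono ?_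
  rintro σ₅ t₅ ⟨⟨⟨U, hU⟩, ht₅⟩, hfr₅⟩
  have v₅ := hfr₅.reg Reg.verts (writeBasis_keepsReg (by simp))
  have i₅ := hfr₅.reg Reg.index (writeBasis_keepsReg (by simp))
  have p₅ := hfr₅.arr (Arr.parent (n := n)) (writeBasis_keepsArr (by simp))
  have l₅ := hfr₅.arr (Arr.letter (n := n)) (writeBasis_keepsArr (by simp))
  have tb₅ : tblTable n σ₅ = tblTable n σ₄ :=
    funext fun l => hfr₅.arr (Arr.tbl l) (writeBasis_keepsArr (by simp))
  have htt' := htt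
  rw [← v₅, ← p₅, ← l₅, ← tb₅] at htt'
  refine ⟨⟨ν, τ, U, htt'.encodesGraph, htt'.encodesSpanningTree, htt.geo, ?_, hU⟩, ?_⟩
  · exact (i₅.trans hidx).trans (htt.index_eq hc hfull)
  · have e₁ : (16 * n + 20) * totalLength J ≤ (16 * n + 20) * V :=
      Nat.mul_le_mul_left _ (by omega)
    have e₂ : (24 * (L + 2) + 28 * n + 40) * (σ₁.reg Reg.tl + 2 * n * V) ≤
        (24 * (L + 2) + 28 * n + 40) * (V + 2 * n * V) := Nat.mul_le_mul_left _ (by omega)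
    have e₃ : (50 * n + 5) * σ₄.reg Reg.verts ≤ (50 * n + 5) * V := Nat.mul_le_mul_left _ hle
    omega

/-- A linear function of `N` times a linear function of `logStar N`, for all but finitely many
`N`, is bounded by a multiple of `N * logStar N`. -/
theorem logStar_bound (N : ℕ) : (logStar N + 1) * (N + 1) ≤
    (4 + (logStar 0 + 1) + 2 * (logStar 1 + 1)) * (N * logStar N + 1) := by
  rcases Nat.lt_or_ge N 2 with h | h
  · interval_cases N
    · nlinarith
    · nlinarith
  -- For `N ≥ 2` the iterated logarithm is positive, and each of the four terms of the expanded
  -- product is at most `N * logStar N + 1`; this is the `4` in the constant. The other summands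
  -- settle `N = 0` and `N = 1`.
  · have := one_le_logStar h
    nlinarith [Nat.mul_le_mul h this]

end Folding

theorem mainTheorem2 (n : ℕ) :
    ∃ (build query : Folding.Cmd) (C : ℕ),
      -- construction of the folded graph, index, Nielsen basis and Schreier transversal
      (∀ J : List (Folding.Word n),
        ∃ (t : ℕ) (σ : Folding.State) (Γ : Folding.LGraph n) (ν : Γ.V → ℕ)
          (U : List (Folding.Word n)) (τ : Γ.V → Folding.Word n),
          Folding.Exec build (Folding.inputState J) t σ ∧
          t ≤ C * (Folding.totalLength J * Folding.logStar (Folding.totalLength J)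
                + J.length + 1) ∧
          Folding.IsFoldedGraphOf J Γ ∧
          Folding.EncodesGraph σ Γ ν ∧
          σ.reg Folding.regIndex = (Folding.generated J).index ∧
          (Folding.IsNielsenBasis (Folding.generated J) U ∧
            σ.reg Folding.regRank = U.length ∧
            σ.Holds Folding.arrBasis (Folding.encodeWords U)) ∧
          (Folding.EncodesSpanningTree σ Γ ν τ ∧
            Folding.IsSchreierTransversal (Folding.generated J) (Γ.treeTransversal τ) ∧
            ((Folding.generated J).FiniteIndex →
              Γ.treeTransversal τ = Set.range fun v => FreeGroup.mk (τ v)))) ∧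
      -- membership, given any memory that contains the folded graph
      (∀ (J : List (Folding.Word n)) (Γ : Folding.LGraph n) (ν : Γ.V → ℕ)
        (σ : Folding.State) (w : Folding.Word n),
        Folding.IsFoldedGraphOf J Γ → Folding.EncodesGraph σ Γ ν →
        σ.Holds Folding.arrQuery (Folding.encodeWord w) →
        ∃ (t : ℕ) (σ' : Folding.State),
          Folding.Exec query σ t σ' ∧
          t ≤ C * (w.length + 1) ∧
          (FreeGroup.mk w ∈ Folding.generated J → σ'.reg Folding.regAnswer = 1) ∧
          (FreeGroup.mk w ∉ Folding.generated J → σ'.reg Folding.regAnswer = 0) ∧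
          Folding.EncodesGraph σ' Γ ν) := by
  open Folding in
  -- `B` is the factor of `logStar_bound`. `K` dominates the coefficients in `construction_spec`,
  -- which are at most quadratic in `n`, and the rest of the constant is for the membership program.
  set B := 4 + (logStar 0 + 1) + 2 * (logStar 1 + 1) with hB
  set K := 1000 * (n + 1) * (n + 1) with hK
  refine ⟨construction n, membership n, K * B + 22 * n + 60, fun J => ?_,
    fun J Γ ν σ w hΓ hE hq => ?_⟩
  -- The folded graph is obtained abstractly; the program is then shown to compute a numbered copy
  -- of it.
  · obtain ⟨Γ, hΓ⟩ := exists_isFoldedGraphOf J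
    set N := totalLength J with hN
    have hlog := logStar_bound N
    rw [← hB] at hlog
    obtain ⟨t, σ, hex, ⟨ν, τ, U, h₁, h₂, h₃, h₄, h₅⟩, ht⟩ :=
      -- The choice of `L` is dictated by `V = 2 * N + 1 < tower (logStar N + 3)`.
      construction_spec hΓ (L := logStar N + 2) rfl (lt_tower_logStar N)
    refine ⟨t, σ, Γ, ν, U, τ, hex, ?_, hΓ, h₁, h₄, h₅, h₂, h₃.isSchreierTransversal hΓ.carries,
      fun hfin => ?_⟩
    · have hcost : t ≤ K * ((logStar N + 1) * (N + 1)) + 20 * J.length := by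
        refine ht.trans ?_
        rw [hK]
        generalize logStar N = l
        nlinarith [Nat.zero_le (n * n * l * N), Nat.zero_le (n * n * l), Nat.zero_le (n * n * N),
          Nat.zero_le (n * l * N), Nat.zero_le (n * n), Nat.zero_le (n * l), Nat.zero_le (n * N),
          Nat.zero_le (l * N)]
      have h₆ : K * ((logStar N + 1) * (N + 1)) ≤ K * (B * (N * logStar N + 1)) :=
        Nat.mul_le_mul_left _ hlog
      have h₇ : (K * B + 22 * n + 60) * (N * logStar N + J.length + 1) =
          K * (B * (N * logStar N + 1)) + 20 * J.length + (K * B * J.length +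
          (22 * n + 40) * J.length + (22 * n + 60) * (N * logStar N + 1)) := by ring
      omega
    -- Finite index forces every letter to be readable at every vertex, so no words `s` other than
    -- the empty one occur in the transversal.
    · exact GeodesicTree.treeTransversal_of_complete (by
        by_contra hcomp
        exact h₃.not_finiteIndex hΓ.carries hcomp hfin)
  · obtain ⟨t, σ', hex, ht, h₁, h₂, h₃⟩ := membership_spec hΓ hE hq
    refine ⟨t, σ', hex, ht.trans (Nat.mul_le_mul_right _ (by omega)), h₁, h₂, h₃⟩
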